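/- Let $p$ be a prime, $B$ a perfect ring of characteristic $p$ (i.e. a nonzero perfect $\mathbb{F}_p$-algebra), $n\ge 0$, and $$C:=B[x_1^{p^{-\infty}},\ldots,x_n^{p^{-\infty}}]/(x_1,\ldots,x_n),$$ where $B[x_1^{p^{-\infty}},\ldots,x_n^{p^{-\infty}}]$ is the ring of finite sums $\sum_\alpha b_\alpha x^\alpha$ with $b_\alpha\in B$, $\alpha\in\mathbb{Z}_+[1/p]^n$, $\mathbb{Z}_+[1/p]=\{a\in\mathbb{Z}[1/p] : a\ge 0\}$. Notation. Let $C^\flat$ be the inverse limit of $\cdots\to C\to C\to C$ along the Frobenius maps $c\mapsto c^p$, and $\nu_k:C^\flat\to C$, $(c_0,c_1,\ldots)\mapsto c_k$, for $k\ge 0$; $C^\flat$ carries the inverse limit topology, for which the ideals $\operatorname{Ker}\nu_k$ form a basis of neighbourhoods of $0$. Let $W(C^\flat)$ be the ring of $p$-typical Witt vectors, with Frobenius $F$, Verschiebung $V$ and Teichmüller lifts $[c]$. Let $A_{\mathrm{cris}}(C)$ be the $p$-adic completion of the PD hull of the surjection $W(C^\flat)\to C$ induced by $\nu_0$ (divided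 powers compatible with the canonical ones on $(p)$), with divided powers $\gamma_m$, with its $p$-adic topology and with the endomorphism $F$ induced by the Frobenius of $C$. Put $$A'_{\mathrm{cris}}(C):=\{u\in A_{\mathrm{cris}}(C) : p^m u\in F^m(A_{\mathrm{cris}}(C))\text{ for all } m\ge 0\},$$ which is a $W(C^\flat)$-submodule of $A_{\mathrm{cris}}(C)$ stable under $F$. Let $\overline{M}(C)$ be Fontaine's module of Witt bivectors: the set of formal expressions $\sum_{m\in\mathbb{Z}}V^m[x_m]$ with $x_m\in C^\flat$, such that $x_m\in\operatorname{Ker}\nu_0$ for $m<0$ and the ideal $I\subset C^\flat$ generated by $x_{-1},x_{-2},\ldots$ is topologically nilpotent (for each $k$ there is an $r$ with $I^r\subset\operatorname{Ker}\nu_k$). Its sum is the coordinatewise limit, as $N\to\infty$, of the sums of the truncations $\sum_{m\ge -N}V^m[x_m]$, computed in $V^{-N}W(C^\flat)$; the action of $a\in W(C^\flat)$ is the coordinatewise limit of its action on the truncations, where $a\cdot V^{-N}w=V^{-N}(F^{-N}(a)\,w)$; and $F\big(\sum_m V^m[x_m]\big)=\sum_m V^m[x_m^p]$. **Proposition.**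 For every element of $\overline{M}(C)$ the series below converges in $A_{\mathrm{cris}}(C)$, and the map $$\bar f\Big(\sum_{m\in\mathbb{Z}}V^m[x_m]\Big):=\sum_{m=0}^{\infty}V^m[x_m]+\sum_{l=1}^{\infty}(p^l-1)!\cdot\gamma_{p^l}([x_{-l}])$$ (where the first sum is the element of $A_{\mathrm{cris}}(C)$ defined by an element of $W(C^\flat)$) takes values in $A'_{\mathrm{cris}}(C)$ and is an isomorphism $\bar f:\overline{M}(C)\to A'_{\mathrm{cris}}(C)$ of $W(C^\flat)$-modules that commutes with $F$. -/

import Mathlib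

set_option linter.unusedSectionVars false

namespace Fontaine
open WittVector
variable {p : ℕ} [hp : Fact p.Prime] {R : Type*} [CommRing R]

/-- The Witt vector `(c_1, c_2, …)` obtained from `c = (c_0, c_1, …)` by deleting `c_0`. -/
def wtl (c : WittVector p R) : WittVector p R := WittVector.mk p fun i => c.coeff (i + 1)

lemma cons_coeff_zero (a : R) (b : WittVector p R) :
    (teichmuller p a + verschiebung b).coeff 0 = a := by
  rw [coeff_add_of_disjoint]
  · simp
  · intro n; cases n with
    | zero => right; simp
    | succ n => left; exact teichmuller_coeff_pos p a _ (Nat.succ_pos n)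

lemma cons_coeff_succ (a : R) (b : WittVector p R) (i : ℕ) :
    (teichmuller p a + verschiebung b).coeff (i + 1) = b.coeff i := by
  rw [coeff_add_of_disjoint]
  · simp [teichmuller_coeff_pos p a (i+1) (Nat.succ_pos i)]
  · intro n; cases n with
    | zero => right; simp
    | succ n => left; exact teichmuller_coeff_pos p a _ (Nat.succ_pos n)

lemma eq_cons (c : WittVector p R) :
    c = teichmuller p (c.coeff 0) + verschiebung (wtl c) := by
  ext i
  cases i with
  | zero => rw [cons_coeff_zero]
  | succ i => rw [cons_coeff_succ]; rfl

lemma wtl_cons (a : R) (b : WittVector p R) :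
    wtl (teichmuller p a + verschiebung b) = b := by
  ext i; exact cons_coeff_succ a b i

lemma add_coeff_zero' (c d : WittVector p R) : (c + d).coeff 0 = c.coeff 0 + d.coeff 0 :=
  (constantCoeff (p := p)).map_add c d

lemma wtl_add (c d : WittVector p R) :
    wtl (c + d) = wtl (teichmuller p (c.coeff 0) + teichmuller p (d.coeff 0)) + wtl c + wtl d := by
  have h : c + d = teichmuller p (c.coeff 0 + d.coeff 0) + verschiebung
      (wtl (teichmuller p (c.coeff 0) + teichmuller p (d.coeff 0)) + wtl c + wtl d) := by
    have h1 := eq_cons (teichmuller p (c.coeff 0) + teichmuller p (d.coeff 0))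
    rw [add_coeff_zero', teichmuller_coeff_zero, teichmuller_coeff_zero] at h1
    rw [verschiebung.map_add, verschiebung.map_add, ← add_assoc, ← add_assoc, ← h1]
    conv_lhs => rw [eq_cons c, eq_cons d]
    abel
  rw [h, wtl_cons]

section charp
variable [CharP R p]

lemma frob_teich (t : R) : WittVector.frobenius (teichmuller p t) = teichmuller p (t ^ p) := by
  rw [frobenius_eq_map_frobenius, map_teichmuller]; rfl

lemma teich_mul_eq (t : R) (w : WittVector p R) : teichmuller p t * w =
    teichmuller p (t * w.coeff 0) + verschiebung (teichmuller p (t ^ p) * wtl w) := by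
  conv_lhs => rw [eq_cons w, mul_add, ← map_mul]
  rw [← frob_teich, mul_comm (WittVector.frobenius _), verschiebung_mul_frobenius, mul_comm (verschiebung _)]

lemma teich_mul_coeff (j : ℕ) (t : R) (w : WittVector p R) :
    (teichmuller p t * w).coeff j = t ^ p ^ j * w.coeff j := by
  induction j generalizing t w with
  | zero => rw [teich_mul_eq, cons_coeff_zero]; simp
  | succ j ih => rw [teich_mul_eq, cons_coeff_succ, ih, ← pow_mul, pow_succ']; rfl

lemma wtl_mul (a c : WittVector p R) :
    wtl (a * c) = wtl (a * teichmuller p (c.coeff 0)) + WittVector.frobenius a * wtl c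
      ∧ (a * c).coeff 0 = a.coeff 0 * c.coeff 0 := by
  refine ⟨?_, (constantCoeff (p := p)).map_mul a c⟩
  have h : a * c = teichmuller p (a.coeff 0 * c.coeff 0) + verschiebung
      (wtl (a * teichmuller p (c.coeff 0)) + WittVector.frobenius a * wtl c) := by
    have h1 := eq_cons (a * teichmuller p (c.coeff 0))
    have h0 : (a * teichmuller p (c.coeff 0)).coeff 0 = a.coeff 0 * c.coeff 0 := by
      rw [mul_comm, teich_mul_coeff]; simp [mul_comm]
    rw [h0] at h1
    rw [verschiebung.map_add, ← add_assoc, ← h1]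
    conv_lhs => rw [eq_cons c, mul_add]
    rw [mul_comm (WittVector.frobenius a), verschiebung_mul_frobenius, mul_comm a (verschiebung _)]
  rw [h, wtl_cons]



open MvPolynomial in
lemma coeff_aeval_smul (K : Type*) [CommRing K] [Algebra K R] (P : MvPolynomial (Fin 2) K)
    (v : Fin 2 → R) (d : ℕ) :
    (aeval (fun i => Polynomial.C (v i) * Polynomial.X) P : Polynomial R).coeff d
      = aeval v (homogeneousComponent d P) := by
  induction P using MvPolynomial.induction_on' with
  | add a b ha hb => simp only [map_add, Polynomial.coeff_add, ha, hb]
  | monomial m c =>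
    rw [homogeneousComponent_of_mem (isHomogeneous_monomial c (n := m.degree) rfl)]
    have h1 : (aeval (fun i => Polynomial.C (v i) * Polynomial.X) (monomial m c) : Polynomial R)
        = Polynomial.C (aeval v (monomial m c)) * Polynomial.X ^ m.degree := by
      simp only [aeval_monomial, Finsupp.prod_fintype, mul_pow, pow_zero, implies_true,
        Finsupp.degree_eq_sum]
      simp [Polynomial.algebraMap_apply]
      ring
    rw [h1, Polynomial.coeff_C_mul_X_pow]
    split_ifs <;> simp

variable (R) in
open MvPolynomial in
/-- The `j`-th coordinate of `[x] + [y]` is a homogeneous polynomial of degree `p ^ j`. -/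
lemma exists_homog [Algebra (ZMod p) R] (j : ℕ) :
    ∃ Q : MvPolynomial (Fin 2) (ZMod p), Q.IsHomogeneous (p ^ j) ∧
    ∀ (v : Fin 2 → R),
      (teichmuller p (v 0) + teichmuller p (v 1)).coeff j = aeval v Q := by
  set P : MvPolynomial (Fin 2) (ZMod p) :=
    (teichmuller p (X 0) + teichmuller p (X 1) : WittVector p _).coeff j with hP
  have key : ∀ (S : Type _) [CommRing S] [Algebra (ZMod p) S] (v : Fin 2 → S),
      (teichmuller p (v 0) + teichmuller p (v 1)).coeff j = aeval v P := by
    intro S _ _ v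
    have := WittVector.map_coeff (aeval v : MvPolynomial (Fin 2) (ZMod p) →ₐ[ZMod p] S).toRingHom
      (teichmuller p (X 0) + teichmuller p (X 1)) j
    rw [map_add, map_teichmuller, map_teichmuller] at this
    simpa [P] using this
  refine ⟨homogeneousComponent (p ^ j) P, homogeneousComponent_isHomogeneous _ _, fun v => ?_⟩
  rw [← coeff_aeval_smul, ← key, mul_comm, mul_comm (Polynomial.C (v 1)),
    (teichmuller p).map_mul, (teichmuller p).map_mul, ← mul_add,
    teich_mul_coeff, Polynomial.coeff_X_pow_mul', if_pos le_rfl, Nat.sub_self,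
    ← map_teichmuller, ← map_teichmuller, ← RingHom.map_add, WittVector.map_coeff,
    Polynomial.coeff_C_zero]

lemma homog_diff (I : Ideal R) (A : ℕ → Ideal R) (hA : ∀ q, I * A q ≤ A (q + 1))
    (v v' : Fin 2 → R) (hv : ∀ i, v i ∈ I) (hv' : ∀ i, v' i ∈ I) (h d : ℕ)
    (hd : ∀ i, v i - v' i ∈ A h) [Algebra (ZMod p) R] (hd0 : 0 < d)
    (Q : MvPolynomial (Fin 2) (ZMod p)) (hQ : Q.IsHomogeneous d) :
    MvPolynomial.aeval v Q - MvPolynomial.aeval v' Q ∈ A (h + (d - 1)) := by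
  have hI : ∀ n, I ^ n * A h ≤ A (h + n) := by
    intro n
    induction n with
    | zero => simp
    | succ n ih =>
      rw [pow_succ', mul_assoc]
      exact (Ideal.mul_mono_right ih).trans (hA _)
  let D : ℕ → R → R → Prop := fun a u u' => u ∈ I ^ a ∧ u' ∈ I ^ a ∧
    (0 < a → u - u' ∈ I ^ (a - 1) * A h) ∧ (a = 0 → u = u')
  have D0 : D 0 1 1 := ⟨by simp, by simp, by simp, fun _ => rfl⟩
  have D1 : ∀ i, D 1 (v i) (v' i) := fun i => ⟨by simpa using hv i, by simpa using hv' i,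
    fun _ => by simpa using hd i, by simp⟩
  have Dm : ∀ a b u u' w w', D a u u' → D b w w' → D (a + b) (u * w) (u' * w') := by
    rintro a b u u' w w' ⟨h1, h2, h3, h4⟩ ⟨k1, k2, k3, k4⟩
    refine ⟨?_, ?_, ?_, ?_⟩
    · rw [pow_add]; exact Ideal.mul_mem_mul h1 k1
    · rw [pow_add]; exact Ideal.mul_mem_mul h2 k2
    · intro hab
      have e : u * w - u' * w' = w * (u - u') + u' * (w - w') := by ring
      rw [e]
      refine Ideal.add_mem _ ?_ ?_
      · rcases Nat.eq_zero_or_pos a with ha | ha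
        · rw [h4 ha]; simp
        · have : a + b - 1 = b + (a - 1) := by omega
          rw [this, pow_add, mul_assoc]
          exact Ideal.mul_mem_mul k1 (h3 ha)
      · rcases Nat.eq_zero_or_pos b with hb | hb
        · rw [k4 hb]; simp
        · have : a + b - 1 = a + (b - 1) := by omega
          rw [this, pow_add, mul_assoc]
          exact Ideal.mul_mem_mul h2 (k3 hb)
    · intro hab
      rw [h4 (by omega), k4 (by omega)]
  have Dp : ∀ i a, D a (v i ^ a) (v' i ^ a) := by
    intro i a
    induction a with
    | zero => simpa using D0
    | succ a ih => rw [pow_succ, pow_succ]; exact Dm _ _ _ _ _ _ ih (D1 i)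
  rw [MvPolynomial.aeval_def, MvPolynomial.aeval_def, MvPolynomial.eval₂_eq, MvPolynomial.eval₂_eq,
    ← Finset.sum_sub_distrib]
  refine Ideal.sum_mem _ fun m hm => ?_
  rw [← mul_sub]
  refine Ideal.mul_mem_left _ _ ?_
  have hdeg : m 0 + m 1 = d := by
    have := hQ (MvPolynomial.mem_support_iff.mp hm)
    rw [← this, Finsupp.weight_apply, Finsupp.sum_fintype _ _ (by simp)]
    simp
  have h5 := (Dm _ _ _ _ _ _ (Dp 0 (m 0)) (Dp 1 (m 1))).2.2.1 (by omega)
  rw [hdeg] at h5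
  have e : ∀ w : Fin 2 → R, ∏ i ∈ m.support, w i ^ m i = w 0 ^ m 0 * w 1 ^ m 1 := by
    intro w
    rw [← Fin.prod_univ_two (fun i => w i ^ m i)]
    refine Finset.prod_subset (Finset.subset_univ _) fun i _ hi => ?_
    rw [Finsupp.notMem_support_iff.mp hi, pow_zero]
  rw [e, e]
  exact hI _ h5


lemma teich_add_congr (K : Ideal R) (x x' y y' : R) (hx : x - x' ∈ K) (hy : y - y' ∈ K) (j : ℕ) :
    (teichmuller p x + teichmuller p y).coeff j - (teichmuller p x' + teichmuller p y').coeff j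
      ∈ K := by
  rw [← Ideal.Quotient.mk_eq_mk_iff_sub_mem] at *
  rw [← WittVector.map_coeff, ← WittVector.map_coeff, map_add, map_add, map_teichmuller,
    map_teichmuller, map_teichmuller, map_teichmuller, hx, hy]

lemma teich_add_mem (K : Ideal R) (x y : R) (hx : x ∈ K) (hy : y ∈ K) (j : ℕ) :
    (teichmuller p x + teichmuller p y).coeff j ∈ K := by
  have := teich_add_congr (p := p) K x 0 y 0 (by simpa) (by simpa) j
  rw [teichmuller_zero, add_zero, WittVector.zero_coeff, sub_zero] at this
  exact this

lemma add_coeff_succ' (c d : WittVector p R) (j : ℕ) : (c + d).coeff (j + 1) =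
    (wtl (teichmuller p (c.coeff 0) + teichmuller p (d.coeff 0)) + wtl c + wtl d).coeff j := by
  rw [← wtl_add]; rfl

lemma mul_coeff_succ' (a c : WittVector p R) (j : ℕ) : (a * c).coeff (j + 1) =
    (wtl (a * teichmuller p (c.coeff 0)) + WittVector.frobenius a * wtl c).coeff j := by
  rw [← (wtl_mul a c).1]; rfl

lemma wtl_coeff (c : WittVector p R) (j : ℕ) : (wtl c).coeff j = c.coeff (j + 1) := rfl

lemma add_coeff_mem (I : Ideal R) (j : ℕ) : ∀ c d : WittVector p R,
    (∀ i ≤ j, c.coeff i ∈ I) → (∀ i ≤ j, d.coeff i ∈ I) → (c + d).coeff j ∈ I := by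
  induction j using Nat.strong_induction_on with
  | _ j ih =>
    intro c d hc hd
    cases j with
    | zero => rw [add_coeff_zero']; exact I.add_mem (hc 0 le_rfl) (hd 0 le_rfl)
    | succ j =>
      rw [add_coeff_succ']
      refine ih j (by omega) _ _ (fun i hi => ih i (by omega) _ _ (fun k hk => ?_) (fun k hk => ?_))
        (fun i hi => ?_)
      · rw [wtl_coeff]; exact teich_add_mem I _ _ (hc 0 (by omega)) (hd 0 (by omega)) _
      · rw [wtl_coeff]; exact hc _ (by omega)
      · rw [wtl_coeff]; exact hd _ (by omega)

lemma mul_teich_coeff (a : WittVector p R) (x : R) (j : ℕ) :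
    (a * teichmuller p x).coeff j = x ^ p ^ j * a.coeff j := by
  rw [mul_comm, teich_mul_coeff]

lemma mul_coeff_mem (I : Ideal R) (j : ℕ) : ∀ a c : WittVector p R,
    (∀ i ≤ j, c.coeff i ∈ I) → (a * c).coeff j ∈ I := by
  induction j using Nat.strong_induction_on with
  | _ j ih =>
    intro a c hc
    cases j with
    | zero => rw [(wtl_mul a c).2]; exact I.mul_mem_left _ (hc 0 le_rfl)
    | succ j =>
      rw [mul_coeff_succ']
      refine add_coeff_mem I j _ _ (fun i hi => ?_) (fun i hi => ih i (by omega) _ _ (fun k hk => ?_))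
      · rw [wtl_coeff, mul_teich_coeff]
        exact I.mul_mem_right _ (I.pow_mem_of_mem (hc 0 (by omega)) _ (pow_pos hp.out.pos _))
      · rw [wtl_coeff]; exact hc _ (by omega)

/-- The growth condition on the exponents of the congruences. -/
def Adm (p : ℕ) (q : ℕ → ℕ) (L : ℕ) : Prop :=
  (∀ i, q (i + 1) ≤ q i + (p - 1)) ∧ ∀ i, L ≤ i → q (i + 1) ≤ q i

lemma Adm.shift {q : ℕ → ℕ} {L : ℕ} (h : Adm p q L) : Adm p (fun i => q (i + 1)) (L - 1) :=
  ⟨fun i => h.1 _, fun i hi => h.2 _ (by omega)⟩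

lemma Adm.le_zero {q : ℕ → ℕ} (h : Adm p q 0) (i : ℕ) : q i ≤ q 0 := by
  induction i with
  | zero => exact le_rfl
  | succ i ih => exact (h.2 i (Nat.zero_le _)).trans ih

lemma Adm.le_pow {q : ℕ → ℕ} {L : ℕ} (h : Adm p q L) (i : ℕ) : q i ≤ q 0 + (p ^ i - 1) := by
  have h1 : q i ≤ q 0 + i * (p - 1) := by
    induction i with
    | zero => simp
    | succ i ih => have := h.1 i; rw [add_mul]; omega
  have h2 : 1 + i * (p - 1) ≤ p ^ i := by
    have h3 := hp.out.one_lt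
    have := one_add_mul_le_pow (R := ℤ) (a := (p : ℤ) - 1) (by omega) i
    zify [h3.le]
    simpa using this
  omega

lemma teich_add_filt (I : Ideal R) (A : ℕ → Ideal R) (hA : ∀ q, I * A q ≤ A (q + 1))
    (hA' : Antitone A) {q : ℕ → ℕ} {L : ℕ} (hq : Adm p q L) (x x' y y' : R)
    (hI : 0 < L → x ∈ I ∧ x' ∈ I ∧ y ∈ I ∧ y' ∈ I) (hx : x - x' ∈ A (q 0)) (hy : y - y' ∈ A (q 0))
    (i : ℕ) : (teichmuller p x + teichmuller p y).coeff i
      - (teichmuller p x' + teichmuller p y').coeff i ∈ A (q i) := by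
  rcases Nat.eq_zero_or_pos L with rfl | hL
  · exact hA' (hq.le_zero i) (teich_add_congr _ _ _ _ _ hx hy i)
  · let _ := ZMod.algebra R p
    obtain ⟨Q, hQ, hQ'⟩ := exists_homog (p := p) R i
    obtain ⟨h1, h2, h3, h4⟩ := hI hL
    have := homog_diff (p := p) I A hA ![x, y] ![x', y']
      (by intro i; fin_cases i <;> simpa) (by intro i; fin_cases i <;> simpa) (q 0) (p ^ i)
      (by intro i; fin_cases i <;> simpa) (pow_pos hp.out.pos _) Q hQ
    rw [← hQ', ← hQ'] at this
    exact hA' (hq.le_pow i) this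

lemma pow_filt (I : Ideal R) (A : ℕ → Ideal R) (hA : ∀ q, I * A q ≤ A (q + 1))
    (hA' : Antitone A) {q : ℕ → ℕ} {L : ℕ} (hq : Adm p q L) (x x' : R)
    (hI : 0 < L → x ∈ I ∧ x' ∈ I) (hx : x - x' ∈ A (q 0))
    (i : ℕ) : x ^ p ^ i - x' ^ p ^ i ∈ A (q i) := by
  rcases Nat.eq_zero_or_pos L with rfl | hL
  · exact hA' (hq.le_zero i) (Ideal.mem_of_dvd _ (sub_dvd_pow_sub_pow _ _ _) hx)
  · let _ := ZMod.algebra R p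
    obtain ⟨h1, h2⟩ := hI hL
    have := homog_diff (p := p) I A hA (fun _ => x) (fun _ => x')
      (fun _ => h1) (fun _ => h2) (q 0) (p ^ i)
      (fun _ => hx) (pow_pos hp.out.pos _) (MvPolynomial.X 0 ^ p ^ i)
      (by simpa using (MvPolynomial.isHomogeneous_X (ZMod p) (0 : Fin 2)).pow (p ^ i))
    simp only [map_pow, MvPolynomial.aeval_X] at this
    exact hA' (hq.le_pow i) this

/-- If the first coordinates of two pairs of Witt vectors lie in `I` and the coordinates
are congruent modulo a filtration, the same holds for the coordinates of the sums. -/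
lemma add_filt (I : Ideal R) (A : ℕ → Ideal R) (hA : ∀ q, I * A q ≤ A (q + 1))
    (hA' : Antitone A) (j : ℕ) : ∀ (q : ℕ → ℕ) (L : ℕ) (c c' d d' : WittVector p R), Adm p q L →
      (∀ i, i < L → i ≤ j → c.coeff i ∈ I ∧ c'.coeff i ∈ I ∧ d.coeff i ∈ I ∧ d'.coeff i ∈ I) →
      (∀ i, i ≤ j → c.coeff i - c'.coeff i ∈ A (q i) ∧ d.coeff i - d'.coeff i ∈ A (q i)) →
      (c + d).coeff j - (c' + d').coeff j ∈ A (q j) := by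
  induction j using Nat.strong_induction_on with
  | _ j ih =>
    intro q L c c' d d' hq hI hc
    cases j with
    | zero =>
      rw [add_coeff_zero', add_coeff_zero', add_sub_add_comm]
      exact (A _).add_mem (hc 0 le_rfl).1 (hc 0 le_rfl).2
    | succ j =>
      rw [add_coeff_succ', add_coeff_succ']
      have hI0 := fun hL => hI 0 hL (by omega)
      have hI1 := fun i hi hij => hI (i + 1) hi hij
      have g1 : ∀ k, 0 < L → (wtl (teichmuller p (c.coeff 0) + teichmuller p (d.coeff 0))).coeff k
          ∈ I := fun k hL => by
        rw [wtl_coeff]; exact teich_add_mem I _ _ (hI0 hL).1 (hI0 hL).2.2.1 (k + 1)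
      have g2 : ∀ k, 0 < L → (wtl (teichmuller p (c'.coeff 0) + teichmuller p (d'.coeff 0))).coeff k
          ∈ I := fun k hL => by
        rw [wtl_coeff]; exact teich_add_mem I _ _ (hI0 hL).2.1 (hI0 hL).2.2.2 (k + 1)
      have g3 : ∀ k, (wtl (teichmuller p (c.coeff 0) + teichmuller p (d.coeff 0))).coeff k
          - (wtl (teichmuller p (c'.coeff 0) + teichmuller p (d'.coeff 0))).coeff k
          ∈ A (q (k + 1)) := fun k => by
        rw [wtl_coeff, wtl_coeff]
        exact teich_add_filt I A hA hA' hq _ _ _ _ hI0 (hc 0 (by omega)).1 (hc 0 (by omega)).2 (k + 1)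
      generalize wtl (teichmuller p (c.coeff 0) + teichmuller p (d.coeff 0)) = g at *
      generalize wtl (teichmuller p (c'.coeff 0) + teichmuller p (d'.coeff 0)) = g' at *
      have s1 : ∀ i ≤ j, (g + wtl c).coeff i - (g' + wtl c').coeff i ∈ A (q (i + 1)) := by
        intro i hi
        exact ih i (by omega) (fun i => q (i + 1)) (L - 1) g g' (wtl c) (wtl c') hq.shift
          (fun k hk hki => ⟨g1 k (by omega), g2 k (by omega), (hI1 k (by omega) (by omega)).1,
            (hI1 k (by omega) (by omega)).2.1⟩)
          (fun k hk => ⟨g3 k, (hc (k + 1) (by omega)).1⟩)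
      have s2 : ∀ i, i < L - 1 → i ≤ j → (g + wtl c).coeff i ∈ I := fun i hi hij =>
        add_coeff_mem I i g (wtl c) (fun k hk => g1 k (by omega))
          (fun k hk => (hI1 k (by omega) (by omega)).1)
      have s3 : ∀ i, i < L - 1 → i ≤ j → (g' + wtl c').coeff i ∈ I := fun i hi hij =>
        add_coeff_mem I i g' (wtl c') (fun k hk => g2 k (by omega))
          (fun k hk => (hI1 k (by omega) (by omega)).2.1)
      exact ih j (by omega) (fun i => q (i + 1)) (L - 1) (g + wtl c) (g' + wtl c') (wtl d) (wtl d')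
        hq.shift (fun i hi hij => ⟨s2 i hi hij, s3 i hi hij, (hI1 i (by omega) (by omega)).2.2.1,
          (hI1 i (by omega) (by omega)).2.2.2⟩)
        (fun i hi => ⟨s1 i hi, (hc (i + 1) (by omega)).2⟩)

/-- The analogue of the previous lemma for multiplication by a fixed Witt vector. -/
lemma mul_filt (I : Ideal R) (A : ℕ → Ideal R) (hA : ∀ q, I * A q ≤ A (q + 1))
    (hA' : Antitone A) (j : ℕ) : ∀ (q : ℕ → ℕ) (L : ℕ) (a c c' : WittVector p R), Adm p q L →
      (∀ i, i < L → i ≤ j → c.coeff i ∈ I ∧ c'.coeff i ∈ I) →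
      (∀ i, i ≤ j → c.coeff i - c'.coeff i ∈ A (q i)) →
      (a * c).coeff j - (a * c').coeff j ∈ A (q j) := by
  induction j using Nat.strong_induction_on with
  | _ j ih =>
    intro q L a c c' hq hI hc
    cases j with
    | zero =>
      rw [(wtl_mul a c).2, (wtl_mul a c').2, ← mul_sub]
      exact (A _).mul_mem_left _ (hc 0 le_rfl)
    | succ j =>
      rw [mul_coeff_succ', mul_coeff_succ']
      have hI0 := fun hL => hI 0 hL (by omega)
      refine add_filt I A hA hA' j (fun i => q (i + 1)) (L - 1) _ _ _ _ hq.shift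
        (fun i hi hij => ⟨?_, ?_, ?_, ?_⟩) (fun i hi => ⟨?_, ?_⟩)
      · rw [wtl_coeff, mul_teich_coeff]
        exact I.mul_mem_right _ (I.pow_mem_of_mem (hI0 (by omega)).1 _ (pow_pos hp.out.pos _))
      · rw [wtl_coeff, mul_teich_coeff]
        exact I.mul_mem_right _ (I.pow_mem_of_mem (hI0 (by omega)).2 _ (pow_pos hp.out.pos _))
      · exact mul_coeff_mem I _ _ _ fun k hk => (hI (k + 1) (by omega) (by omega)).1
      · exact mul_coeff_mem I _ _ _ fun k hk => (hI (k + 1) (by omega) (by omega)).2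
      · rw [wtl_coeff, wtl_coeff, mul_teich_coeff, mul_teich_coeff, ← sub_mul]
        exact (A _).mul_mem_right _ (pow_filt I A hA hA' hq _ _ hI0 (hc 0 (by omega)) _)
      · exact ih i (by omega) (fun i => q (i + 1)) (L - 1) _ _ _ hq.shift
          (fun k hk hki => hI (k + 1) (by omega) (by omega)) (fun k hk => hc (k + 1) (by omega))

end charp

noncomputable section barM
open Filter

variable (C : Type*) [CommRing C] (p : ℕ) [hp : Fact p.Prime] [CharP C p]

/-- An ideal of `C^♭` is topologically nilpotent (for the inverse limit topology, in which the
kernels of the projections `ν_k : C^♭ → C` form a basis of neighbourhoods of `0`) if its image in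
each quotient `C^♭ / Ker ν_k` is nilpotent. -/
def TopNilpotent {C : Type*} [CommRing C] {p : ℕ} [Fact p.Prime] [CharP C p]
    (I : Ideal (Perfection C p)) : Prop :=
  ∀ k, ∃ r, I ^ r ≤ RingHom.ker (Perfection.coeff C p k)

/-- Fontaine's module `M̄(C)`: formal expressions `∑_{m ∈ ℤ} V^m [x_m]`, with `x_m ∈ C^♭`, such that
`x_m ∈ Ker ν_0` for `m < 0` and the ideal generated by `x_{-1}, x_{-2}, …` is topologically
nilpotent. -/
def BarM : Type _ :=
  {x : ℤ → Perfection C p // (∀ m < 0, Perfection.coeff C p 0 (x m) = 0) ∧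
    TopNilpotent (Ideal.span (x '' Set.Iio 0))}

variable {C p}

/-- The Witt vector `∑_{i ≥ 0} V^i [x_{i - N}]`, that is, `V^N` applied to the truncation
`∑_{m ≥ -N} V^m [x_m]` of the formal expression `∑_m V^m [x_m]`. -/
def trunc (x : ℤ → Perfection C p) (N : ℕ) : WittVector p (Perfection C p) :=
  WittVector.mk p fun i => x ((i : ℤ) - N)

/-- A sequence of Witt vectors `s_N`, thought of as the sequence of formal expressions
`V^{-N} s_N`, converges coordinatewise to `∑_m V^m [x_m]` (each coordinate converges in the
topology of `C^♭`). -/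
def IsLim (s : ℕ → WittVector p (Perfection C p)) (x : ℤ → Perfection C p) : Prop :=
  ∀ (k : ℕ) (n : ℤ), ∀ᶠ N : ℕ in atTop,
    Perfection.coeff C p k ((s N).coeff (n + N).toNat) = Perfection.coeff C p k (x n)

open Classical in
/-- The coordinatewise limit of `V^{-N} s_N`, if it exists. -/
def limit (s : ℕ → WittVector p (Perfection C p)) : ℤ → Perfection C p :=
  if h : ∃ x, IsLim s x then h.choose else 0

lemma IsLim.unique {s : ℕ → WittVector p (Perfection C p)} {x y : ℤ → Perfection C p}
    (hx : IsLim s x) (hy : IsLim s y) : x = y := by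
  funext n
  ext k
  obtain ⟨N, h1, h2⟩ := ((hx k n).and (hy k n)).exists
  rw [← h1, h2]

lemma isLim_limit {s : ℕ → WittVector p (Perfection C p)} (h : ∃ x, IsLim s x) :
    IsLim s (limit s) := by
  rw [limit, dif_pos h]; exact h.choose_spec

/-- Convergence to a limit, with uniform topological nilpotence of the polar parts. -/
def NilLim (s : ℕ → WittVector p (Perfection C p)) (x : ℤ → Perfection C p) : Prop :=
  (∃ I : Ideal (Perfection C p), TopNilpotent I ∧ I ≤ RingHom.ker (Perfection.coeff C p 0) ∧
    ∀ N j, j < N → (s N).coeff j ∈ I) ∧ IsLim s x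

lemma TopNilpotent.sup {I J : Ideal (Perfection C p)} (hI : TopNilpotent I)
    (hJ : TopNilpotent J) : TopNilpotent (I ⊔ J) := by
  intro k
  obtain ⟨a, ha⟩ := hI k
  obtain ⟨b, hb⟩ := hJ k
  exact ⟨a + b, Ideal.sup_pow_add_le_pow_sup_pow.trans (sup_le ha hb)⟩

lemma TopNilpotent.mono {I J : Ideal (Perfection C p)} (hI : TopNilpotent I) (h : J ≤ I) :
    TopNilpotent J := fun k => (hI k).imp fun _ hr => (Ideal.pow_right_mono h _).trans hr

/-- The congruence exponents used below. -/
def qfun (p L r : ℕ) (i : ℕ) : ℕ := 1 + (p - 1) * (min i L - (L - r))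

lemma qfun_adm (L r : ℕ) : Adm p (qfun p L r) L := by
  constructor
  · intro i
    have : min (i + 1) L - (L - r) ≤ (min i L - (L - r)) + 1 := by omega
    calc _ ≤ 1 + (p - 1) * ((min i L - (L - r)) + 1) :=
          Nat.add_le_add_left (Nat.mul_le_mul_left _ this) _
      _ = _ := by rw [qfun]; ring
  · intro i hi
    rw [qfun, qfun, min_eq_right hi, min_eq_right (by omega)]

lemma le_qfun {L r i : ℕ} (h1 : r ≤ L) (h2 : L ≤ i) : r ≤ qfun p L r i := by
  rw [qfun, min_eq_right h2, Nat.sub_sub_self h1]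
  have := hp.out.two_le
  calc r = 1 * r := (one_mul r).symm
    _ ≤ (p - 1) * r := Nat.mul_le_mul_right _ (by omega)
    _ ≤ _ := Nat.le_add_left _ _

lemma qfun_low {L r i : ℕ} (h : i < L - r) : qfun p L r i = 1 := by
  rw [qfun, min_eq_left (by omega), Nat.sub_eq_zero_of_le h.le, mul_zero, add_zero]

/-- The filtration used below. -/
def fil (I J : Ideal (Perfection C p)) (q : ℕ) : Ideal (Perfection C p) := I ^ q ⊔ J

lemma fil_mul (I J : Ideal (Perfection C p)) (q : ℕ) : I * fil I J q ≤ fil I J (q + 1) := by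
  rw [fil, fil, Ideal.mul_sup, pow_succ']
  exact sup_le_sup_left Ideal.mul_le_right _

lemma fil_anti (I J : Ideal (Perfection C p)) : Antitone (fil I J) :=
  fun _ _ h => sup_le_sup_right (Ideal.pow_le_pow_right h) _

/-- Two sequences with the same limit are eventually close enough, in the required range. -/
lemma close {s s' : ℕ → WittVector p (Perfection C p)} {x : ℤ → Perfection C p}
    (h : IsLim s x) (h' : IsLim s' x) {I : Ideal (Perfection C p)}
    (hI : ∀ N j, j < N → (s N).coeff j ∈ I ∧ (s' N).coeff j ∈ I) (k : ℕ) (n : ℤ) (r : ℕ) :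
    ∀ᶠ N : ℕ in atTop, ∀ i, i ≤ (n + N).toNat →
      (s N).coeff i - (s' N).coeff i ∈
        fil I (RingHom.ker (Perfection.coeff C p k)) (qfun p (N - n.natAbs) r i) := by
  have h1 : ∀ᶠ N : ℕ in atTop, ∀ m ∈ Finset.Icc (-(n.natAbs + r : ℤ)) n,
      Perfection.coeff C p k ((s N).coeff (m + N).toNat)
        = Perfection.coeff C p k ((s' N).coeff (m + N).toNat) := by
    rw [Filter.eventually_all_finset]
    intro m _
    filter_upwards [h k m, h' k m] with N e1 e2
    rw [e1, e2]
  filter_upwards [h1, eventually_ge_atTop (n.natAbs + r)] with N hN hN' i hi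
  by_cases hlow : i < N - n.natAbs - r
  · rw [qfun_low hlow, fil, pow_one]
    have := hI N i (by omega)
    exact Ideal.mem_sup_left (I.sub_mem this.1 this.2)
  · have := hN ((i : ℤ) - N) (by rw [Finset.mem_Icc]; omega)
    rw [sub_add_cancel, Int.toNat_natCast] at this
    refine Ideal.mem_sup_right ?_
    rw [RingHom.mem_ker, map_sub, this, sub_self]

lemma fil_top {I : Ideal (Perfection C p)} {k r : ℕ}
    (hr : I ^ r ≤ RingHom.ker (Perfection.coeff C p k)) {q : ℕ} (hq : r ≤ q)
    {u v : Perfection C p} (h : u - v ∈ fil I (RingHom.ker (Perfection.coeff C p k)) q) :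
    Perfection.coeff C p k u = Perfection.coeff C p k v := by
  have := (sup_le ((Ideal.pow_le_pow_right hq).trans hr) le_rfl :
    fil I (RingHom.ker (Perfection.coeff C p k)) q ≤ _) h
  rwa [RingHom.mem_ker, map_sub, sub_eq_zero] at this

lemma agree_add {s s' t t' : ℕ → WittVector p (Perfection C p)} {x y : ℤ → Perfection C p}
    (hs : NilLim s x) (hs' : NilLim s' x) (ht : NilLim t y) (ht' : NilLim t' y) (k : ℕ) (n : ℤ) :
    ∀ᶠ N : ℕ in atTop, Perfection.coeff C p k ((s N + t N).coeff (n + N).toNat)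
      = Perfection.coeff C p k ((s' N + t' N).coeff (n + N).toNat) := by
  obtain ⟨⟨I1, n1, -, b1⟩, l1⟩ := hs
  obtain ⟨⟨I2, n2, -, b2⟩, l2⟩ := hs'
  obtain ⟨⟨I3, n3, -, b3⟩, l3⟩ := ht
  obtain ⟨⟨I4, n4, -, b4⟩, l4⟩ := ht'
  set I := I1 ⊔ I2 ⊔ (I3 ⊔ I4) with hI
  have m1 : I1 ≤ I := le_sup_left.trans le_sup_left
  have m2 : I2 ≤ I := le_sup_right.trans le_sup_left
  have m3 : I3 ≤ I := le_sup_left.trans le_sup_right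
  have m4 : I4 ≤ I := le_sup_right.trans le_sup_right
  obtain ⟨r, hr⟩ := ((n1.sup n2).sup (n3.sup n4)) k
  filter_upwards [close l1 l2 (fun N j hj => ⟨m1 (b1 N j hj), m2 (b2 N j hj)⟩) k n r,
    close l3 l4 (fun N j hj => ⟨m3 (b3 N j hj), m4 (b4 N j hj)⟩) k n r,
    eventually_ge_atTop (n.natAbs + r)] with N e1 e2 hN
  refine fil_top hr (le_qfun (by omega) (by omega)) (add_filt I _ (fil_mul _ _) (fil_anti _ _)
    (n + N).toNat _ (N - n.natAbs) _ _ _ _ (qfun_adm _ r) (fun i hi _ => ?_)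
    fun i hi => ⟨e1 i hi, e2 i hi⟩)
  exact ⟨m1 (b1 N i (by omega)), m2 (b2 N i (by omega)), m3 (b3 N i (by omega)),
    m4 (b4 N i (by omega))⟩

lemma agree_mul (a : ℕ → WittVector p (Perfection C p))
    {s s' : ℕ → WittVector p (Perfection C p)} {x : ℤ → Perfection C p}
    (hs : NilLim s x) (hs' : NilLim s' x) (k : ℕ) (n : ℤ) :
    ∀ᶠ N : ℕ in atTop, Perfection.coeff C p k ((a N * s N).coeff (n + N).toNat)
      = Perfection.coeff C p k ((a N * s' N).coeff (n + N).toNat) := by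
  obtain ⟨⟨I1, n1, -, b1⟩, l1⟩ := hs
  obtain ⟨⟨I2, n2, -, b2⟩, l2⟩ := hs'
  obtain ⟨r, hr⟩ := (n1.sup n2) k
  have m1 : I1 ≤ I1 ⊔ I2 := le_sup_left
  have m2 : I2 ≤ I1 ⊔ I2 := le_sup_right
  filter_upwards [close l1 l2 (fun N j hj => ⟨m1 (b1 N j hj), m2 (b2 N j hj)⟩) k n r,
    eventually_ge_atTop (n.natAbs + r)] with N e1 hN
  exact fil_top hr (le_qfun (by omega) (by omega)) (mul_filt (I1 ⊔ I2) _ (fil_mul _ _)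
    (fil_anti _ _) (n + N).toNat _ (N - n.natAbs) _ _ _ (qfun_adm _ r)
    (fun i hi _ => ⟨m1 (b1 N i (by omega)), m2 (b2 N i (by omega))⟩) e1)

/-- The reindexed sequence: `V^{-N} (V s_{N-1}) = V^{-(N-1)} s_{N-1}`. -/
def vshift (s : ℕ → WittVector p (Perfection C p)) (N : ℕ) : WittVector p (Perfection C p) :=
  WittVector.verschiebung (s (N - 1))

lemma shift_coeff (s : ℕ → WittVector p (Perfection C p)) (n : ℤ) {N : ℕ} (h : n.natAbs < N) :
    (vshift s N).coeff (n + N).toNat = (s (N - 1)).coeff (n + (N - 1 : ℕ)).toNat := by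
  have : (n + N).toNat = (n + (N - 1 : ℕ)).toNat + 1 := by omega
  rw [vshift, this, WittVector.verschiebung_coeff_add_one]

lemma nilLim_vshift {s : ℕ → WittVector p (Perfection C p)} {x : ℤ → Perfection C p} (h : NilLim s x) :
    NilLim (vshift s) x := by
  obtain ⟨⟨I, h1, h2, h3⟩, h4⟩ := h
  refine ⟨⟨I, h1, h2, fun N j hj => ?_⟩, fun k n => ?_⟩
  · cases j with
    | zero => rw [vshift, WittVector.verschiebung_coeff_zero]; exact I.zero_mem
    | succ j =>
      rw [vshift, WittVector.verschiebung_coeff_add_one]; exact h3 _ _ (by omega)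
  · filter_upwards [(tendsto_sub_atTop_nat 1).eventually (h4 k n),
      eventually_gt_atTop n.natAbs] with N e hN
    rw [shift_coeff s n hN, e]

lemma exists_isLim {s : ℕ → WittVector p (Perfection C p)}
    (h : ∀ (k : ℕ) (n : ℤ), ∀ᶠ N : ℕ in atTop,
      Perfection.coeff C p k ((s N).coeff (n + N).toNat)
        = Perfection.coeff C p k ((vshift s N).coeff (n + N).toNat)) : ∃ x, IsLim s x := by
  have h1 : ∀ (k : ℕ) (n : ℤ), ∃ c : C, ∀ᶠ N : ℕ in atTop,
      Perfection.coeff C p k ((s N).coeff (n + N).toNat) = c := by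
    intro k n
    obtain ⟨N₀, hN₀⟩ := eventually_atTop.mp ((h k n).and (eventually_gt_atTop n.natAbs))
    refine ⟨Perfection.coeff C p k ((s N₀).coeff (n + N₀).toNat), ?_⟩
    filter_upwards [eventually_ge_atTop N₀] with N hN
    induction N, hN using Nat.le_induction with
    | base => rfl
    | succ N hN ih =>
      obtain ⟨e1, e2⟩ := hN₀ (N + 1) (by omega)
      rw [e1, shift_coeff s n e2]
      exact ih
  choose c hc using h1
  refine ⟨fun n => ⟨fun k => c k n, fun k => ?_⟩, fun k n => hc k n⟩
  obtain ⟨N, e1, e2⟩ := ((hc (k + 1) n).and (hc k n)).exists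
  change c (k + 1) n ^ p = c k n
  rw [← e1, ← e2, Perfection.coeff_pow_p']

lemma NilLim.mem {s : ℕ → WittVector p (Perfection C p)} {x : ℤ → Perfection C p} (h : NilLim s x) :
    (∀ m < 0, Perfection.coeff C p 0 (x m) = 0) ∧
      TopNilpotent (Ideal.span (x '' Set.Iio 0)) := by
  obtain ⟨⟨I, h1, h2, h3⟩, h4⟩ := h
  have key : ∀ (k : ℕ), ∀ m < 0, x m ∈ I ⊔ RingHom.ker (Perfection.coeff C p k) := by
    intro k m hm
    obtain ⟨N, e, hN⟩ := ((h4 k m).and (eventually_gt_atTop m.natAbs)).exists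
    have e1 : x m = (s N).coeff (m + N).toNat + (x m - (s N).coeff (m + N).toNat) := by ring
    rw [e1]
    refine Submodule.add_mem_sup (h3 _ _ (by omega)) ?_
    rw [RingHom.mem_ker, map_sub, e, sub_self]
  refine ⟨fun m hm => (sup_le h2 le_rfl : I ⊔ _ ≤ _) (key 0 m hm), fun k => ?_⟩
  obtain ⟨r, hr⟩ := h1 k
  refine ⟨r + 1, (Ideal.pow_right_mono (Ideal.span_le.mpr ?_) _).trans
    ((Ideal.sup_pow_add_le_pow_sup_pow (I := I)
      (J := RingHom.ker (Perfection.coeff C p k)) (n := r) (m := 1)).trans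
      (sup_le hr (by rw [pow_one])))⟩
  rintro _ ⟨m, hm, rfl⟩
  exact key k m hm

lemma nilLim_trunc (x : BarM C p) : NilLim (trunc x.1) x.1 := by
  refine ⟨⟨_, x.2.2, Ideal.span_le.mpr ?_, fun N j hj => Ideal.subset_span ⟨(j : ℤ) - N, ?_, rfl⟩⟩,
    fun k n => ?_⟩
  · rintro _ ⟨m, hm, rfl⟩
    exact x.2.1 m hm
  · rw [Set.mem_Iio]; omega
  · filter_upwards [eventually_gt_atTop n.natAbs] with N hN
    have : (((n + N).toNat : ℕ) : ℤ) - N = n := by omega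
    rw [trunc, WittVector.coeff_mk, this]

lemma NilLim.congr {s s' : ℕ → WittVector p (Perfection C p)} {x : ℤ → Perfection C p}
    (h : IsLim s x) (hss' : ∀ (k : ℕ) (n : ℤ), ∀ᶠ N : ℕ in atTop,
      Perfection.coeff C p k ((s' N).coeff (n + N).toNat)
        = Perfection.coeff C p k ((s N).coeff (n + N).toNat)) : IsLim s' x := fun k n => by
  filter_upwards [h k n, hss' k n] with N e1 e2
  rw [e2, e1]

lemma NilLim.add {s t : ℕ → WittVector p (Perfection C p)} {x y : ℤ → Perfection C p}
    (hs : NilLim s x) (ht : NilLim t y) : NilLim (fun N => s N + t N) (limit fun N => s N + t N) := by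
  refine ⟨?_, isLim_limit (exists_isLim fun k n => ?_)⟩
  · obtain ⟨⟨I, h1, h2, h3⟩, h4⟩ := hs
    obtain ⟨⟨J, k1, k2, k3⟩, k4⟩ := ht
    refine ⟨I ⊔ J, h1.sup k1, sup_le h2 k2, fun N j hj => add_coeff_mem _ _ _ _
      (fun i hi => Ideal.mem_sup_left (h3 _ _ (by omega)))
      (fun i hi => Ideal.mem_sup_right (k3 _ _ (by omega)))⟩
  · filter_upwards [agree_add hs (nilLim_vshift hs) ht (nilLim_vshift ht) k n] with N e
    rw [e, vshift, vshift, vshift, map_add]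

lemma NilLim.mul {s : ℕ → WittVector p (Perfection C p)} {x : ℤ → Perfection C p} (hs : NilLim s x)
    (a : ℕ → WittVector p (Perfection C p))
    (ha : ∀ N, WittVector.frobenius (a (N + 1)) = a N) :
    NilLim (fun N => a N * s N) (limit fun N => a N * s N) := by
  refine ⟨?_, isLim_limit (exists_isLim fun k n => ?_)⟩
  · obtain ⟨⟨I, h1, h2, h3⟩, h4⟩ := hs
    exact ⟨I, h1, h2, fun N j hj => mul_coeff_mem _ _ _ _ fun i hi => h3 _ _ (by omega)⟩
  · filter_upwards [agree_mul a hs (nilLim_vshift hs) k n, eventually_gt_atTop 0] with N e hN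
    obtain ⟨N, rfl⟩ : ∃ M, N = M + 1 := ⟨N - 1, by omega⟩
    rw [e, vshift, vshift, Nat.add_sub_cancel, ← ha N,
      mul_comm (WittVector.frobenius _), WittVector.verschiebung_mul_frobenius, mul_comm]

/-- The element `F^{-N} a` of `W(C^♭)`. -/
def frobInv (a : WittVector p (Perfection C p)) (N : ℕ) : WittVector p (Perfection C p) :=
  (WittVector.frobeniusEquiv p (Perfection C p)).symm^[N] a

lemma frob_frobInv (a : WittVector p (Perfection C p)) (N : ℕ) :
    WittVector.frobenius (frobInv a (N + 1)) = frobInv a N := by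
  rw [frobInv, frobInv, Function.iterate_succ_apply']
  exact (WittVector.frobeniusEquiv p (Perfection C p)).apply_symm_apply _

namespace BarM

/-- Addition of formal expressions: the coordinatewise limit of the sums of the truncations
`∑_{m ≥ -N} V^m [x_m]` and `∑_{m ≥ -N} V^m [y_m]`, computed in `V^{-N} W(C^♭)`. -/
instance : Add (BarM C p) :=
  ⟨fun x y => ⟨limit fun N => trunc x.1 N + trunc y.1 N, ((nilLim_trunc x).add (nilLim_trunc y)).mem⟩⟩

instance : Neg (BarM C p) :=
  ⟨fun x => ⟨limit fun N => -1 * trunc x.1 N,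
    ((nilLim_trunc x).mul (fun _ => -1) (fun _ => by simp)).mem⟩⟩

instance : Zero (BarM C p) :=
  ⟨⟨0, fun _ _ => map_zero _, fun k => ⟨1, by
    rw [pow_one, Ideal.span_le]; rintro _ ⟨m, -, rfl⟩; exact map_zero _⟩⟩⟩

/-- The action of `W(C^♭)`, characterized by `a • V^{-N} w = V^{-N} (F^{-N}(a) * w)` and
continuity. -/
instance : SMul (WittVector p (Perfection C p)) (BarM C p) :=
  ⟨fun a x => ⟨limit fun N => frobInv a N * trunc x.1 N,
    ((nilLim_trunc x).mul (frobInv a) (frob_frobInv a)).mem⟩⟩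

lemma spec_add {s t : ℕ → WittVector p (Perfection C p)} {x y : BarM C p}
    (hs : NilLim s x.1) (ht : NilLim t y.1) : NilLim (fun N => s N + t N) (x + y).1 :=
  ⟨(hs.add ht).1, NilLim.congr ((nilLim_trunc x).add (nilLim_trunc y)).2
    (agree_add hs (nilLim_trunc x) ht (nilLim_trunc y))⟩

lemma spec_neg {s : ℕ → WittVector p (Perfection C p)} {x : BarM C p}
    (hs : NilLim s x.1) : NilLim (fun N => -1 * s N) (-x).1 :=
  ⟨(hs.mul (fun _ => -1) (fun _ => by simp)).1,
    NilLim.congr ((nilLim_trunc x).mul (fun _ => -1) (fun _ => by simp)).2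
      (agree_mul _ hs (nilLim_trunc x))⟩

lemma spec_smul (a : WittVector p (Perfection C p))
    {s : ℕ → WittVector p (Perfection C p)} {x : BarM C p}
    (hs : NilLim s x.1) : NilLim (fun N => frobInv a N * s N) (a • x).1 :=
  ⟨(hs.mul _ (frob_frobInv a)).1, NilLim.congr ((nilLim_trunc x).mul _ (frob_frobInv a)).2
      (agree_mul _ hs (nilLim_trunc x))⟩

lemma spec_zero : NilLim (fun _ => 0) (0 : BarM C p).1 :=
  ⟨⟨⊥, fun _ => ⟨1, by simp⟩, bot_le, by simp⟩, fun k n =>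
    Eventually.of_forall fun N => by rw [WittVector.zero_coeff]; rfl⟩

lemma eq_of_nilLim {s t : ℕ → WittVector p (Perfection C p)} {x y : BarM C p}
    (hs : NilLim s x.1) (ht : NilLim t y.1) (h : ∀ N, s N = t N) : x = y := by
  obtain rfl : s = t := funext h
  exact Subtype.ext (hs.2.unique ht.2)

instance : AddCommGroup (BarM C p) where
  add_assoc x y z := eq_of_nilLim (spec_add (spec_add (nilLim_trunc x) (nilLim_trunc y)) (nilLim_trunc z))
    (spec_add (nilLim_trunc x) (spec_add (nilLim_trunc y) (nilLim_trunc z))) fun N => add_assoc _ _ _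
  zero_add x := eq_of_nilLim (spec_add spec_zero (nilLim_trunc x)) (nilLim_trunc x) fun N => zero_add _
  add_zero x := eq_of_nilLim (spec_add (nilLim_trunc x) spec_zero) (nilLim_trunc x) fun N => add_zero _
  nsmul := nsmulRec
  zsmul := zsmulRec
  neg_add_cancel x := eq_of_nilLim (spec_add (spec_neg (nilLim_trunc x)) (nilLim_trunc x)) spec_zero
    fun N => by ring
  add_comm x y := eq_of_nilLim (spec_add (nilLim_trunc x) (nilLim_trunc y))
    (spec_add (nilLim_trunc y) (nilLim_trunc x)) fun N => add_comm _ _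

lemma frobInv_add (a b : WittVector p (Perfection C p)) (N : ℕ) :
    frobInv (a + b) N = frobInv a N + frobInv b N := iterate_map_add _ _ _ _

lemma frobInv_mul (a b : WittVector p (Perfection C p)) (N : ℕ) :
    frobInv (a * b) N = frobInv a N * frobInv b N := iterate_map_mul _ _ _ _

instance : Module (WittVector p (Perfection C p)) (BarM C p) where
  one_smul x := eq_of_nilLim (spec_smul 1 (nilLim_trunc x)) (nilLim_trunc x) fun N => by
    rw [frobInv, iterate_map_one, one_mul]
  mul_smul a b x := eq_of_nilLim (spec_smul (a * b) (nilLim_trunc x))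
    (spec_smul a (spec_smul b (nilLim_trunc x))) fun N => by rw [frobInv_mul, mul_assoc]
  smul_zero a := eq_of_nilLim (spec_smul a spec_zero) spec_zero fun N => mul_zero _
  zero_smul x := eq_of_nilLim (spec_smul 0 (nilLim_trunc x)) spec_zero fun N => by
    rw [frobInv, iterate_map_zero, zero_mul]
  smul_add a x y := eq_of_nilLim (spec_smul a (spec_add (nilLim_trunc x) (nilLim_trunc y)))
    (spec_add (spec_smul a (nilLim_trunc x)) (spec_smul a (nilLim_trunc y))) fun N => mul_add _ _ _
  add_smul a b x := eq_of_nilLim (spec_smul (a + b) (nilLim_trunc x))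
    (spec_add (spec_smul a (nilLim_trunc x)) (spec_smul b (nilLim_trunc x))) fun N => by
      rw [frobInv_add, add_mul]

/-- The operator `F` on `M̄(C)`: `∑ V^m [x_m] ↦ ∑ V^m [x_m ^ p]`. -/
def frob (x : BarM C p) : BarM C p :=
  ⟨fun m => x.1 m ^ p, fun m hm => by rw [map_pow, x.2.1 m hm, zero_pow hp.out.ne_zero],
    x.2.2.mono (Ideal.span_le.mpr (by
      rintro _ ⟨m, hm, rfl⟩
      exact Ideal.pow_mem_of_mem _ (Ideal.subset_span (Set.mem_image_of_mem x.1 hm)) _ hp.out.pos))⟩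

end BarM

end barM

noncomputable section pdHull
open scoped Nat

/-- The relations imposed on the divided power algebra `Γ_A(I)` in order to obtain the PD hull of
`A → A ⧸ I` compatible with the divided powers of `p`: the degree one generator attached to
`x ∈ I` is identified with `x`, and `γ_n(p) = p ^ n / n!`. -/
inductive PDRel (p : ℕ) {A : Type*} [CommRing A] (I : Ideal A) : DividedPowerAlgebra A I → Prop
  | deg_one (x : I) : PDRel p I (DividedPowerAlgebra.dp A 1 x - algebraMap A _ (x : A))
  | base (x : I) (hx : (x : A) = p) (n : ℕ) (a : A) (ha : (n ! : A) * a = (p : A) ^ n) :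
      PDRel p I (DividedPowerAlgebra.dp A n x - algebraMap A _ a)

/-- The PD hull of `A → A ⧸ I` (with the condition `γ_n(p) = p ^ n / n!`), for a ring `A` in which
`p ^ n / n!` makes sense and an ideal `I` containing `p`: the quotient of `Γ_A(I)` by the
relations `PDRel`. -/
def PDHull (p : ℕ) {A : Type*} [CommRing A] (I : Ideal A) : Type _ :=
  DividedPowerAlgebra A I ⧸ Ideal.span {t | PDRel p I t}

instance (p : ℕ) {A : Type*} [CommRing A] (I : Ideal A) : CommRing (PDHull p I) :=
  inferInstanceAs (CommRing (DividedPowerAlgebra A I ⧸ Ideal.span {t | PDRel p I t}))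

instance (p : ℕ) {A : Type*} [CommRing A] (I : Ideal A) : Algebra A (PDHull p I) :=
  inferInstanceAs (Algebra A (DividedPowerAlgebra A I ⧸ Ideal.span {t | PDRel p I t}))

/-- The projection from `Γ_A(I)` to the PD hull. -/
def PDHull.mk (p : ℕ) {A : Type*} [CommRing A] (I : Ideal A) :
    DividedPowerAlgebra A I →+* PDHull p I :=
  Ideal.Quotient.mk (Ideal.span {t | PDRel p I t})

/-- The divided power `γ_n(x)` in the PD hull, for `x ∈ I`. -/
def PDHull.gamma (p : ℕ) {A : Type*} [CommRing A] (I : Ideal A) (n : ℕ) (x : I) : PDHull p I :=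
  PDHull.mk p I (DividedPowerAlgebra.dp A n x)

/-- A ring endomorphism `g` of `A` with `g(I) ⊆ I` induces an endomorphism of `Γ_A(I)`
sending `γ_n(x)` to `γ_n(g(x))`. -/
def dpMap {A : Type*} [CommRing A] {I : Ideal A} (g : A →+* A) (hg : ∀ x ∈ I, g x ∈ I) :
    DividedPowerAlgebra A I →+* DividedPowerAlgebra A I :=
  RingCon.lift (DividedPowerAlgebra.ringCon A I)
    (MvPolynomial.eval₂Hom ((algebraMap A (DividedPowerAlgebra A I)).comp g)
      fun nx : ℕ × I => DividedPowerAlgebra.dp A nx.1 ⟨g nx.2, hg _ nx.2.2⟩) (by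
    refine RingCon.ringConGen_le.mpr ?_
    intro a b h
    rw [RingCon.ker_apply]
    cases h with
    | rfl_zero => rfl
    | zero => simp [DividedPowerAlgebra.dp_zero]
    | @smul r n a =>
      simp only [MvPolynomial.smul_eq_C_mul, map_mul, map_pow, MvPolynomial.coe_eval₂Hom,
        MvPolynomial.eval₂_X, MvPolynomial.eval₂_C, RingHom.comp_apply]
      rw [← map_pow, ← Algebra.smul_def, ← DividedPowerAlgebra.dp_smul]
      congr 1
      ext
      simp
    | mul => simp [DividedPowerAlgebra.dp_mul]
    | @add n a b =>
      simp only [map_sum, map_mul, MvPolynomial.coe_eval₂Hom, MvPolynomial.eval₂_X]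
      refine Eq.trans ?_ (DividedPowerAlgebra.dp_add (x := (⟨g a, hg _ a.2⟩ : I))
        (y := (⟨g b, hg _ b.2⟩ : I)))
      congr 1
      ext
      simp)

lemma dpMap_dp {A : Type*} [CommRing A] {I : Ideal A} (g : A →+* A) (hg : ∀ x ∈ I, g x ∈ I)
    (n : ℕ) (x : I) :
    dpMap g hg (DividedPowerAlgebra.dp A n x) = DividedPowerAlgebra.dp A n ⟨g x, hg _ x.2⟩ :=
  MvPolynomial.eval₂Hom_X' _ _ (n, x)

lemma dpMap_algebraMap {A : Type*} [CommRing A] {I : Ideal A} (g : A →+* A)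
    (hg : ∀ x ∈ I, g x ∈ I) (a : A) :
    dpMap g hg (algebraMap A _ a) = algebraMap A _ (g a) := by
  change MvPolynomial.eval₂Hom _ _ (MvPolynomial.C a) = _
  rw [MvPolynomial.eval₂Hom_C]
  rfl

/-- A ring endomorphism `g` of `A` with `g(I) ⊆ I` induces an endomorphism of the PD hull
sending `γ_n(x)` to `γ_n(g(x))`. -/
def PDHull.map (p : ℕ) {A : Type*} [CommRing A] {I : Ideal A} (g : A →+* A)
    (hg : ∀ x ∈ I, g x ∈ I) : PDHull p I →+* PDHull p I :=
  Ideal.quotientMap (Ideal.span {t | PDRel p I t}) (dpMap g hg) (by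
    rw [Ideal.span_le]
    rintro _ (⟨x⟩ | ⟨x, hx, n, a, ha⟩)
    · refine Ideal.subset_span ?_
      rw [map_sub, dpMap_dp, dpMap_algebraMap]
      exact PDRel.deg_one ⟨g x, hg _ x.2⟩
    · refine Ideal.subset_span ?_
      rw [map_sub, dpMap_dp, dpMap_algebraMap]
      refine PDRel.base _ (by simp [hx]) n _ ?_
      rw [← map_natCast g, ← map_mul, ha, map_pow, map_natCast])

lemma PDHull.map_gamma (p : ℕ) {A : Type*} [CommRing A] {I : Ideal A} (g : A →+* A)
    (hg : ∀ x ∈ I, g x ∈ I) (n : ℕ) (x : I) :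
    PDHull.map p g hg (PDHull.gamma p I n x) = PDHull.gamma p I n ⟨g x, hg _ x.2⟩ := by
  rw [PDHull.gamma, PDHull.gamma, ← dpMap_dp]
  rfl

lemma PDHull.map_algebraMap (p : ℕ) {A : Type*} [CommRing A] {I : Ideal A} (g : A →+* A)
    (hg : ∀ x ∈ I, g x ∈ I) (a : A) :
    PDHull.map p g hg (algebraMap A (PDHull p I) a) = algebraMap A (PDHull p I) (g a) := by
  change PDHull.mk p I (dpMap g hg (algebraMap A _ a)) = PDHull.mk p I (algebraMap A _ (g a))
  rw [dpMap_algebraMap]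

lemma padicCompletionMap_aux (p : ℕ) {D : Type*} [CommRing D] (g : D →+* D) (n : ℕ) :
    Ideal.span {(p : D)} ^ n ≤ (Ideal.span {(p : D)} ^ n).comap g := by
  rw [← Ideal.map_le_iff_le_comap, Ideal.map_pow, Ideal.map_span, Set.image_singleton,
    map_natCast]

lemma padicCompletionMap_compat (p : ℕ) {D : Type*} [CommRing D] (g : D →+* D) {m n : ℕ}
    (hle : m ≤ n) : (Ideal.Quotient.factorPow (Ideal.span {(p : D)}) hle).comp
      ((Ideal.quotientMap (Ideal.span {(p : D)} ^ n) g (padicCompletionMap_aux p g n)).comp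
        (AdicCompletion.evalₐ (Ideal.span {(p : D)}) n).toRingHom) =
      (Ideal.quotientMap (Ideal.span {(p : D)} ^ m) g (padicCompletionMap_aux p g m)).comp
        (AdicCompletion.evalₐ (Ideal.span {(p : D)}) m).toRingHom := by
    ext x
    obtain ⟨f, rfl⟩ := AdicCompletion.mk_surjective _ _ x
    have h1 : g (f n) - g (f m) ∈ Ideal.span {(p : D)} ^ m := by
      rw [← map_sub]
      have h2 : f n - f m ∈ Ideal.span {(p : D)} ^ m := by
        have := AdicCompletion.AdicCauchySequence.mk_eq_mk hle f
        rw [Submodule.Quotient.eq] at this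
        simpa using this
      exact padicCompletionMap_aux p g m h2
    simpa [AdicCompletion.evalₐ_mk, Ideal.Quotient.mk_eq_mk_iff_sub_mem] using h1

/-- A ring endomorphism `g` of `D` induces an endomorphism of the `p`-adic completion of `D`. -/
def padicCompletionMap (p : ℕ) {D : Type*} [CommRing D] (g : D →+* D) :
    AdicCompletion (Ideal.span {(p : D)}) D →+* AdicCompletion (Ideal.span {(p : D)}) D :=
  AdicCompletion.liftRingHom (Ideal.span {(p : D)})
    (fun n => (Ideal.quotientMap (Ideal.span {(p : D)} ^ n) g (padicCompletionMap_aux p g n)).comp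
      (AdicCompletion.evalₐ (Ideal.span {(p : D)}) n).toRingHom)
    (padicCompletionMap_compat p g)

lemma evalₐ_padicCompletionMap (p : ℕ) {D : Type*} [CommRing D] (g : D →+* D) (n : ℕ) (y : D) :
    AdicCompletion.evalₐ (Ideal.span {(p : D)}) n
      (padicCompletionMap p g (AdicCompletion.of _ D y)) = Ideal.Quotient.mk _ (g y) := by
  rw [padicCompletionMap, AdicCompletion.evalₐ_liftRingHom _ _ (padicCompletionMap_compat p g)]
  simp

end pdHull

noncomputable section acris
open scoped Nat

/-- The kernel of the map `W(C^♭) → C` induced by `ν_0 : C^♭ → C`. -/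
def thetaKer (C : Type*) [CommRing C] (p : ℕ) [Fact p.Prime] [CharP C p] :
    Ideal (WittVector p (Perfection C p)) :=
  RingHom.ker ((Perfection.coeff C p 0).comp WittVector.constantCoeff)

/-- `A_cris(C)`: the `p`-adic completion of the PD hull of `W(C^♭) → C`. -/
def Acris (C : Type*) [CommRing C] (p : ℕ) [Fact p.Prime] [CharP C p] : Type _ :=
  AdicCompletion (Ideal.span {(p : PDHull p (thetaKer C p))}) (PDHull p (thetaKer C p))

variable {C : Type*} [CommRing C] {p : ℕ} [hp : Fact p.Prime] [CharP C p]

instance : CommRing (Acris C p) :=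
  inferInstanceAs (CommRing (AdicCompletion (Ideal.span {(p : PDHull p (thetaKer C p))})
    (PDHull p (thetaKer C p))))

instance : Algebra (PDHull p (thetaKer C p)) (Acris C p) :=
  inferInstanceAs (Algebra _ (AdicCompletion (Ideal.span {(p : PDHull p (thetaKer C p))})
    (PDHull p (thetaKer C p))))

instance : Algebra (WittVector p (Perfection C p)) (Acris C p) :=
  inferInstanceAs (Algebra _ (AdicCompletion (Ideal.span {(p : PDHull p (thetaKer C p))})
    (PDHull p (thetaKer C p))))

/-- The `p`-adic topology on `A_cris(C)`. -/
instance : TopologicalSpace (Acris C p) := (Ideal.span {(p : Acris C p)}).adicTopology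

lemma frobenius_mem_thetaKer (w : WittVector p (Perfection C p)) (hw : w ∈ thetaKer C p) :
    WittVector.frobenius w ∈ thetaKer C p := by
  have hw' : Perfection.coeff C p 0 (w.coeff 0) = 0 := hw
  change Perfection.coeff C p 0 ((WittVector.frobenius w).coeff 0) = 0
  rw [WittVector.coeff_frobenius_charP, map_pow, hw', zero_pow hp.out.ne_zero]

lemma teichmuller_mem_thetaKer (c : Perfection C p) (hc : Perfection.coeff C p 0 c = 0) :
    WittVector.teichmuller p c ∈ thetaKer C p := by
  change Perfection.coeff C p 0 ((WittVector.teichmuller p c).coeff 0) = 0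
  rw [WittVector.teichmuller_coeff_zero, hc]

namespace Acris

/-- The endomorphism `F` of `A_cris(C)` induced by the Frobenius of `C`. -/
def frob : Acris C p →+* Acris C p :=
  padicCompletionMap p (PDHull.map p WittVector.frobenius frobenius_mem_thetaKer)

/-- The divided power `γ_n(w) ∈ A_cris(C)` of `w ∈ Ker (W(C^♭) → C)`. -/
def gamma (n : ℕ) (w : thetaKer C p) : Acris C p :=
  algebraMap (PDHull p (thetaKer C p)) (Acris C p) (PDHull.gamma p _ n w)


lemma frob_algebraMap (y : PDHull p (thetaKer C p)) :
    frob (algebraMap (PDHull p (thetaKer C p)) (Acris C p) y) =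
      algebraMap (PDHull p (thetaKer C p)) (Acris C p)
        (PDHull.map p WittVector.frobenius frobenius_mem_thetaKer y) := by
  refine AdicCompletion.ext_evalₐ fun n => ?_
  exact (evalₐ_padicCompletionMap p _ n y).trans (AdicCompletion.evalₐ_of _ n _).symm

lemma frob_algebraMap_witt (a : WittVector p (Perfection C p)) :
    frob (algebraMap _ (Acris C p) a) = algebraMap _ (Acris C p) (WittVector.frobenius a) := by
  change frob (algebraMap (PDHull p (thetaKer C p)) (Acris C p) (algebraMap _ _ a)) = _
  rw [frob_algebraMap, PDHull.map_algebraMap]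
  rfl

variable (C p) in
/-- `A'_cris(C) = {u ∈ A_cris(C) | p^n u ∈ F^n(A_cris(C)) for all n}`, as a `W(C^♭)`-submodule
of `A_cris(C)`. -/
def prime : Submodule (WittVector p (Perfection C p)) (Acris C p) where
  carrier := {u | ∀ n : ℕ, ∃ v : Acris C p, (p : Acris C p) ^ n * u = frob^[n] v}
  zero_mem' n := ⟨0, by rw [mul_zero, iterate_map_zero]⟩
  add_mem' hu hv n := by
    obtain ⟨a, ha⟩ := hu n
    obtain ⟨b, hb⟩ := hv n
    exact ⟨a + b, by rw [mul_add, ha, hb, iterate_map_add]⟩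
  smul_mem' w u hu n := by
    obtain ⟨v, hv⟩ := hu n
    have h1 : ∀ m : ℕ, ∃ w' : WittVector p (Perfection C p),
        frob^[m] (algebraMap _ (Acris C p) w') = algebraMap _ (Acris C p) w := by
      intro m
      induction m with
      | zero => exact ⟨w, rfl⟩
      | succ m ih =>
        obtain ⟨w', hw'⟩ := ih
        obtain ⟨w'', rfl⟩ := (WittVector.frobenius_bijective p (Perfection C p)).2 w'
        exact ⟨w'', by rw [Function.iterate_succ_apply, frob_algebraMap_witt, hw']⟩
    obtain ⟨w', hw'⟩ := h1 n
    exact ⟨algebraMap _ _ w' * v, by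
      rw [iterate_map_mul, hw', ← hv, Algebra.smul_def, mul_left_comm]⟩

end Acris

end acris

noncomputable section fbarMap
open scoped Nat

variable {C : Type*} [CommRing C] {p : ℕ} [hp : Fact p.Prime] [CharP C p]

/-- The term `(p^l - 1)! γ_{p^l}([x_{-l}])`, `l ≥ 1`, of the series defining `f̄(x)`; the index is
`l - 1`. -/
def polarTerm (x : BarM C p) (i : ℕ) : Acris C p :=
  ((p ^ (i + 1) - 1)! : ℕ) • Acris.gamma (p ^ (i + 1))
    ⟨WittVector.teichmuller p (x.1 (-(i + 1 : ℤ))),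
      teichmuller_mem_thetaKer _ (x.2.1 _ (by omega))⟩

/-- The map `f̄ : M̄(C) → A_cris(C)`,
`∑_m V^m [x_m] ↦ ∑_{m ≥ 0} V^m [x_m] + ∑_{l ≥ 1} (p^l - 1)! γ_{p^l}([x_{-l}])`. -/
def fbar (x : BarM C p) : Acris C p :=
  algebraMap (WittVector p (Perfection C p)) (Acris C p)
      (WittVector.mk p fun m : ℕ => x.1 m) + ∑' i : ℕ, polarTerm x i

end fbarMap

noncomputable section keyExample

/-- The monoid `ℤ_+[1/p]` of non-negative elements of `ℤ[1/p]`. -/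
def PExp (p : ℕ) : AddSubmonoid ℚ≥0 where
  carrier := {q | ∃ k m : ℕ, q * (p : ℚ≥0) ^ k = m}
  zero_mem' := ⟨0, 0, by simp⟩
  add_mem' := by
    rintro a b ⟨k, m, h⟩ ⟨k', m', h'⟩
    refine ⟨k + k', m * p ^ k' + m' * p ^ k, ?_⟩
    push_cast
    rw [← h, ← h']
    ring

/-- The element `1` of `ℤ_+[1/p]`. -/
def PExp.one (p : ℕ) : PExp p := ⟨1, 0, 1, by simp⟩

/-- The ring `B[x_1^{p^{-∞}}, …, x_n^{p^{-∞}}]` of finite sums `∑ b_α x^α`, `α ∈ ℤ_+[1/p]^n`. -/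
abbrev PerfPoly (B : Type*) [CommRing B] (p n : ℕ) : Type _ :=
  AddMonoidAlgebra B (Fin n → PExp p)

/-- The variable `x_i`. -/
def PerfPoly.X (B : Type*) [CommRing B] (p n : ℕ) (i : Fin n) : PerfPoly B p n :=
  AddMonoidAlgebra.single (Pi.single i (PExp.one p)) 1

/-- The ring `C = B[x_1^{p^{-∞}}, …, x_n^{p^{-∞}}] / (x_1, …, x_n)`. -/
abbrev KeyRing (B : Type*) [CommRing B] (p n : ℕ) : Type _ :=
  PerfPoly B p n ⧸ Ideal.span (Set.range (PerfPoly.X B p n))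

variable (B : Type*) [CommRing B] (p n : ℕ)

lemma PExp.add_eq_zero (a b : Fin n → PExp p) : a + b = 0 ↔ a = 0 ∧ b = 0 := by
  constructor
  · intro h
    have h' : ∀ i, (a i : ℚ≥0) = 0 ∧ (b i : ℚ≥0) = 0 := fun i => by
      have h1 : ((a i : ℚ≥0) + (b i : ℚ≥0)) = 0 := congrArg Subtype.val (congrFun h i)
      exact _root_.add_eq_zero.mp h1
    exact ⟨funext fun i => Subtype.ext (h' i).1, funext fun i => Subtype.ext (h' i).2⟩
  · rintro ⟨rfl, rfl⟩
    exact add_zero _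

open Classical in
/-- The homomorphism `B[x^{p^{-∞}}] → B` sending `x^α` to `0` for `α ≠ 0`. -/
def PerfPoly.aug : PerfPoly B p n →ₐ[B] B :=
  AddMonoidAlgebra.lift B B (Fin n → PExp p)
    { toFun := fun a => if a.toAdd = 0 then 1 else 0
      map_one' := by simp
      map_mul' := fun a b => by
        have h : (a * b).toAdd = 0 ↔ a.toAdd = 0 ∧ b.toAdd = 0 := by
          rw [toAdd_mul, PExp.add_eq_zero]
        by_cases h1 : a.toAdd = 0
        · by_cases h2 : b.toAdd = 0
          · rw [if_pos (h.mpr ⟨h1, h2⟩), if_pos h1, if_pos h2, one_mul]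
          · rw [if_neg fun h' => h2 (h.mp h').2, if_neg h2, mul_zero]
        · rw [if_neg fun h' => h1 (h.mp h').1, if_neg h1, zero_mul] }

instance [Fact p.Prime] [CharP B p] : CharP (KeyRing B p n) p := by
  have h : ∀ y ∈ Ideal.span (Set.range (PerfPoly.X B p n)), PerfPoly.aug B p n y = 0 := by
    intro y hy
    rw [← RingHom.mem_ker]
    refine (Ideal.span_le.mpr ?_ : _ ≤ RingHom.ker (PerfPoly.aug B p n)) hy
    rintro _ ⟨i, rfl⟩
    have h1 : (Pi.single i (PExp.one p) : Fin n → PExp p) ≠ 0 := fun h0 => by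
      have h2 : ((Pi.single i (PExp.one p) : Fin n → PExp p) i : ℚ≥0) = 0 := by rw [h0]; rfl
      rw [Pi.single_eq_same] at h2
      exact one_ne_zero h2
    rw [SetLike.mem_coe, RingHom.mem_ker, PerfPoly.X, PerfPoly.aug, AddMonoidAlgebra.lift_single]
    simp [h1]
  refine charP_of_injective_ringHom (f := algebraMap B (KeyRing B p n)) (fun a b hab => ?_) p
  have := congrArg (Ideal.Quotient.liftₐ _ (PerfPoly.aug B p n) h) hab
  simpa using this

end keyExample

end Fontaine

namespace Fontaine
open WittVector

/-! ### p-adic divisibility and factorials -/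

section padic
open scoped Nat

variable {p : ℕ} [hp : Fact p.Prime] {S : Type*} [CommRing S]

/-! Since FV = p on W(C^♭), the element V^{-N}w ought to correspond to p^{-N}F^N(w). In A_cris(C)
this makes sense as soon as the first N coordinates of w lie in Ker ν_0, because p^{-l}F^l[r] =
[r]^{p^l}/p^l = (p^l-1)! γ_{p^l}([r]) (`pow_mul_polar`, `pow_mul_divFrob`). The construction is
continuous: if ν_k kills the first l+k coordinates of w, those coordinates of F^{-k}w lie in Ker
ν_0, so F^l(w) = F^{l+k}(F^{-k}w) is divisible by p^{l+k} (`pow_dvd_algebraMap_iterate_frobenius`).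
Hence f̄(x) is the limit of p^{-N}F^N(s_N) whenever V^{-N}s_N tends to x and the first N coordinates
of s_N lie in Ker ν_0 (`eventually_pow_dvd_fbar_sub`). If A_cris(C) has no p-torsion, identities
between Witt vectors then give linearity, compatibility with F, and p f̄(x) = F(f̄(Vx)). Iterating
the last one puts f̄(x) in A'_cris(C).

The specific ring C enters through a basis: every element of A_cris(C) has a unique expansion with
coefficients in W(B) in the elements x^α/⌊α⌋!, where ⌊α⌋! is the product of the ⌊α_i⌋!. They span
modulo p because Ker(W(C^♭) → C) is generated by p and the [x_i] (`exists_eq_sum_teichX`,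
`exists_comb_pow`). They are independent because the PD hull maps to the completion of an explicit
ring of divided power polynomials (`DPSeries.exists_hullHom`, `pow_dvd_of_pow_dvd_comb`). Since F
multiplies exponents by p and coefficients by nonzero integers (after applying the Frobenius of
W(B)), A_cris(C) is torsion free and F is injective on it.

Injectivity is a degree argument. If f̄(x) = 0, then f̄(V^M x) = 0 for every M, so the nonnegative
part of V^M x equals minus a sum of polar terms, all of whose monomials have degree at least 1. A
Witt vector whose image has degree at least d has j-th coordinate of degree at least p^j d
(`tiltDeg_coeff`). The coordinate x_m therefore has degree at least p^{m+M} for all large M, and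
vanishes.

For surjectivity, take u in A'_cris(C), write p^L u = F^L(v_L), and cut the expansion of u into
layers p^L ≤ max α_i < p^{L+1} (layer 0 being max α_i < p). Layer L is p^{-L}F^L of the part of v_L
with 1 ≤ max α_i < p (only max α_i < p if L = 0). There ⌊α⌋! is prime to p, so this part comes from
a Witt vector w_L (`exists_witt_expands`, `exists_layer`). For L > 0 its coordinates lie in growing
powers of the topologically nilpotent ideal (x_1, …, x_n), which makes ∑ V^{-L}w_L converge in M̄(C)
(`exists_nilLim_layerSum`); its image is u (`exists_fbar_eq`). -/

lemma eq_zero_of_forall_pow_dvd [IsHausdorff (Ideal.span {(p : S)}) S] {x : S}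
    (h : ∀ m, (p : S) ^ m ∣ x) : x = 0 := by
  refine IsHausdorff.haus (I := Ideal.span {(p : S)}) inferInstance x fun m => ?_
  rw [SModEq.zero, smul_eq_mul, Ideal.mul_top, Ideal.span_singleton_pow, Ideal.mem_span_singleton]
  exact h m

lemma eq_of_forall_pow_dvd_sub [IsHausdorff (Ideal.span {(p : S)}) S] {x y : S}
    (h : ∀ m, (p : S) ^ m ∣ x - y) : x = y :=
  sub_eq_zero.mp (eq_zero_of_forall_pow_dvd h)

lemma pow_dvd_sub_of_le {f : ℕ → S} (h : ∀ m, (p : S) ^ m ∣ f (m + 1) - f m) {m k : ℕ}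
    (hmk : m ≤ k) : (p : S) ^ m ∣ f k - f m := by
  induction k, hmk using Nat.le_induction with
  | base => simp
  | succ k hk ih =>
    rw [← sub_add_sub_cancel _ (f k)]
    exact dvd_add ((pow_dvd_pow _ hk).trans (h k)) ih

lemma exists_forall_pow_dvd_sub [IsPrecomplete (Ideal.span {(p : S)}) S] {f : ℕ → S}
    (h : ∀ m, (p : S) ^ m ∣ f (m + 1) - f m) : ∃ u, ∀ m, (p : S) ^ m ∣ u - f m := by
  obtain ⟨u, hu⟩ := IsPrecomplete.prec (I := Ideal.span {(p : S)}) inferInstance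
    (f := f) (fun {m k} hmk => by
      rw [SModEq.comm, SModEq.sub_mem, smul_eq_mul, Ideal.mul_top, Ideal.span_singleton_pow,
        Ideal.mem_span_singleton]
      exact pow_dvd_sub_of_le h hmk)
  refine ⟨u, fun m => ?_⟩
  have := hu m
  rwa [SModEq.comm, SModEq.sub_mem, smul_eq_mul, Ideal.mul_top, Ideal.span_singleton_pow,
    Ideal.mem_span_singleton] at this

/-- In a p-adically complete ring p lies in the Jacobson radical, and a Bézout relation exhibits a
multiple of k as 1 - bp. -/
lemma isUnit_natCast_of_coprime [IsAdicComplete (Ideal.span {(p : S)}) S] {k : ℕ}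
    (hk : k.Coprime p) : IsUnit (k : S) := by
  have h := Nat.isCoprime_iff_coprime.mpr hk
  obtain ⟨a, b, hab⟩ := h
  have h1 : (p : S) ∈ (⊥ : Ideal S).jacobson :=
    IsAdicComplete.le_jacobson_bot (Ideal.span {(p : S)}) (Ideal.mem_span_singleton_self _)
  rw [Ideal.mem_jacobson_bot] at h1
  have h2 := h1 (-b)
  have h3 : (p : S) * -b + 1 = a * k := by
    have := congrArg (Int.cast (R := S)) hab
    push_cast at this
    rw [← this]; ring
  rw [h3] at h2
  exact isUnit_of_mul_isUnit_right h2

lemma exists_factorial_eq (k : ℕ) : ∃ v m : ℕ, k ! = p ^ v * m ∧ m.Coprime p ∧ (k ≠ 0 → v < k) := by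
  obtain ⟨v, m, hm, h⟩ := Nat.exists_eq_pow_mul_and_not_dvd (Nat.factorial_ne_zero k) p
    hp.out.ne_one
  refine ⟨v, m, h, ((Nat.Prime.coprime_iff_not_dvd hp.out).mpr hm).symm, fun hk => ?_⟩
  refine lt_of_le_of_lt ?_ (padicValNat_factorial_lt_of_ne_zero p hk)
  exact (padicValNat_dvd_iff_le (Nat.factorial_ne_zero k)).mp ⟨m, h⟩

/-- The valuation of k! at p is less than k, and the prime-to-p part of k! is a unit. -/
lemma exists_factorial_mul_eq [IsAdicComplete (Ideal.span {(p : S)}) S] {k : ℕ} (hk : k ≠ 0) :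
    ∃ c : S, (k ! : S) * (p * c) = (p : S) ^ k := by
  obtain ⟨v, m, h, hm, hv⟩ := exists_factorial_eq (p := p) k
  obtain ⟨u, hu⟩ := isUnit_natCast_of_coprime (S := S) hm
  obtain ⟨j, hj⟩ := Nat.exists_eq_add_of_lt (hv hk)
  refine ⟨p ^ j * (↑u⁻¹ : S), ?_⟩
  rw [h, hj]
  push_cast
  rw [← hu]
  linear_combination (p : S) ^ (v + j + 1) * u.mul_inv

lemma exists_factorial_mul_eq_pow [IsAdicComplete (Ideal.span {(p : S)}) S] (k : ℕ) :
    ∃ c : S, (k ! : S) * c = (p : S) ^ k := by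
  rcases eq_or_ne k 0 with rfl | hk
  · exact ⟨1, by simp⟩
  · obtain ⟨c, hc⟩ := exists_factorial_mul_eq (p := p) (S := S) hk
    exact ⟨_, hc⟩

lemma natCast_mul_left_injective [IsAdicComplete (Ideal.span {(p : S)}) S]
    (ht : ∀ x : S, p * x = 0 → x = 0) {k : ℕ} (hk : k ≠ 0) {x : S} (h : (k : S) * x = 0) :
    x = 0 := by
  obtain ⟨v, m, hm, e⟩ := Nat.exists_eq_pow_mul_and_not_dvd hk p hp.out.ne_one
  have hu := isUnit_natCast_of_coprime (S := S) ((Nat.Prime.coprime_iff_not_dvd hp.out).mpr hm).symm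
  have h1 : ∀ v : ℕ, ∀ y : S, (p : S) ^ v * y = 0 → y = 0 := by
    intro v
    induction v with
    | zero => intro y hy; simpa using hy
    | succ v ih => intro y hy; exact ht y (ih _ (by rw [← mul_assoc, ← pow_succ, hy]))
  rw [e] at h
  push_cast at h
  rw [mul_assoc] at h
  exact (hu.mul_right_eq_zero).mp (h1 _ _ h)

lemma pow_dvd_of_pow_add_dvd (ht : ∀ x : S, p * x = 0 → x = 0) {N M : ℕ} {x : S}
    (h : (p : S) ^ (N + M) ∣ p ^ N * x) : (p : S) ^ M ∣ x := by
  have h1 : ∀ v : ℕ, ∀ y : S, (p : S) ^ v * y = 0 → y = 0 := by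
    intro v
    induction v with
    | zero => intro y hy; simpa using hy
    | succ v ih => intro y hy; exact ht y (ih _ (by rw [← mul_assoc, ← pow_succ, hy]))
  obtain ⟨c, hc⟩ := h
  refine ⟨c, sub_eq_zero.mp (h1 N _ ?_)⟩
  rw [mul_sub, hc]; ring

lemma pow_dvd_factorial_pow_succ (i : ℕ) : p ^ i ∣ (p ^ (i + 1) - 1)! := by
  induction i with
  | zero => simp
  | succ i ih =>
    have h1 : p ^ (i + 1) * 1 < p ^ (i + 1) * p :=
      Nat.mul_lt_mul_of_pos_left hp.out.one_lt (pow_pos hp.out.pos _)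
    have h2 : 0 < p ^ (i + 1) := pow_pos hp.out.pos _
    exact Nat.dvd_factorial h2 (by rw [pow_succ p (i + 1)]; omega)

lemma wittVector_natCast_mul {R : Type*} [CommRing R] [CharP R p] [PerfectRing R p] {k : ℕ}
    (hk : k ≠ 0) {x : WittVector p R} (h : (k : WittVector p R) * x = 0) : x = 0 :=
  natCast_mul_left_injective (p := p)
    (fun x hx => eq_zero_of_p_mul_eq_zero x (by rw [mul_comm, hx])) hk h

end padic

/-! ### The p-adic completion of a ring -/

section adicCompletion

variable {p : ℕ} [hp : Fact p.Prime] {D : Type*} [CommRing D]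

lemma isAdicComplete_adicCompletion : IsAdicComplete
    (Ideal.span {(p : AdicCompletion (Ideal.span {(p : D)}) D)})
    (AdicCompletion (Ideal.span {(p : D)}) D) := by
  have h := AdicCompletion.isAdicComplete (I := Ideal.span {(p : D)}) (M := D)
    ⟨{(p : D)}, by simp⟩
  have e : Ideal.span {(p : AdicCompletion (Ideal.span {(p : D)}) D)} =
      (Ideal.span {(p : D)}).map (algebraMap D (AdicCompletion (Ideal.span {(p : D)}) D)) := by
    rw [Ideal.map_span, Set.image_singleton, map_natCast]
  rw [e]
  exact { haus' := (IsHausdorff.map_algebraMap_iff.mpr h.toIsHausdorff).haus'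
          prec' := (IsPrecomplete.map_algebraMap_iff.mpr h.toIsPrecomplete).prec' }

lemma pow_dvd_of_evalₐ_eq_zero {m : ℕ} {u : AdicCompletion (Ideal.span {(p : D)}) D}
    (h : AdicCompletion.evalₐ (Ideal.span {(p : D)}) m u = 0) :
    (p : AdicCompletion (Ideal.span {(p : D)}) D) ^ m ∣ u := by
  have h1 : u ∈ (AdicCompletion.eval (Ideal.span {(p : D)}) D m).ker := by
    rw [LinearMap.mem_ker]
    have := AdicCompletion.factor_evalₐ_eq_eval (I := Ideal.span {(p : D)}) (n := m) u (by simp)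
    rw [← this, h, map_zero]
  rw [← AdicCompletion.pow_smul_top_eq_ker_eval ⟨{(p : D)}, by simp⟩,
    Ideal.span_singleton_pow, Submodule.ideal_span_singleton_smul] at h1
  obtain ⟨v, -, rfl⟩ := (Submodule.mem_smul_pointwise_iff_exists _ _ _).mp h1
  refine ⟨v, ?_⟩
  rw [Algebra.smul_def, map_pow, map_natCast]

lemma exists_pow_dvd_sub_of (m : ℕ) (u : AdicCompletion (Ideal.span {(p : D)}) D) :
    ∃ d : D, (p : AdicCompletion (Ideal.span {(p : D)}) D) ^ m ∣ u - algebraMap D _ d := by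
  obtain ⟨d, hd⟩ := Ideal.Quotient.mk_surjective (AdicCompletion.evalₐ (Ideal.span {(p : D)}) m u)
  refine ⟨d, pow_dvd_of_evalₐ_eq_zero ?_⟩
  rw [map_sub, ← hd, sub_eq_zero]
  exact (AdicCompletion.evalₐ_of _ _ _).symm

lemma pow_dvd_of_pow_dvd_algebraMap {m : ℕ} {d : D}
    (h : (p : AdicCompletion (Ideal.span {(p : D)}) D) ^ m ∣ algebraMap D _ d) :
    (p : D) ^ m ∣ d := by
  obtain ⟨c, hc⟩ := h
  have h1 := congrArg (AdicCompletion.evalₐ (Ideal.span {(p : D)}) m) hc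
  have h2 : AdicCompletion.evalₐ (Ideal.span {(p : D)}) m (algebraMap D _ d)
    = Ideal.Quotient.mk _ d := AdicCompletion.evalₐ_of _ _ _
  have h3 : (p : D ⧸ Ideal.span {(p : D)} ^ m) ^ m = 0 := by
    rw [← map_natCast (Ideal.Quotient.mk (Ideal.span {(p : D)} ^ m)), ← map_pow,
      Ideal.Quotient.eq_zero_iff_mem]
    exact Ideal.pow_mem_pow (Ideal.mem_span_singleton_self _) _
  rw [h2, map_mul, map_pow, map_natCast, h3, zero_mul, Ideal.Quotient.eq_zero_iff_mem,
    Ideal.span_singleton_pow, Ideal.mem_span_singleton] at h1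
  exact h1

/-- An element is approximated by elements of `D`, where p can be cancelled by hypothesis. -/
lemma adicCompletion_torsionFree (ht : ∀ d : D, p * d = 0 → d = 0)
    {u : AdicCompletion (Ideal.span {(p : D)}) D} (hu : p * u = 0) : u = 0 := by
  have := isAdicComplete_adicCompletion (p := p) (D := D)
  refine eq_zero_of_forall_pow_dvd (p := p) fun m => ?_
  -- Precision m + 1, because cancelling p costs one power.
  obtain ⟨d, v, hd⟩ := exists_pow_dvd_sub_of (m + 1) u
  have h1 : (p : D) ^ (m + 1) ∣ p * d := by
    refine pow_dvd_of_pow_dvd_algebraMap ⟨-(p * v), ?_⟩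
    rw [map_mul, map_natCast]
    linear_combination hu - (p : AdicCompletion (Ideal.span {(p : D)}) D) * hd
  have h2 : (p : D) ^ m ∣ d :=
    pow_dvd_of_pow_add_dvd (N := 1) ht (by rwa [pow_one, add_comm])
  obtain ⟨c, rfl⟩ := h2
  refine ⟨algebraMap D _ c + p * v, ?_⟩
  rw [map_mul, map_pow, map_natCast] at hd
  linear_combination hd

end adicCompletion

/-! ### The PD hull: universal property and rules for divided powers -/

section pdHullLift
open scoped Nat

variable {p : ℕ} {A : Type*} [CommRing A] {I : Ideal A} {S : Type*} [CommRing S]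

/-- The universal property of the PD hull, in terms of a system of divided powers. -/
lemma PDHull.exists_lift (g : A →+* S) (dpS : ℕ → I → S) (h_zero : ∀ x, dpS 0 x = 1)
    (h_one : ∀ x, dpS 1 x = g x) (h_smul : ∀ n (a : A) (x : I), dpS n (a • x) = g a ^ n * dpS n x)
    (h_mul : ∀ m n x, dpS m x * dpS n x = (m + n).choose m • dpS (m + n) x)
    (h_add : ∀ n x y, dpS n (x + y) = ∑ k ∈ Finset.HasAntidiagonal.antidiagonal n, dpS k.1 x * dpS k.2 y)
    (h_base : ∀ (x : I), (x : A) = p → ∀ (n : ℕ) (a : A), (n ! : A) * a = (p : A) ^ n →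
      dpS n x = g a) :
    ∃ f : PDHull p I →+* S, (∀ a, f (algebraMap A _ a) = g a) ∧
      ∀ n x, f (PDHull.gamma p I n x) = dpS n x := by
  let _ := g.toAlgebra
  let f₀ : DividedPowerAlgebra A I →ₐ[A] S := DividedPowerAlgebra.lift' (f := fun nx => dpS nx.1 nx.2)
    h_zero (fun n a x => by rw [h_smul, ← map_pow, Algebra.smul_def]; rfl)
    (fun m n x => by rw [h_mul])
    h_add
  have hf₀ : ∀ n x, f₀ (DividedPowerAlgebra.dp A n x) = dpS n x := fun n x =>
    DividedPowerAlgebra.lift'_apply_dp _ _ _ _ n x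
  have hf₁ : ∀ a, f₀ (algebraMap A _ a) = g a := fun a => f₀.commutes a
  refine ⟨Ideal.Quotient.lift _ f₀.toRingHom fun t ht => ?_, hf₁, hf₀⟩
  rw [← RingHom.mem_ker]
  refine (Ideal.span_le.mpr ?_ : _ ≤ RingHom.ker f₀.toRingHom) ht
  rintro _ (⟨x⟩ | ⟨x, hx, n, a, ha⟩)
  · change f₀ _ = 0
    rw [map_sub, hf₀, hf₁, h_one, sub_self]
  · change f₀ _ = 0
    rw [map_sub, hf₀, hf₁, h_base x hx n a ha, sub_self]

lemma PDHull.induction_on {P : PDHull p I → Prop} (d : PDHull p I)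
    (algebraMap : ∀ a, P (algebraMap A _ a)) (add : ∀ x y, P x → P y → P (x + y))
    (gamma : ∀ x n y, P x → P (x * PDHull.gamma p I n y)) : P d := by
  obtain ⟨d, rfl⟩ := Ideal.Quotient.mk_surjective d
  induction d using DividedPowerAlgebra.induction_on with
  | C a => exact algebraMap a
  | add f g hf hg => exact add _ _ hf hg
  | dp f n m hf => exact gamma _ _ _ hf

lemma PDHull.gamma_zero (x : I) : PDHull.gamma p I 0 x = 1 := by
  rw [PDHull.gamma, DividedPowerAlgebra.dp_zero, map_one]

lemma PDHull.gamma_one (x : I) : PDHull.gamma p I 1 x = algebraMap A _ (x : A) := by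
  have : PDHull.mk p I (DividedPowerAlgebra.dp A 1 x - algebraMap A _ (x : A)) = 0 :=
    Ideal.Quotient.eq_zero_iff_mem.mpr (Ideal.subset_span (PDRel.deg_one x))
  rw [map_sub, sub_eq_zero] at this
  exact this

lemma PDHull.factorial_mul_gamma (n : ℕ) (x : I) :
    (n ! : PDHull p I) * PDHull.gamma p I n x = algebraMap A _ (x : A) ^ n := by
  rw [← PDHull.gamma_one, PDHull.gamma, PDHull.gamma, ← map_pow,
    ← DividedPowerAlgebra.natFactorial_mul_dp_eq, map_mul, map_natCast]

lemma PDHull.gamma_mul (m n : ℕ) (x : I) : PDHull.gamma p I m x * PDHull.gamma p I n x =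
    (m + n).choose m • PDHull.gamma p I (m + n) x := by
  rw [PDHull.gamma, PDHull.gamma, ← map_mul, DividedPowerAlgebra.dp_mul, map_nsmul]
  rfl

lemma PDHull.gamma_add (n : ℕ) (x y : I) : PDHull.gamma p I n (x + y) =
    ∑ k ∈ Finset.HasAntidiagonal.antidiagonal n, PDHull.gamma p I k.1 x * PDHull.gamma p I k.2 y := by
  rw [PDHull.gamma, DividedPowerAlgebra.dp_add, map_sum]
  simp only [map_mul]
  rfl

lemma PDHull.gamma_smul (n : ℕ) (a : A) (x : I) : PDHull.gamma p I n (a • x) =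
    algebraMap A _ (a ^ n) * PDHull.gamma p I n x := by
  rw [PDHull.gamma, DividedPowerAlgebra.dp_smul, Algebra.smul_def, map_mul]
  rfl

lemma PDHull.gamma_natCast (x : I) (hx : (x : A) = p) (n : ℕ) (a : A)
    (ha : (n ! : A) * a = (p : A) ^ n) : PDHull.gamma p I n x = algebraMap A _ a := by
  have : PDHull.mk p I (DividedPowerAlgebra.dp A n x - algebraMap A _ a) = 0 :=
    Ideal.Quotient.eq_zero_iff_mem.mpr (Ideal.subset_span (PDRel.base x hx n a ha))
  rw [map_sub, sub_eq_zero] at this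
  exact this

end pdHullLift

end Fontaine

namespace Fontaine
open WittVector

/-! ### The map f̄ for an arbitrary ring C of characteristic p -/

noncomputable section general
open scoped Nat
open Filter Topology

variable {C : Type*} [CommRing C] {p : ℕ} [hp : Fact p.Prime] [CharP C p]

instance : IsAdicComplete (Ideal.span {(p : Acris C p)}) (Acris C p) :=
  isAdicComplete_adicCompletion (D := PDHull p (thetaKer C p))

lemma Acris.algebraMap_witt (w : WittVector p (Perfection C p)) :
    algebraMap _ (Acris C p) w =
      algebraMap (PDHull p (thetaKer C p)) (Acris C p) (algebraMap _ _ w) := rfl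

lemma Acris.factorial_mul_gamma (k : ℕ) (w : thetaKer C p) :
    (k ! : Acris C p) * Acris.gamma k w =
      algebraMap (WittVector p (Perfection C p)) (Acris C p) (w : WittVector p _) ^ k := by
  rw [Acris.gamma, Acris.algebraMap_witt, ← map_pow, ← PDHull.factorial_mul_gamma, map_mul,
    map_natCast]

lemma Acris.exists_pow_dvd_sub (m : ℕ) (u : Acris C p) :
    ∃ d : PDHull p (thetaKer C p), (p : Acris C p) ^ m ∣ u - algebraMap _ _ d :=
  exists_pow_dvd_sub_of (D := PDHull p (thetaKer C p)) m u

lemma Acris.pow_dvd_of_algebraMap {m : ℕ} {d : PDHull p (thetaKer C p)}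
    (h : (p : Acris C p) ^ m ∣ algebraMap _ _ d) : (p : PDHull p (thetaKer C p)) ^ m ∣ d :=
  pow_dvd_of_pow_dvd_algebraMap h

section topology

lemma Acris.eventually_iff {ι : Type*} {l : Filter ι} {f : ι → Acris C p} {a : Acris C p} :
    Tendsto f l (𝓝 a) ↔ ∀ m, ∀ᶠ i in l, (p : Acris C p) ^ m ∣ a - f i := by
  rw [(Ideal.hasBasis_nhds_adic (Ideal.span {(p : Acris C p)}) a).tendsto_right_iff]
  refine ⟨fun h m => (h m trivial).mono fun i hi => ?_, fun h m _ => (h m).mono fun i hi => ?_⟩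
  · obtain ⟨y, hy, hy'⟩ := hi
    rw [SetLike.mem_coe, Ideal.span_singleton_pow, Ideal.mem_span_singleton] at hy
    have : a - f i = -y := by rw [← hy']; simp
    rw [this]
    exact hy.neg_right
  · refine ⟨f i - a, ?_, by simp⟩
    rw [SetLike.mem_coe, Ideal.span_singleton_pow, Ideal.mem_span_singleton, ← neg_sub]
    exact hi.neg_right

instance : T2Space (Acris C p) := by
  refine t2_iff_nhds.mpr fun {x y} h => eq_of_forall_pow_dvd_sub (p := p) fun m => ?_
  have h1 := Acris.eventually_iff.mp
    (tendsto_id'.mpr (inf_le_left : 𝓝 x ⊓ 𝓝 y ≤ 𝓝 x)) m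
  have h2 := Acris.eventually_iff.mp
    (tendsto_id'.mpr (inf_le_right : 𝓝 x ⊓ 𝓝 y ≤ 𝓝 y)) m
  obtain ⟨z, h3, h4⟩ := (h1.and h2).exists
  have := dvd_sub h3 h4
  rwa [sub_sub_sub_cancel_right] at this

/-- The bound on the remainder after N terms is kept, since every later comparison is made modulo a
fixed power of p. -/
lemma Acris.exists_hasSum {f : ℕ → Acris C p} (h : ∀ i, (p : Acris C p) ^ i ∣ f i) :
    ∃ a, HasSum f a ∧ ∀ N, (p : Acris C p) ^ N ∣ a - ∑ i ∈ Finset.range N, f i := by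
  obtain ⟨a, ha⟩ := exists_forall_pow_dvd_sub (p := p)
    (f := fun N => ∑ i ∈ Finset.range N, f i) fun m => by
      rw [Finset.sum_range_succ, add_sub_cancel_left]; exact h m
  refine ⟨a, Acris.eventually_iff.mpr fun m => ?_, ha⟩
  filter_upwards [eventually_ge_atTop (Finset.range m)] with S hS
  have h1 : (p : Acris C p) ^ m ∣ ∑ i ∈ S \ Finset.range m, f i := Finset.dvd_sum fun i hi => by
    rw [Finset.mem_sdiff, Finset.mem_range, not_lt] at hi
    exact (pow_dvd_pow _ hi.2).trans (h i)
  rw [← Finset.sum_sdiff hS, add_comm, ← sub_sub]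
  exact dvd_sub (ha m) h1

end topology

/-! ### Division of F^N by p^N, and continuity -/

section frobeniusPowers

open Classical in
/-- The element `(p^l - 1)! γ_{p^l}([r])`, for `r ∈ Ker ν_0`. -/
def polar (l : ℕ) (r : Perfection C p) : Acris C p :=
  -- The value 0 outside Ker ν_0 only serves to make `polar` and `divFrob` total.
  if h : Perfection.coeff C p 0 r = 0 then
    ((p ^ l - 1)! : ℕ) • Acris.gamma (p ^ l) ⟨teichmuller p r, teichmuller_mem_thetaKer _ h⟩
  else 0

lemma polarTerm_eq_polar (x : BarM C p) (i : ℕ) :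
    polarTerm x i = polar (i + 1) (x.1 (-(i + 1 : ℤ))) := by
  rw [polar, dif_pos (x.2.1 _ (by omega))]
  rfl

/-- The factorial alone supplies the power of p, so the polar series converges without appeal to
topological nilpotence. -/
lemma pow_dvd_polar (i : ℕ) (r : Perfection C p) :
    (p : Acris C p) ^ i ∣ polar (i + 1) r := by
  rw [polar]
  split_ifs with h
  · rw [nsmul_eq_mul]
    refine Dvd.dvd.mul_right ?_ _
    rw [← Nat.cast_pow]
    exact Nat.cast_dvd_cast (pow_dvd_factorial_pow_succ i)
  · exact dvd_zero _

lemma iterate_frobenius_teichmuller (l : ℕ) (r : Perfection C p) :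
    WittVector.frobenius^[l] (teichmuller p r) = teichmuller p r ^ p ^ l := by
  induction l generalizing r with
  | zero => simp
  | succ l ih => rw [Function.iterate_succ_apply, frob_teich, ih, map_pow, ← pow_mul, pow_succ']

/-- Indeed p^l (p^l-1)! = (p^l)!, and (p^l)! γ_{p^l}([r]) = [r]^{p^l} = F^l[r]. So `polar l r` plays
the role of p^{-l}F^l[r]. -/
lemma pow_mul_polar (l : ℕ) (r : Perfection C p) (h : Perfection.coeff C p 0 r = 0) :
    (p : Acris C p) ^ l * polar l r =
      algebraMap (WittVector p (Perfection C p)) (Acris C p)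
        (WittVector.frobenius^[l] (teichmuller p r)) := by
  rw [iterate_frobenius_teichmuller, map_pow, polar, dif_pos h, nsmul_eq_mul, ← mul_assoc,
    ← Nat.cast_pow, ← Nat.cast_mul, Nat.mul_factorial_pred (pow_pos hp.out.pos _).ne']
  exact Acris.factorial_mul_gamma _ ⟨teichmuller p r, teichmuller_mem_thetaKer _ h⟩

/-- The element `p^{-N} F^N(w)` of `A_cris(C)`, for a Witt vector `w` whose first `N` coordinates
lie in `Ker ν_0`. -/
def divFrob (N : ℕ) (w : WittVector p (Perfection C p)) : Acris C p :=
  algebraMap (WittVector p (Perfection C p)) (Acris C p) (WittVector.mk p fun i => w.coeff (i + N))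
    + ∑ i ∈ Finset.range N, polar (i + 1) (w.coeff (N - 1 - i))

lemma divFrob_succ (N : ℕ) (w : WittVector p (Perfection C p)) :
    divFrob (N + 1) w = polar (N + 1) (w.coeff 0) + divFrob N (wtl w) := by
  rw [divFrob, divFrob, Finset.sum_range_succ, Nat.add_sub_cancel, Nat.sub_self]
  have : ∑ i ∈ Finset.range N, polar (i + 1) (w.coeff (N - i)) =
      ∑ i ∈ Finset.range N, polar (i + 1) ((wtl w).coeff (N - 1 - i)) :=
    Finset.sum_congr rfl fun i hi => by
      rw [Finset.mem_range] at hi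
      rw [wtl_coeff]
      congr 2
      omega
  rw [this, add_comm (Finset.sum _ _), ← add_assoc, add_comm (algebraMap _ _ _), add_assoc]
  rfl

/-- Splitting off one coordinate, w = [w_0] + V(w'), and F^{N+1}V = pF^N reduces the second term to
w' and N. The coordinate w_j with j < N thus contributes a polar term of level N - j. -/
lemma pow_mul_divFrob (N : ℕ) (w : WittVector p (Perfection C p))
    (hw : ∀ j < N, Perfection.coeff C p 0 (w.coeff j) = 0) :
    (p : Acris C p) ^ N * divFrob N w =
      algebraMap (WittVector p (Perfection C p)) (Acris C p) (WittVector.frobenius^[N] w) := by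
  induction N generalizing w with
  | zero => simp [divFrob, WittVector.mk]
  | succ N ih =>
    rw [divFrob_succ, mul_add, pow_mul_polar _ _ (hw 0 (by omega)), pow_succ', mul_assoc,
      ih _ fun j hj => hw (j + 1) (by omega)]
    conv_rhs => rw [eq_cons w, iterate_map_add, Function.iterate_succ_apply _ _ (verschiebung _),
      frobenius_verschiebung, mul_comm, ← nsmul_eq_mul, iterate_map_nsmul, nsmul_eq_mul]
    rw [map_add, map_mul, map_natCast]

lemma coeff_pow_p_pow (k : ℕ) (r : Perfection C p) :
    Perfection.coeff C p k (r ^ p ^ k) = Perfection.coeff C p 0 r := by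
  have := Perfection.coeffMonoidHom_pow_p_pow r 0 k
  rw [zero_add] at this
  exact this

lemma iterate_frobenius_frobInv (k : ℕ) (w : WittVector p (Perfection C p)) :
    WittVector.frobenius^[k] (frobInv w k) = w := by
  induction k with
  | zero => rfl
  | succ k ih => rw [Function.iterate_succ_apply, frob_frobInv, ih]

lemma frobInv_coeff_pow (k i : ℕ) (w : WittVector p (Perfection C p)) :
    (frobInv w k).coeff i ^ p ^ k = w.coeff i := by
  conv_rhs => rw [← iterate_frobenius_frobInv k w]
  rw [iterate_frobenius_coeff]

lemma coeff_frobInv_coeff (k i : ℕ) (w : WittVector p (Perfection C p)) :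
    Perfection.coeff C p 0 ((frobInv w k).coeff i) = Perfection.coeff C p k (w.coeff i) := by
  rw [← frobInv_coeff_pow k i w, coeff_pow_p_pow]

/-- Since ν_0(F^{-k}w) is ν_k(w) coordinate by coordinate, `pow_mul_divFrob` applies to F^{-k}w with
N = l + k. This is the source of all continuity statements. -/
lemma pow_dvd_algebraMap_iterate_frobenius (l k : ℕ) (w : WittVector p (Perfection C p))
    (hw : ∀ i < l + k, Perfection.coeff C p k (w.coeff i) = 0) :
    (p : Acris C p) ^ (l + k) ∣ algebraMap (WittVector p (Perfection C p)) (Acris C p)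
      (WittVector.frobenius^[l] w) := by
  rw [← iterate_frobenius_frobInv k w, ← Function.iterate_add_apply, ← pow_mul_divFrob (l + k) _
    fun i hi => by rw [coeff_frobInv_coeff, hw i hi]]
  exact dvd_mul_right _ _

lemma coeff_sub_coeff_eq_zero {l k : ℕ} {w w' : WittVector p (Perfection C p)}
    (h : ∀ i < l, Perfection.coeff C p k (w.coeff i) = Perfection.coeff C p k (w'.coeff i)) :
    ∀ i < l, Perfection.coeff C p k ((w - w').coeff i) = 0 := by
  intro i hi
  have h1 := (le_coeff_eq_iff_le_sub_coeff_eq_zero (x := WittVector.map (Perfection.coeff C p k) w)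
    (y := WittVector.map (Perfection.coeff C p k) w') (n := l)).mp
    (fun i hi => by rw [WittVector.map_coeff, WittVector.map_coeff, h i hi]) i hi
  rwa [← map_sub, WittVector.map_coeff] at h1

/-- Continuity of W(C^♭) → A_cris(C) for the topology of coordinatewise convergence: the case l = 0
of the preceding divisibility. -/
lemma pow_dvd_algebraMap_sub {k : ℕ} {w w' : WittVector p (Perfection C p)}
    (h : ∀ i < k, Perfection.coeff C p k (w.coeff i) = Perfection.coeff C p k (w'.coeff i)) :
    (p : Acris C p) ^ k ∣ algebraMap (WittVector p (Perfection C p)) (Acris C p) w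
      - algebraMap (WittVector p (Perfection C p)) (Acris C p) w' := by
  rw [← map_sub]
  have := pow_dvd_algebraMap_iterate_frobenius 0 k (w - w')
    (coeff_sub_coeff_eq_zero (by rwa [zero_add]))
  rwa [zero_add] at this

/-- After multiplication by p^l this is a divisibility of F^l([r] - [r']) by p^{l+k}; the absence of
torsion then removes p^l. The precision k does not depend on the level l. -/
lemma pow_dvd_polar_sub (ht : ∀ u : Acris C p, p * u = 0 → u = 0) (l : ℕ) {k : ℕ}
    {r r' : Perfection C p} (hr : Perfection.coeff C p 0 r = 0)
    (h : Perfection.coeff C p k r = Perfection.coeff C p k r') :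
    (p : Acris C p) ^ k ∣ polar l r - polar l r' := by
  have hr' : Perfection.coeff C p 0 r' = 0 := by
    -- Membership of r' in Ker ν_0 is automatic, because ν_0 is the p^k-th power of ν_k.
    have e : ∀ s : Perfection C p,
        Perfection.coeff C p k s ^ p ^ k = Perfection.coeff C p 0 s :=
      fun s => by rw [← map_pow, coeff_pow_p_pow]
    rw [← e, ← h, e, hr]
  refine pow_dvd_of_pow_add_dvd ht (N := l) ?_
  rw [mul_sub, pow_mul_polar l r hr, pow_mul_polar l r' hr', ← map_sub, ← iterate_map_sub]
  refine pow_dvd_algebraMap_iterate_frobenius l k _ (coeff_sub_coeff_eq_zero fun i _ => ?_)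
  cases i with
  | zero => simpa using h
  | succ i => rw [teichmuller_coeff_pos p r _ i.succ_pos, teichmuller_coeff_pos p r' _ i.succ_pos]

end frobeniusPowers

/-! ### f̄ as a limit, and its algebraic properties -/

section fbar

lemma hasSum_polarTerm (x : BarM C p) : ∃ a, HasSum (polarTerm x) a ∧
    ∀ N, (p : Acris C p) ^ N ∣ a - ∑ i ∈ Finset.range N, polarTerm x i :=
  Acris.exists_hasSum fun i => by rw [polarTerm_eq_polar]; exact pow_dvd_polar i _

lemma summable_polarTerm (x : BarM C p) : Summable (polarTerm x) :=
  (hasSum_polarTerm x).imp fun _ h => h.1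

lemma pow_dvd_tsum_polarTerm_sub (x : BarM C p) (N : ℕ) :
    (p : Acris C p) ^ N ∣ ∑' i, polarTerm x i - ∑ i ∈ Finset.range N, polarTerm x i := by
  obtain ⟨a, h1, h2⟩ := hasSum_polarTerm x
  rw [h1.tsum_eq]
  exact h2 N

/-- `f̄(x)` is the limit of `p^{-N} F^N(s_N)` if `x` is the limit of `V^{-N} s_N`. -/
lemma eventually_pow_dvd_fbar_sub (ht : ∀ u : Acris C p, p * u = 0 → u = 0)
    {s : ℕ → WittVector p (Perfection C p)} {x : BarM C p}
    (hs : ∀ N j, j < N → Perfection.coeff C p 0 ((s N).coeff j) = 0) (h : IsLim s x.1) (M : ℕ) :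
    ∀ᶠ N : ℕ in atTop, (p : Acris C p) ^ (N + M) ∣ p ^ N * fbar x -
      algebraMap (WittVector p (Perfection C p)) (Acris C p) (WittVector.frobenius^[N] (s N)) := by
  -- Modulo p^M only the coordinates with |m| ≤ M matter, and only through ν_M: coordinates of index
  -- at least M do not affect the regular part modulo p^M, and polar terms of level above M are
  -- divisible by p^M.
  have h1 : ∀ᶠ N : ℕ in atTop, ∀ m ∈ Finset.Icc (-(M : ℤ)) M,
      Perfection.coeff C p M ((s N).coeff (m + N).toNat) = Perfection.coeff C p M (x.1 m) := by
    rw [Filter.eventually_all_finset]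
    exact fun m _ => h M m
  filter_upwards [h1, eventually_ge_atTop M] with N h2 hN
  rw [← pow_mul_divFrob N _ (hs N), ← mul_sub, pow_add]
  refine mul_dvd_mul_left _ ?_
  rw [fbar, divFrob, add_sub_add_comm]
  refine dvd_add (pow_dvd_algebraMap_sub fun i hi => ?_) ?_
  · rw [coeff_mk, coeff_mk, ← h2 i (by rw [Finset.mem_Icc]; omega)]
    congr 2
  · rw [← sub_add_sub_cancel _ (∑ i ∈ Finset.range N, polarTerm x i), ← Finset.sum_sub_distrib]
    refine dvd_add ((pow_dvd_pow _ hN).trans (pow_dvd_tsum_polarTerm_sub x N))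
      (Finset.dvd_sum fun i hi => ?_)
    rw [Finset.mem_range] at hi
    rw [polarTerm_eq_polar]
    rcases lt_or_ge i M with hiM | hiM
    · refine pow_dvd_polar_sub ht _ (x.2.1 _ (by omega)) ?_
      rw [← h2 _ (by rw [Finset.mem_Icc]; omega)]
      congr 2
      omega
    · exact dvd_sub ((pow_dvd_pow _ hiM).trans (pow_dvd_polar i _))
        ((pow_dvd_pow _ hiM).trans (pow_dvd_polar i _))

lemma eventually_fbar_trunc (ht : ∀ u : Acris C p, p * u = 0 → u = 0) (x : BarM C p) (M : ℕ) :
    ∀ᶠ N : ℕ in atTop, (p : Acris C p) ^ (N + M) ∣ p ^ N * fbar x -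
      algebraMap (WittVector p (Perfection C p)) (Acris C p)
        (WittVector.frobenius^[N] (trunc x.1 N)) :=
  eventually_pow_dvd_fbar_sub ht (fun N j hj => x.2.1 _ (by omega)) (nilLim_trunc x).2 M

lemma NilLim.coeff_eq_zero {s : ℕ → WittVector p (Perfection C p)} {x : ℤ → Perfection C p}
    (h : NilLim s x) (N j : ℕ) (hj : j < N) : Perfection.coeff C p 0 ((s N).coeff j) = 0 := by
  obtain ⟨⟨I, -, h2, h3⟩, -⟩ := h
  exact h2 (h3 N j hj)

/-- After multiplication by p^N, both sides agree modulo p^{N+M} with images of Witt vectors, where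
F^N is exactly additive; p^N is then cancelled. The same scheme gives the other identities for
`fbar`. -/
lemma fbar_add (ht : ∀ u : Acris C p, p * u = 0 → u = 0) (x y : BarM C p) :
    fbar (x + y) = fbar x + fbar y := by
  refine eq_of_forall_pow_dvd_sub (p := p) fun M => ?_
  have h := BarM.spec_add (nilLim_trunc x) (nilLim_trunc y)
  obtain ⟨N, h1, h2, h3⟩ := ((eventually_pow_dvd_fbar_sub ht h.coeff_eq_zero h.2 M).and
    ((eventually_fbar_trunc ht x M).and (eventually_fbar_trunc ht y M))).exists
  refine pow_dvd_of_pow_add_dvd ht (N := N) ?_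
  rw [iterate_map_add, map_add] at h1
  convert dvd_sub h1 (dvd_add h2 h3) using 1
  ring

lemma fbar_smul (ht : ∀ u : Acris C p, p * u = 0 → u = 0) (a : WittVector p (Perfection C p))
    (x : BarM C p) : fbar (a • x) = a • fbar x := by
  refine eq_of_forall_pow_dvd_sub (p := p) fun M => ?_
  have h := BarM.spec_smul a (nilLim_trunc x)
  obtain ⟨N, h1, h2⟩ := ((eventually_pow_dvd_fbar_sub ht h.coeff_eq_zero h.2 M).and
    (eventually_fbar_trunc ht x M)).exists
  refine pow_dvd_of_pow_add_dvd ht (N := N) ?_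
  -- The twist in the action on V^{-N}W(C^♭) is undone here: F^N(F^{-N}a) = a.
  rw [iterate_map_mul, map_mul, iterate_frobenius_frobInv] at h1
  rw [Algebra.smul_def]
  convert dvd_sub h1 (h2.mul_left (algebraMap _ _ a)) using 1
  ring

lemma trunc_frob (x : BarM C p) (N : ℕ) :
    trunc (BarM.frob x).1 N = WittVector.frobenius (trunc x.1 N) := by
  ext1 i
  rw [coeff_frobenius_charP]
  rfl

lemma dvd_frob {k : ℕ} {u : Acris C p} (h : (p : Acris C p) ^ k ∣ u) :
    (p : Acris C p) ^ k ∣ Acris.frob u := by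
  have := map_dvd Acris.frob h
  rwa [map_pow, map_natCast] at this

lemma fbar_frob (ht : ∀ u : Acris C p, p * u = 0 → u = 0) (x : BarM C p) :
    fbar (BarM.frob x) = Acris.frob (fbar x) := by
  refine eq_of_forall_pow_dvd_sub (p := p) fun M => ?_
  obtain ⟨N, h1, h2⟩ := ((eventually_fbar_trunc ht (BarM.frob x) M).and
    (eventually_fbar_trunc ht x M)).exists
  refine pow_dvd_of_pow_add_dvd ht (N := N) ?_
  have h3 := dvd_frob h2
  rw [map_sub, map_mul, map_pow, map_natCast, Acris.frob_algebraMap_witt,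
    ← Function.iterate_succ_apply' WittVector.frobenius] at h3
  rw [trunc_frob, ← Function.iterate_succ_apply] at h1
  convert dvd_sub h1 h3 using 1
  ring

/-- The operator `V` on `M̄(C)`. -/
def BarM.ver (x : BarM C p) : BarM C p :=
  ⟨fun m => x.1 (m - 1), fun m hm => x.2.1 _ (by omega), x.2.2.mono (Ideal.span_mono (by
    rintro _ ⟨m, hm, rfl⟩
    rw [Set.mem_Iio] at hm
    exact ⟨m - 1, by rw [Set.mem_Iio]; omega, rfl⟩))⟩

lemma trunc_ver (x : BarM C p) (N : ℕ) : trunc (BarM.ver x).1 N = trunc x.1 (N + 1) := by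
  ext1 i
  simp only [trunc, BarM.ver, coeff_mk]
  push_cast
  ring_nf

/-- This is FV = p transported to A_cris(C). Its iterates show that f̄ takes values in A'_cris(C),
and they drive the injectivity argument. -/
lemma p_mul_fbar (ht : ∀ u : Acris C p, p * u = 0 → u = 0) (x : BarM C p) :
    p * fbar x = Acris.frob (fbar (BarM.ver x)) := by
  refine eq_of_forall_pow_dvd_sub (p := p) fun M => ?_
  -- The truncation of x is taken at N + 1 and that of Vx at N, since the two are then the same Witt
  -- vector.
  obtain ⟨N, h1, h2⟩ := (((tendsto_add_atTop_nat 1).eventually (eventually_fbar_trunc ht x M)).and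
    (eventually_fbar_trunc ht (BarM.ver x) M)).exists
  refine pow_dvd_of_pow_add_dvd ht (N := N) ?_
  have h3 := dvd_frob h2
  rw [map_sub, map_mul, map_pow, map_natCast, Acris.frob_algebraMap_witt,
    ← Function.iterate_succ_apply' WittVector.frobenius, trunc_ver] at h3
  convert dvd_sub ((pow_dvd_pow _ (by omega : N + M ≤ N + 1 + M)).trans h1) h3 using 1
  ring

lemma pow_mul_fbar (ht : ∀ u : Acris C p, p * u = 0 → u = 0) (m : ℕ) (x : BarM C p) :
    (p : Acris C p) ^ m * fbar x = Acris.frob^[m] (fbar (BarM.ver^[m] x)) := by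
  induction m generalizing x with
  | zero => simp
  | succ m ih =>
    rw [pow_succ, mul_assoc, p_mul_fbar ht, Function.iterate_succ_apply', ← map_natCast Acris.frob,
      ← map_pow, ← map_mul, ih, Function.iterate_succ_apply]

lemma fbar_mem_prime (ht : ∀ u : Acris C p, p * u = 0 → u = 0) (x : BarM C p) :
    fbar x ∈ Acris.prime C p := fun m => ⟨_, pow_mul_fbar ht m x⟩

end fbar

end general

end Fontaine

namespace Fontaine
open WittVector

/-! ### Exponents in ℤ_+[1/p]^n: integral and fractional parts, degree -/

noncomputable section exponents

variable {p : ℕ} [hp : Fact p.Prime]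

lemma PExp.ext {a b : PExp p} (h : (a : ℚ≥0) = b) : a = b := Subtype.ext h

lemma natCast_p_pow_ne_zero (k : ℕ) : (p : ℚ≥0) ^ k ≠ 0 :=
  pow_ne_zero _ (Nat.cast_ne_zero.mpr hp.out.ne_zero)

/-- Division by `p ^ k` on `ℤ_+[1/p]`. -/
def PExp.div (k : ℕ) : PExp p →+ PExp p where
  toFun a := ⟨a / p ^ k, by
    obtain ⟨j, m, h⟩ := a.2
    refine ⟨k + j, m, ?_⟩
    rw [pow_add, ← mul_assoc, div_mul_cancel₀ _ (natCast_p_pow_ne_zero k), h]⟩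
  map_zero' := PExp.ext (zero_div _)
  map_add' a b := PExp.ext (add_div _ _ _)

lemma PExp.coe_nsmul (k : ℕ) (a : PExp p) : ((k • a : PExp p) : ℚ≥0) = k * a := by
  rw [AddSubmonoidClass.coe_nsmul, nsmul_eq_mul]

lemma PExp.coe_add (a b : PExp p) : ((a + b : PExp p) : ℚ≥0) = a + b := rfl

/-- The integral part. -/
def PExp.floor (a : PExp p) : ℕ := ⌊(a : ℚ≥0)⌋₊

/-- The fractional part. -/
def PExp.fract (a : PExp p) : PExp p :=
  ⟨a - ⌊(a : ℚ≥0)⌋₊, by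
    obtain ⟨j, m, h⟩ := a.2
    obtain ⟨c, hc⟩ := exists_add_of_le (Nat.floor_le (zero_le (a := (a : ℚ≥0))))
    generalize ⌊(a : ℚ≥0)⌋₊ = f at hc ⊢
    rw [hc, add_tsub_cancel_left]
    rw [hc] at h
    refine ⟨j, m - f * p ^ j, ?_⟩
    have h1 : f * p ^ j ≤ m := by
      rw [← Nat.cast_le (α := ℚ≥0), ← h, add_mul]
      push_cast
      exact le_self_add
    rw [Nat.cast_tsub, ← h]
    push_cast
    rw [add_mul, add_tsub_cancel_left]⟩

lemma PExp.floor_add_fract (a : PExp p) : PExp.floor a • PExp.one p + PExp.fract a = a := by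
  refine PExp.ext ?_
  rw [PExp.coe_add, PExp.coe_nsmul]
  change (⌊(a : ℚ≥0)⌋₊ : ℚ≥0) * 1 + ((a : ℚ≥0) - ⌊(a : ℚ≥0)⌋₊) = a
  rw [mul_one, add_tsub_cancel_of_le (Nat.floor_le zero_le)]

lemma PExp.floor_add_nsmul (a : PExp p) (k : ℕ) :
    PExp.floor (a + k • PExp.one p) = PExp.floor a + k := by
  rw [PExp.floor, PExp.coe_add, PExp.coe_nsmul]
  change ⌊(a : ℚ≥0) + k * 1⌋₊ = _
  rw [mul_one, Nat.floor_add_natCast zero_le]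
  rfl

lemma PExp.fract_add_nsmul (a : PExp p) (k : ℕ) :
    PExp.fract (a + k • PExp.one p) = PExp.fract a := by
  have h := PExp.floor_add_fract (a + k • PExp.one p)
  rw [PExp.floor_add_nsmul] at h
  conv_rhs at h => rw [← PExp.floor_add_fract a]
  rw [add_nsmul, add_right_comm _ (k • PExp.one p), add_right_comm _ _ (k • PExp.one p)] at h
  refine PExp.ext ?_
  have h' := congrArg (Subtype.val (p := fun q => q ∈ PExp p)) h
  simp only [PExp.coe_add] at h'
  rw [add_right_comm] at h'
  exact add_left_cancel (add_right_cancel h')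

/-- The monoid of exponents `ℤ_+[1/p]^n`. -/
abbrev Expo (p n : ℕ) : Type := Fin n → PExp p

namespace Expo

variable {n : ℕ}

/-- Division by `p ^ k` on exponents. -/
def div (k : ℕ) : Expo p n →+ Expo p n where
  toFun α i := PExp.div k (α i)
  map_zero' := funext fun _ => map_zero _
  map_add' _ _ := funext fun _ => map_add _ _ _

lemma coe_div (k : ℕ) (α : Expo p n) (i : Fin n) : (div k α i : ℚ≥0) = α i / p ^ k := rfl

lemma ext {α β : Expo p n} (h : ∀ i, (α i : ℚ≥0) = β i) : α = β :=
  funext fun i => PExp.ext (h i)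

lemma nsmul_div (k : ℕ) (α : Expo p n) : p ^ k • div k α = α := ext fun i => by
  rw [Pi.smul_apply, PExp.coe_nsmul, coe_div, Nat.cast_pow,
    mul_div_cancel₀ _ (natCast_p_pow_ne_zero k)]

lemma div_nsmul (k : ℕ) (α : Expo p n) : div k (p ^ k • α) = α := ext fun i => by
  rw [coe_div, Pi.smul_apply, PExp.coe_nsmul, Nat.cast_pow,
    mul_div_cancel_left₀ _ (natCast_p_pow_ne_zero k)]

lemma div_zero' (α : Expo p n) : div 0 α = α := ext fun i => by
  rw [coe_div, pow_zero, div_one]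

lemma div_div (k l : ℕ) (α : Expo p n) : div k (div l α) = div (l + k) α := ext fun i => by
  rw [coe_div, coe_div, coe_div, _root_.div_div, pow_add]

lemma nsmul_div_succ (k : ℕ) (α : Expo p n) : p • div (k + 1) α = div k α := by
  refine ext fun i => ?_
  rw [Pi.smul_apply, PExp.coe_nsmul, coe_div, coe_div, pow_succ', ← mul_div_assoc]
  exact mul_div_mul_left _ _ (Nat.cast_ne_zero.mpr hp.out.ne_zero)

/-- The exponent of the monomial `∏ x_i ^ {k_i}`. -/
def ofNat (k : Fin n → ℕ) : Expo p n := fun i => k i • PExp.one p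

/-- The integral part. -/
def floor (α : Expo p n) : Fin n → ℕ := fun i => PExp.floor (α i)

/-- The fractional part. -/
def fract (α : Expo p n) : Expo p n := fun i => PExp.fract (α i)

lemma floor_add_fract (α : Expo p n) : ofNat α.floor + α.fract = α :=
  funext fun i => PExp.floor_add_fract (α i)

lemma floor_add_ofNat (α : Expo p n) (k : Fin n → ℕ) : (α + ofNat k).floor = α.floor + k :=
  funext fun i => PExp.floor_add_nsmul (α i) (k i)

lemma fract_add_ofNat (α : Expo p n) (k : Fin n → ℕ) : (α + ofNat k).fract = α.fract :=
  funext fun i => PExp.fract_add_nsmul (α i) (k i)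

lemma ofNat_add (k l : Fin n → ℕ) : (ofNat (k + l) : Expo p n) = ofNat k + ofNat l :=
  funext fun i => add_nsmul _ (k i) (l i)

lemma ofNat_eq_sum (k : Fin n → ℕ) :
    (ofNat k : Expo p n) = ∑ i, k i • (Pi.single i (PExp.one p) : Expo p n) := by
  funext j
  simp only [Finset.sum_apply, Pi.smul_apply]
  rw [Finset.sum_eq_single j]
  · simp [ofNat]
  · intro i _ hij; rw [Pi.single_eq_of_ne hij.symm, smul_zero]
  · simp

/-- The total degree. -/
def deg : Expo p n →+ ℚ≥0 where
  toFun α := ∑ i, (α i : ℚ≥0)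
  map_zero' := by simp
  map_add' α β := by rw [← Finset.sum_add_distrib]; rfl

lemma deg_div (k : ℕ) (α : Expo p n) : deg (div k α) = deg α / p ^ k := by
  change ∑ i, (α i : ℚ≥0) / p ^ k = (∑ i, (α i : ℚ≥0)) / p ^ k
  rw [Finset.sum_div]

lemma coe_le_deg (α : Expo p n) (i : Fin n) : (α i : ℚ≥0) ≤ deg α :=
  Finset.single_le_sum (f := fun i => (α i : ℚ≥0)) (fun _ _ => zero_le) (Finset.mem_univ i)

lemma exists_le_coe_of_le_deg {α : Expo p n} {c : ℚ≥0} (hc : n * c < deg α) :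
    ∃ i, c ≤ (α i : ℚ≥0) := by
  by_contra! h
  have : deg α ≤ ∑ _i : Fin n, c := Finset.sum_le_sum fun i _ => (h i).le
  rw [Finset.sum_const, Finset.card_univ, Fintype.card_fin, nsmul_eq_mul] at this
  exact absurd hc this.not_gt

lemma exists_add_single {α : Expo p n} {i : Fin n} (h : 1 ≤ (α i : ℚ≥0)) :
    ∃ β : Expo p n, α = β + Pi.single i (PExp.one p) := by
  have h1 : 1 ≤ α.floor i := by
    change 1 ≤ ⌊(α i : ℚ≥0)⌋₊
    exact (Nat.one_le_floor_iff _).mpr h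
  refine ⟨α.fract + ofNat (α.floor - Pi.single i 1), ?_⟩
  have h2 : (Pi.single i (PExp.one p) : Expo p n) = ofNat (Pi.single i 1) := by
    funext j
    rcases eq_or_ne j i with rfl | hj
    · simp [ofNat]
    · simp [ofNat, hj]
  rw [h2, add_assoc, ← ofNat_add]
  conv_lhs => rw [← floor_add_fract α, add_comm]
  congr 2
  funext j
  rcases eq_or_ne j i with rfl | hj
  · simp only [Pi.add_apply, Pi.sub_apply, Pi.single_eq_same]; omega
  · simp [hj]

end Expo

end exponents

/-! ### The tilt C^♭ and the kernel of W(C^♭) → C -/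

noncomputable section tilt

variable {B : Type*} [CommRing B] {p : ℕ} [hp : Fact p.Prime] [CharP B p] [PerfectRing B p]
  {n : ℕ}

variable (B p n) in
/-- The ring `C = B[x_1^{p^{-∞}}, …, x_n^{p^{-∞}}] / (x_1, …, x_n)`, with a sealed ring structure. -/
def KeyQuot : Type _ := KeyRing B p n

instance : CommRing (KeyQuot B p n) := inferInstanceAs (CommRing (KeyRing B p n))

instance : CharP (KeyQuot B p n) p := inferInstanceAs (CharP (KeyRing B p n) p)

variable (B p n) in
/-- The projection to `C`. -/
def keyMk : PerfPoly B p n →+* KeyQuot B p n :=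
  Ideal.Quotient.mk (Ideal.span (Set.range (PerfPoly.X B p n)))

lemma keyMk_surjective : Function.Surjective (keyMk B p n) := Ideal.Quotient.mk_surjective

lemma keyMk_eq_zero_iff {y : PerfPoly B p n} :
    keyMk B p n y = 0 ↔ y ∈ Ideal.span (Set.range (PerfPoly.X B p n)) :=
  Ideal.Quotient.eq_zero_iff_mem

variable (B p n) in
/-- The tilt `C^♭` of `C = B[x_1^{p^{-∞}}, …, x_n^{p^{-∞}}] / (x_1, …, x_n)`. -/
abbrev KeyTilt : Type _ := Perfection (KeyQuot B p n) p

/-- The `p ^ k`-th root. -/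
def rootB (k : ℕ) : B →+* B := ((frobeniusEquiv B p).symm : B →+* B) ^ k

lemma rootB_zero (b : B) : rootB (p := p) 0 b = b := rfl

lemma rootB_succ_pow (k : ℕ) (b : B) : rootB (p := p) (k + 1) b ^ p = rootB (p := p) k b := by
  rw [rootB, pow_succ', RingHom.mul_def, RingHom.comp_apply]
  exact frobeniusEquiv_symm_pow_p _ _ _

lemma rootB_pow (k : ℕ) (b : B) : rootB (p := p) k b ^ p ^ k = b := by
  induction k with
  | zero => rw [pow_zero, pow_one, rootB_zero]
  | succ k ih => rw [pow_succ', pow_mul, rootB_succ_pow, ih]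

/-- The element `b x^α` of `C^♭`. -/
def mono (b : B) (α : Expo p n) : KeyTilt B p n :=
  ⟨fun k => keyMk B p n (AddMonoidAlgebra.single (Expo.div k α) (rootB (p := p) k b)),
    fun k => by
      rw [← map_pow, AddMonoidAlgebra.single_pow, Expo.nsmul_div_succ, rootB_succ_pow]⟩

lemma coeff_mono (k : ℕ) (b : B) (α : Expo p n) :
    Perfection.coeff _ p k (mono b α) =
      keyMk B p n (AddMonoidAlgebra.single (Expo.div k α) (rootB (p := p) k b)) := rfl

lemma mono_add_left (b b' : B) (α : Expo p n) : mono (b + b') α = mono b α + mono b' α :=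
  Perfection.ext fun k => by
    rw [map_add, coeff_mono, coeff_mono, coeff_mono, ← map_add, ← AddMonoidAlgebra.single_add,
      map_add]

lemma mono_zero_left (α : Expo p n) : mono (0 : B) α = 0 :=
  Perfection.ext fun k => by
    rw [coeff_mono, map_zero, AddMonoidAlgebra.single_zero, map_zero, map_zero]

lemma mono_mul (b b' : B) (α α' : Expo p n) : mono b α * mono b' α' = mono (b * b') (α + α') :=
  Perfection.ext fun k => by
    rw [map_mul, coeff_mono, coeff_mono, coeff_mono, ← map_mul, AddMonoidAlgebra.single_mul_single,
      map_add, map_mul]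

lemma mono_one : mono (1 : B) (0 : Expo p n) = 1 := Perfection.ext fun k => by
  rw [coeff_mono, map_zero, map_one, map_one]; rfl

lemma mono_pow (b : B) (α : Expo p n) (m : ℕ) : mono b α ^ m = mono (b ^ m) (m • α) := by
  induction m with
  | zero => rw [pow_zero, pow_zero, zero_nsmul, mono_one]
  | succ m ih => rw [pow_succ, ih, mono_mul, pow_succ, succ_nsmul]

variable (B p n) in
/-- The embedding of the constants in `C^♭`. -/
def constHom : B →+* KeyTilt B p n where
  toFun b := mono b 0
  map_one' := mono_one
  map_mul' b b' := by rw [mono_mul, add_zero]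
  map_zero' := mono_zero_left 0
  map_add' b b' := mono_add_left b b' 0

variable (B p n) in
/-- The homomorphism `B[x_1^{p^{-∞}}, …, x_n^{p^{-∞}}] → C^♭`. -/
def polyHom : PerfPoly B p n →+* KeyTilt B p n :=
  AddMonoidAlgebra.liftNCRingHom (constHom B p n)
    { toFun := fun α => mono 1 α.toAdd
      map_one' := mono_one
      map_mul' := fun α β => by rw [mono_mul, one_mul, toAdd_mul] } fun _ _ => by
      unfold Commute SemiconjBy; exact mul_comm (constHom B p n _) _

lemma polyHom_single (α : Expo p n) (b : B) :
    polyHom B p n (AddMonoidAlgebra.single α b) = mono b α := by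
  rw [polyHom, AddMonoidAlgebra.liftNCRingHom_single]
  change mono b 0 * mono 1 α = _
  rw [mono_mul, mul_one, zero_add]

lemma polyHom_eq_sum (y : PerfPoly B p n) :
    polyHom B p n y = ∑ α ∈ y.coeff.support, mono (y.coeff α) α := by
  conv_lhs => rw [← AddMonoidAlgebra.sum_coeff_single y, Finsupp.sum, map_sum]
  exact Finset.sum_congr rfl fun α _ => polyHom_single _ _

lemma coeff_zero_polyHom (y : PerfPoly B p n) :
    Perfection.coeff _ p 0 (polyHom B p n y) = keyMk B p n y := by
  induction y using AddMonoidAlgebra.induction_linear with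
  | zero => rw [map_zero, map_zero, map_zero]
  | add x y hx hy => rw [map_add, map_add, map_add, hx, hy]
  | single α b => rw [polyHom_single, coeff_mono, Expo.div_zero', rootB_zero]

/-- Density of polynomials in C^♭. A lift y of ν_k(r) must be raised to the power p^k, because
ν_k(y^{p^k}) = ν_0(y). -/
lemma exists_coeff_polyHom_eq (k : ℕ) (r : KeyTilt B p n) :
    ∃ y, Perfection.coeff _ p k (polyHom B p n (y ^ p ^ k)) = Perfection.coeff _ p k r := by
  obtain ⟨y, hy⟩ := keyMk_surjective (Perfection.coeff _ p k r)
  exact ⟨y, by rw [map_pow, coeff_pow_p_pow, coeff_zero_polyHom, hy]⟩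

variable (B p n) in
/-- The element `x_i` of `C^♭`. -/
def tiltX (i : Fin n) : KeyTilt B p n := mono 1 (Pi.single i (PExp.one p))

lemma coeff_zero_tiltX (i : Fin n) : Perfection.coeff _ p 0 (tiltX B p n i) = 0 := by
  rw [tiltX, coeff_mono, Expo.div_zero', rootB_zero, keyMk_eq_zero_iff]
  exact Ideal.subset_span ⟨i, rfl⟩

/-- The component of index k involves x^{α/p^k}, which is divisible by x_i as soon as α_i ≥ p^k. -/
lemma coeff_mono_eq_zero {k : ℕ} {α : Expo p n} {i : Fin n} (h : (p : ℚ≥0) ^ k ≤ α i) (b : B) :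
    Perfection.coeff _ p k (mono b α) = 0 := by
  obtain ⟨β, hβ⟩ := Expo.exists_add_single (α := Expo.div k α) (i := i) (by
    rw [Expo.coe_div, one_le_div (pow_pos (Nat.cast_pos.mpr hp.out.pos) _)]; exact h)
  have h1 : (AddMonoidAlgebra.single (Pi.single i (PExp.one p) : Expo p n) (1 : B)) ∈
      Ideal.span (Set.range (PerfPoly.X B p n)) := Ideal.subset_span ⟨i, rfl⟩
  rw [coeff_mono, hβ, ← mul_one (rootB k b), ← AddMonoidAlgebra.single_mul_single, map_mul,
    keyMk_eq_zero_iff.mpr h1, mul_zero]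

lemma polyHom_mem_span {y : PerfPoly B p n}
    (hy : y ∈ Ideal.span (Set.range (PerfPoly.X B p n))) :
    polyHom B p n y ∈ Ideal.span (Set.range (tiltX B p n)) := by
  have := Ideal.mem_map_of_mem (polyHom B p n) hy
  rw [Ideal.map_span, ← Set.range_comp] at this
  convert this using 3
  funext i
  exact (polyHom_single _ _).symm

/-- Sums of series whose terms tend to `0` in the standard way. -/
lemma Perfection.exists_sum {C : Type*} [CommRing C] [CharP C p] (t : ℕ → Perfection C p)
    (ht : ∀ j k, j < k → Perfection.coeff C p j (t k) = 0) :
    ∃ s : Perfection C p, ∀ j m, j < m → Perfection.coeff C p j s =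
      Perfection.coeff C p j (∑ k ∈ Finset.range m, t k) := by
  have h : ∀ j m, j < m → Perfection.coeff C p j (∑ k ∈ Finset.range m, t k) =
      Perfection.coeff C p j (∑ k ∈ Finset.range (j + 1), t k) := by
    intro j m hm
    induction m, Nat.succ_le_of_lt hm using Nat.le_induction with
    | base => rfl
    | succ m hm' ih =>
      rw [Finset.sum_range_succ, map_add, ih (Nat.lt_of_succ_le hm'), ht j m (by omega), add_zero]
  refine ⟨⟨fun j => Perfection.coeff C p j (∑ k ∈ Finset.range (j + 1), t k), fun j => ?_⟩,
    fun j m hm => (h j m hm).symm⟩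
  rw [Perfection.coeff_pow_p', h j _ (by omega)]

lemma coeff_zero_eq_zero_of_coeff {C : Type*} [CommRing C] [CharP C p] {k : ℕ} {r : Perfection C p}
    (h : Perfection.coeff C p k r = 0) : Perfection.coeff C p 0 r = 0 := by
  rw [← coeff_pow_p_pow k, map_pow, h, zero_pow (pow_pos hp.out.pos _).ne']

/-- Approximate r by y^p at ν_1. The polynomial y^p dies in C, hence lies in the ideal of the x_i,
while the error lies in Ker ν_1, which consists of p-th powers of elements of Ker ν_0. -/
lemma exists_eq_sum_add_pow (r : KeyTilt B p n) (hr : Perfection.coeff _ p 0 r = 0) :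
    ∃ (a : Fin n → KeyTilt B p n) (s : KeyTilt B p n), Perfection.coeff _ p 0 s = 0 ∧
      r = ∑ i, tiltX B p n i * a i + s ^ p := by
  obtain ⟨y, hy⟩ := exists_coeff_polyHom_eq 1 r
  rw [pow_one] at hy
  have h1 : Perfection.coeff _ p 1 (r - polyHom B p n (y ^ p)) = 0 := by
    rw [map_sub, hy, sub_self]
  have h2 := coeff_zero_eq_zero_of_coeff h1
  rw [map_sub, hr, zero_sub, neg_eq_zero, coeff_zero_polyHom, keyMk_eq_zero_iff] at h2
  obtain ⟨a, ha⟩ := Submodule.mem_span_range_iff_exists_fun _ |>.mp (polyHom_mem_span h2)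
  have hs : Perfection.pthRoot _ p (r - polyHom B p n (y ^ p)) ^ p = r - polyHom B p n (y ^ p) :=
    congrArg (fun f => f (r - polyHom B p n (y ^ p)))
      (Perfection.frobenius_pthRoot (R := KeyQuot B p n) (p := p))
  refine ⟨a, Perfection.pthRoot _ p (r - polyHom B p n (y ^ p)), ?_, ?_⟩
  · rw [← h1, ← hs, Perfection.coeff_pow_p, hs]
  · rw [hs, ← add_sub_assoc, eq_sub_iff_add_eq, ← ha, add_comm r]
    congr 1
    exact Finset.sum_congr rfl fun i _ => mul_comm (a i) _

/-- Iterating r = ∑ x_i a_i + s^p expresses r as a series in x_i^{p^k} a_{k,i}^{p^k}. Dividing by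
x_i leaves convergent series, so Ker ν_0 is generated by the x_i without taking a closure. -/
lemma mem_span_tiltX_of_coeff_eq_zero {r : KeyTilt B p n} (hr : Perfection.coeff _ p 0 r = 0) :
    r ∈ Ideal.span (Set.range (tiltX B p n)) := by
  choose! a s hs h using exists_eq_sum_add_pow (B := B) (p := p) (n := n)
  let r' : ℕ → KeyTilt B p n := fun k => s^[k] r
  have hr' : ∀ k, Perfection.coeff _ p 0 (r' k) = 0 := by
    intro k
    induction k with
    | zero => exact hr
    | succ k ih => rw [show r' (k + 1) = s (r' k) from Function.iterate_succ_apply' _ _ _]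
                   exact hs _ ih
  -- For j < k the exponent p^k - 1 is at least p^j, and x_i^{p^j} is in Ker ν_j.
  have hX : ∀ j k i, j < k → Perfection.coeff _ p j
      (tiltX B p n i ^ (p ^ k - 1) * a (r' k) i ^ p ^ k) = 0 := by
    intro j k i hjk
    have h1 : p ^ j ≤ p ^ k - 1 := by
      have := Nat.pow_lt_pow_right hp.out.one_lt hjk
      omega
    rw [← Nat.add_sub_cancel' h1, pow_add, mul_assoc, map_mul, coeff_pow_p_pow, coeff_zero_tiltX,
      zero_mul]
  choose b hb using fun i => Perfection.exists_sum (p := p)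
    (fun k => tiltX B p n i ^ (p ^ k - 1) * a (r' k) i ^ p ^ k) fun j k hjk => hX j k i hjk
  -- The power p^m is additive in characteristic p, so the relation for the m-th remainder can be
  -- substituted under it.
  have key : ∀ m, r = ∑ k ∈ Finset.range m, ∑ i, tiltX B p n i *
      (tiltX B p n i ^ (p ^ k - 1) * a (r' k) i ^ p ^ k) + r' m ^ p ^ m := by
    intro m
    induction m with
    | zero => simp [r']
    | succ m ih =>
      rw [Finset.sum_range_succ, add_assoc]
      conv_lhs => rw [ih, h (r' m) (hr' m), add_pow_char_pow, sum_pow_char_pow, ← pow_mul,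
        ← pow_succ', show s (r' m) = r' (m + 1) from (Function.iterate_succ_apply' _ _ _).symm]
      congr 2
      refine Finset.sum_congr rfl fun i _ => ?_
      rw [mul_pow, ← mul_assoc, mul_pow_sub_one (pow_pos hp.out.pos _).ne']
  have : r = ∑ i, b i * tiltX B p n i := Perfection.ext fun j => by
    conv_lhs => rw [key (j + 1), Finset.sum_comm, map_add]
    rw [pow_succ', pow_mul, coeff_pow_p_pow, map_pow, hr', zero_pow hp.out.ne_zero,
      add_zero, map_sum, map_sum]
    refine Finset.sum_congr rfl fun i _ => ?_
    rw [← Finset.mul_sum, map_mul, map_mul, hb i j (j + 1) (by omega), mul_comm]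
  rw [this]
  exact Ideal.sum_mem _ fun i _ => Ideal.mul_mem_left _ _ (Ideal.subset_span ⟨i, rfl⟩)

/-- The ideal is finitely generated and x_i^{p^k} is in Ker ν_k. This is where finiteness of the
number of variables is used for convergence in M̄(C). -/
lemma topNilpotent_span_tiltX : TopNilpotent (Ideal.span (Set.range (tiltX B p n))) := by
  intro k
  refine Ideal.exists_pow_le_of_le_radical_of_fg (Ideal.span_le.mpr ?_)
    ⟨(Set.finite_range (tiltX B p n)).toFinset, by simp⟩
  rintro _ ⟨i, rfl⟩
  exact ⟨p ^ k, by rw [RingHom.mem_ker, coeff_pow_p_pow, coeff_zero_tiltX]⟩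

variable (B p n) in
/-- The Teichmüller lift `[x_i]`, as an element of the kernel of `W(C^♭) → C`. -/
def teichX (i : Fin n) : thetaKer (KeyQuot B p n) p :=
  ⟨teichmuller p (tiltX B p n i), teichmuller_mem_thetaKer _ (coeff_zero_tiltX i)⟩

lemma p_mem_thetaKer {C : Type*} [CommRing C] [CharP C p] :
    (p : WittVector p (Perfection C p)) ∈ thetaKer C p := by
  rw [thetaKer, RingHom.mem_ker, map_natCast, CharP.cast_eq_zero]

lemma p_dvd_of_coeff_zero {R : Type*} [CommRing R] [CharP R p] [PerfectRing R p]
    {w : WittVector p R} (h : w.coeff 0 = 0) : (p : WittVector p R) ∣ w := by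
  rw [← Ideal.mem_span_singleton]
  exact (mem_span_p_iff_coeff_zero_eq_zero w).mpr h

/-- The 0-th coordinate of w is a combination of the x_i; subtracting the corresponding combination
of the [x_i] leaves a Witt vector with 0-th coordinate 0, a multiple of p because C^♭ is perfect. -/
lemma exists_eq_sum_teichX (w : thetaKer (KeyQuot B p n) p) :
    ∃ (a : Fin n → WittVector p (KeyTilt B p n)) (c : WittVector p (KeyTilt B p n)),
      w = ∑ i, a i • teichX B p n i + c • ⟨(p : WittVector p (KeyTilt B p n)), p_mem_thetaKer⟩ := by
  have hw : Perfection.coeff _ p 0 ((w : WittVector p (KeyTilt B p n)).coeff 0) = 0 := w.2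
  obtain ⟨a, ha⟩ := Submodule.mem_span_range_iff_exists_fun _ |>.mp
    (mem_span_tiltX_of_coeff_eq_zero hw)
  obtain ⟨c, hc⟩ := p_dvd_of_coeff_zero (p := p) (w := (w : WittVector p (KeyTilt B p n)) -
    ∑ i, teichmuller p (a i) * teichmuller p (tiltX B p n i)) (by
      have h := add_coeff_zero' ((w : WittVector p (KeyTilt B p n)) -
        ∑ i, teichmuller p (a i) * teichmuller p (tiltX B p n i))
        (∑ i, teichmuller p (a i) * teichmuller p (tiltX B p n i))
      rw [sub_add_cancel, ← ha] at h
      have h' : (∑ i, teichmuller p (a i) * teichmuller p (tiltX B p n i)).coeff 0 =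
          ∑ i, a i • tiltX B p n i := by
        change constantCoeff _ = _
        rw [map_sum]
        refine Finset.sum_congr rfl fun i _ => ?_
        rw [map_mul]
        change (teichmuller p (a i)).coeff 0 * (teichmuller p (tiltX B p n i)).coeff 0 = _
        rw [teichmuller_coeff_zero, teichmuller_coeff_zero]
        rfl
      rw [h'] at h
      exact right_eq_add.mp h)
  refine ⟨fun i => teichmuller p (a i), c, Subtype.ext ?_⟩
  rw [Submodule.coe_add, Submodule.coe_sum, Submodule.coe_smul]
  simp only [Submodule.coe_smul, smul_eq_mul]
  rw [mul_comm c, ← hc]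
  exact (add_sub_cancel _ _).symm

end tilt

end Fontaine

namespace Fontaine
open WittVector

/-! ### Homomorphisms out of rings of Witt vectors -/

section thetaLift
variable {p : ℕ} [hp : Fact p.Prime]

/-- Fontaine's map attached to a homomorphism `C → T / p`, for a `p`-adically complete ring `T`. -/
lemma exists_theta {C T : Type*} [CommRing C] [CharP C p] [CommRing T] [Fact ¬IsUnit (p : T)]
    [IsAdicComplete (Ideal.span {(p : T)}) T] (f : C →+* ModP T p) :
    ∃ g : WittVector p (Perfection C p) →+* T, ∀ (r : Perfection C p) (y : ℕ → T),
      (∀ k, y k ^ p ^ k = y 0) →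
      (∀ k, Ideal.Quotient.mk (Ideal.span {(p : T)}) (y k) = f (Perfection.coeff C p (k + 1) r)) →
        g (teichmuller p r) = y 0 := by
  let h : Perfection C p →+* PreTilt T p := (Perfection.map p f).comp (Perfection.pthRoot C p)
  refine ⟨(fontaineTheta T p).comp (WittVector.map h), fun r y h1 h2 => ?_⟩
  rw [RingHom.comp_apply, map_teichmuller, fontaineTheta_teichmuller]
  exact Perfection.teichmuller_spec fun k => ⟨y k, h2 k, by rw [h1 k]⟩

/-- Homomorphisms from a ring of Witt vectors to a `p`-adically separated ring are determined by
their values at Teichmüller lifts. -/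
lemma eq_of_teichmuller_eq {R T : Type*} [CommRing R] [CharP R p] [PerfectRing R p] [CommRing T]
    [IsHausdorff (Ideal.span {(p : T)}) T] (f g : WittVector p R →+* T)
    (h : ∀ r, f (teichmuller p r) = g (teichmuller p r)) : f = g := by
  ext1 w
  refine eq_of_forall_pow_dvd_sub (p := p) fun m => ?_
  have := WittVector.eq_of_apply_teichmuller_eq
    ((Ideal.Quotient.mk (Ideal.span {(p : T) ^ m})).comp f)
    ((Ideal.Quotient.mk (Ideal.span {(p : T) ^ m})).comp g)
    ⟨m, by
      rw [← map_natCast (Ideal.Quotient.mk (Ideal.span {(p : T) ^ m})), ← map_pow,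
        Ideal.Quotient.eq_zero_iff_mem]
      exact Ideal.mem_span_singleton_self _⟩
    fun r => by rw [RingHom.comp_apply, RingHom.comp_apply, h]
  have := congrArg (fun f => f w) this
  exact Ideal.mem_span_singleton.mp (Ideal.Quotient.eq.mp this)

end thetaLift

/-! ### Divided powers in torsion free rings -/

section torsionFreeDP
open scoped Nat
variable {S : Type*} [CommRing S]

/-- The elements of a torsion free ring that have divided powers. -/
def HasDP (x : S) : Prop := ∀ m : ℕ, (m ! : S) ∣ x ^ m

lemma HasDP.add {x y : S} (hx : HasDP x) (hy : HasDP y) : HasDP (x + y) := fun m => by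
  rw [add_pow]
  refine Finset.dvd_sum fun i hi => ?_
  have hi' : i ≤ m := Nat.lt_succ_iff.mp (Finset.mem_range.mp hi)
  rw [← Nat.choose_mul_factorial_mul_factorial hi', mul_comm (x ^ i * _), mul_assoc]
  push_cast
  exact mul_dvd_mul_left _ (mul_dvd_mul (hx i) (hy _))

lemma HasDP.mul_left {x : S} (a : S) (hx : HasDP x) : HasDP (a * x) := fun m => by
  rw [mul_pow]; exact (hx m).mul_left _

lemma HasDP.zero : HasDP (0 : S) := fun m => by
  cases m with
  | zero => simp
  | succ m => simp

lemma HasDP.sum {ι : Type*} {s : Finset ι} {x : ι → S} (h : ∀ i ∈ s, HasDP (x i)) :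
    HasDP (∑ i ∈ s, x i) :=
  Finset.sum_induction _ HasDP (fun _ _ => HasDP.add) HasDP.zero h

lemma HasDP.map {S' : Type*} [CommRing S'] (f : S →+* S') {x : S} (hx : HasDP x) :
    HasDP (f x) := fun m => by
  have := map_dvd f (hx m)
  rwa [map_natCast, map_pow] at this

/-- A homomorphism to a torsion free ring extends to the PD hull as soon as the images of
the elements of the ideal have divided powers. -/
lemma PDHull.exists_lift_of_hasDP {p : ℕ} {A : Type*} [CommRing A] {I : Ideal A}
    (hS : ∀ k : ℕ, k ≠ 0 → ∀ x : S, (k : S) * x = 0 → x = 0) (g : A →+* S)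
    (hg : ∀ x ∈ I, HasDP (g x)) :
    ∃ f : PDHull p I →+* S, ∀ a, f (algebraMap A _ a) = g a := by
  choose d hd using fun (m : ℕ) (x : I) => hg x x.2 m
  have inj : ∀ (k : ℕ), k ≠ 0 → ∀ x y : S, (k : S) * x = k * y → x = y := fun k hk x y h =>
    sub_eq_zero.mp (hS k hk _ (by rw [mul_sub, h, sub_self]))
  have hf := Nat.factorial_ne_zero
  obtain ⟨f, hf, -⟩ := PDHull.exists_lift (p := p) g d
    (fun x => inj _ (hf 0) _ _ (by rw [← hd]; simp))
    (fun x => inj _ (hf 1) _ _ (by rw [← hd]; simp))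
    (fun m a x => inj _ (hf m) _ _ (by
      rw [← hd, mul_left_comm, ← hd, ← mul_pow, ← map_mul]; rfl))
    (fun m k x => inj _ (mul_ne_zero (hf m) (hf k)) _ _ (by
      have h := hd (m + k) x
      rw [pow_add, hd, hd, ← Nat.add_choose_mul_factorial_mul_factorial] at h
      push_cast at h ⊢
      rw [nsmul_eq_mul, Nat.choose_symm_add]
      linear_combination h))
    (fun m x y => inj _ (hf m) _ _ (by
      rw [← hd, Submodule.coe_add, map_add, (Commute.all _ _).add_pow', Finset.mul_sum]
      refine Finset.sum_congr rfl fun k hk => ?_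
      rw [Finset.HasAntidiagonal.mem_antidiagonal] at hk
      rw [nsmul_eq_mul, hd, hd, ← hk, Nat.choose_symm_add, ← Nat.add_choose_mul_factorial_mul_factorial]
      push_cast
      ring))
    (fun x hx m a ha => inj _ (hf m) _ _ (by
      rw [← hd, hx, map_natCast, ← map_natCast g (m !), ← map_mul, ha, map_pow, map_natCast]))
  exact ⟨f, hf⟩

end torsionFreeDP

/-! ### The divided power polynomial ring and the map from the PD hull -/

noncomputable section dpPoly
open scoped Nat

namespace Expo
variable {p : ℕ} [hp : Fact p.Prime] {n : ℕ}

/-- The product of the factorials of the integral parts. -/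
def fac (α : Expo p n) : ℕ := ∏ i, (floor α i)!

lemma fac_ne_zero (α : Expo p n) : fac α ≠ 0 :=
  Finset.prod_ne_zero_iff.mpr fun _ _ => Nat.factorial_ne_zero _

lemma floor_zero : floor (0 : Expo p n) = 0 := funext fun i => by
  change ⌊((0 : PExp p) : ℚ≥0)⌋₊ = 0
  simp

lemma fac_zero : fac (0 : Expo p n) = 1 := by
  rw [fac, floor_zero]
  simp

lemma floor_add_le (α β : Expo p n) (i : Fin n) : floor α i + floor β i ≤ floor (α + β) i :=
  by
  refine Nat.le_floor ?_
  push_cast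
  exact add_le_add (Nat.floor_le zero_le) (Nat.floor_le zero_le)

/-- Integral parts are superadditive. This divisibility makes the span of the x^α/⌊α⌋! a ring. -/
lemma fac_mul_fac_dvd (α β : Expo p n) : fac α * fac β ∣ fac (α + β) := by
  rw [fac, fac, fac, ← Finset.prod_mul_distrib]
  exact Finset.prod_dvd_prod_of_dvd _ _ fun i _ => (Nat.factorial_mul_factorial_dvd_factorial_add _ _).trans
    (Nat.factorial_dvd_factorial (floor_add_le α β i))

lemma floor_ofNat (k : Fin n → ℕ) : floor (ofNat k : Expo p n) = k := by
  have := floor_add_ofNat (0 : Expo p n) k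
  rwa [zero_add, floor_zero, zero_add] at this

end Expo

variable (B : Type*) [CommRing B] (p : ℕ) [hp : Fact p.Prime] [CharP B p] [PerfectRing B p]
  (n : ℕ)

/-- The total ring of fractions of `W(B)`. -/
def WFrac : Type _ := FractionRing (WittVector p B)

instance : CommRing (WFrac B p) := inferInstanceAs (CommRing (FractionRing (WittVector p B)))

instance : Algebra (WittVector p B) (WFrac B p) :=
  inferInstanceAs (Algebra _ (FractionRing (WittVector p B)))

instance : IsFractionRing (WittVector p B) (WFrac B p) :=
  inferInstanceAs (IsFractionRing _ (FractionRing (WittVector p B)))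

variable {B p n}

/-- W(B) need not be a domain, but B being perfect, W(B) has no integer torsion, so nonzero integers
become invertible in its total ring of fractions. -/
lemma isUnit_wFrac_natCast {k : ℕ} (hk : k ≠ 0) : IsUnit (k : WFrac B p) := by
  have h : (k : WittVector p B) ∈ nonZeroDivisors (WittVector p B) :=
    mem_nonZeroDivisors_iff_right.mpr fun x hx =>
      wittVector_natCast_mul hk (by rw [mul_comm]; exact hx)
  have := IsLocalization.map_units (WFrac B p) ⟨_, h⟩
  rwa [map_natCast] at this

lemma wFrac_algebraMap_injective : Function.Injective (algebraMap (WittVector p B) (WFrac B p)) :=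
  IsFractionRing.injective _ _

variable (B p n) in
/-- The ring of polynomials in `x_i^{p^{-∞}}` and the divided powers of the `x_i`, with coefficients
in `W(B)`. -/
def DPPoly : Subring (AddMonoidAlgebra (WFrac B p) (Expo p n)) where
  carrier := {f | ∀ α, ∃ a : WittVector p B,
    (Expo.fac α : WFrac B p) * f.coeff α = algebraMap _ _ a}
  zero_mem' α := ⟨0, by simp⟩
  one_mem' α := by
    classical
    rw [AddMonoidAlgebra.one_def, AddMonoidAlgebra.coeff_single, Finsupp.single_apply]
    exact ⟨if 0 = α then Expo.fac α else 0, by split_ifs <;> simp⟩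
  add_mem' {f g} hf hg α := by
    obtain ⟨a, ha⟩ := hf α
    obtain ⟨b, hb⟩ := hg α
    exact ⟨a + b, by rw [AddMonoidAlgebra.coeff_add, Finsupp.add_apply, mul_add, ha, hb, map_add]⟩
  neg_mem' {f} hf α := by
    obtain ⟨a, ha⟩ := hf α
    exact ⟨-a, by
      rw [map_neg, ← ha, ← mul_neg]
      rfl⟩
  mul_mem' {f g} hf hg γ := by
    classical
    choose a ha using hf
    choose b hb using hg
    rw [AddMonoidAlgebra.coeff_mul, Finsupp.sum, Finset.mul_sum]
    simp only [Finsupp.sum, Finset.mul_sum]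
    refine ⟨∑ α ∈ f.coeff.support, ∑ β ∈ g.coeff.support, if α + β = γ then
      ((Expo.fac (α + β) / (Expo.fac α * Expo.fac β) : ℕ) : WittVector p B) * (a α * b β) else 0, ?_⟩
    rw [map_sum]
    refine Finset.sum_congr rfl fun α _ => ?_
    rw [map_sum]
    refine Finset.sum_congr rfl fun β _ => ?_
    split_ifs with h
    · rw [map_mul, map_mul, map_natCast, ← ha, ← hb, ← h]
      conv_lhs => rw [← Nat.div_mul_cancel (Expo.fac_mul_fac_dvd α β)]
      push_cast
      ring
    · simp

namespace DPPoly

lemma single_mem (α : Expo p n) {c : WFrac B p} {a : WittVector p B}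
    (h : (Expo.fac α : WFrac B p) * c = algebraMap _ _ a) :
    AddMonoidAlgebra.single α c ∈ DPPoly B p n := fun β => by
  classical
  rw [AddMonoidAlgebra.coeff_single, Finsupp.single_apply]
  split_ifs with hβ
  · exact ⟨a, by rw [← hβ, h]⟩
  · exact ⟨0, by simp⟩

/-- The divided monomial `x^α / ⌊α⌋!`. -/
def dpMono (α : Expo p n) : DPPoly B p n :=
  ⟨AddMonoidAlgebra.single α (Ring.inverse (Expo.fac α : WFrac B p)), single_mem α (a := 1) (by
    rw [map_one, Ring.mul_inverse_cancel _ (isUnit_wFrac_natCast (Expo.fac_ne_zero α))])⟩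

/-- The monomial `x^α`. -/
def xMono (α : Expo p n) : DPPoly B p n :=
  ⟨AddMonoidAlgebra.single α 1, single_mem α (a := Expo.fac α) (by simp)⟩

lemma xMono_add (α β : Expo p n) : xMono (B := B) (α + β) = xMono α * xMono β := by
  refine Subtype.ext ?_
  rw [Subring.coe_mul]
  simp only [xMono, AddMonoidAlgebra.single_mul_single, one_mul]

lemma xMono_zero : xMono (B := B) (0 : Expo p n) = 1 := rfl

lemma xMono_nsmul (m : ℕ) (α : Expo p n) : xMono (B := B) (m • α) = xMono α ^ m := by
  induction m with
  | zero => rw [zero_nsmul, pow_zero, xMono_zero]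
  | succ m ih => rw [succ_nsmul, xMono_add, ih, pow_succ]

lemma natCast_mul_coeff (k : ℕ) (f : DPPoly B p n) (α : Expo p n) :
    ((k * f : DPPoly B p n) : AddMonoidAlgebra (WFrac B p) (Expo p n)).coeff α =
      k * (f : AddMonoidAlgebra (WFrac B p) (Expo p n)).coeff α := by
  rw [← nsmul_eq_mul, AddSubmonoidClass.coe_nsmul, AddMonoidAlgebra.coeff_smul_apply, nsmul_eq_mul]

lemma ext_coeff {f g : DPPoly B p n} (h : ∀ α,
    (f : AddMonoidAlgebra (WFrac B p) (Expo p n)).coeff α =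
      (g : AddMonoidAlgebra (WFrac B p) (Expo p n)).coeff α) : f = g :=
  Subtype.ext (AddMonoidAlgebra.coeff_injective (Finsupp.ext h))

lemma fac_mul_dpMono (α : Expo p n) : (Expo.fac α : DPPoly B p n) * dpMono α = xMono α := by
  classical
  refine ext_coeff fun β => ?_
  rw [natCast_mul_coeff]
  simp only [xMono, dpMono, AddMonoidAlgebra.coeff_single, Finsupp.single_apply]
  split_ifs
  · exact Ring.mul_inverse_cancel _ (isUnit_wFrac_natCast (Expo.fac_ne_zero α))
  · exact mul_zero _

variable (B p n) in
/-- The embedding of the constants. -/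
def const : WittVector p B →+* DPPoly B p n where
  toFun a := ⟨AddMonoidAlgebra.single 0 (algebraMap _ _ a), single_mem 0 (a := a) (by
    rw [Expo.fac_zero, Nat.cast_one, one_mul])⟩
  map_one' := Subtype.ext (by simp only [map_one]; rfl)
  map_mul' a b := Subtype.ext (by
    rw [Subring.coe_mul]
    simp only [map_mul, AddMonoidAlgebra.single_mul_single, add_zero])
  map_zero' := Subtype.ext (by simp only [map_zero, AddMonoidAlgebra.single_zero]; rfl)
  map_add' a b := Subtype.ext (by
    rw [Subring.coe_add]
    simp only [map_add, AddMonoidAlgebra.single_add])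

lemma const_mul_dpMono_coeff (a : WittVector p B) (α β : Expo p n) [Decidable (α = β)] :
    ((const B p n a * dpMono α : DPPoly B p n) : AddMonoidAlgebra (WFrac B p) (Expo p n)).coeff β =
      if α = β then algebraMap _ _ a * Ring.inverse (Expo.fac α : WFrac B p) else 0 := by
  rw [Subring.coe_mul]
  simp only [const, dpMono, RingHom.coe_mk, MonoidHom.coe_mk, OneHom.coe_mk]
  rw [AddMonoidAlgebra.single_mul_single, zero_add, AddMonoidAlgebra.coeff_single, Finsupp.single_apply]

lemma natCast_mul {k : ℕ} (hk : k ≠ 0) {f : DPPoly B p n} (h : (k : DPPoly B p n) * f = 0) :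
    f = 0 := by
  refine ext_coeff fun α => ?_
  have h2 := natCast_mul_coeff k f α
  rw [h] at h2
  exact (isUnit_wFrac_natCast hk).mul_right_eq_zero.mp h2.symm

/-- Multiplying the coefficient of x^α by ⌊α⌋! recovers a_α on one side and lands in p^m W(B) on the
other. This is the independence of the basis in the model ring. -/
lemma pow_dvd_of_pow_dvd_sum {m : ℕ} {s : Finset (Expo p n)} {a : Expo p n → WittVector p B}
    (h : (p : DPPoly B p n) ^ m ∣ ∑ α ∈ s, const B p n (a α) * dpMono α) :
    ∀ α ∈ s, (p : WittVector p B) ^ m ∣ a α := by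
  classical
  intro α hα
  obtain ⟨t, ht⟩ := h
  obtain ⟨b, hb⟩ := t.2 α
  refine ⟨b, wFrac_algebraMap_injective ?_⟩
  have h1 := congrArg (fun f : DPPoly B p n => (Expo.fac α : WFrac B p) *
    (f : AddMonoidAlgebra (WFrac B p) (Expo p n)).coeff α) ht
  beta_reduce at h1
  rw [AddSubmonoidClass.coe_finsetSum, AddMonoidAlgebra.coeff_sum, Finsupp.finsetSum_apply] at h1
  simp only [const_mul_dpMono_coeff] at h1
  rw [Finset.sum_ite_eq' s α, if_pos hα, mul_left_comm,
    Ring.mul_inverse_cancel _ (isUnit_wFrac_natCast (Expo.fac_ne_zero α)), mul_one,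
    ← Nat.cast_pow, natCast_mul_coeff, mul_left_comm, hb] at h1
  rw [h1, map_mul, map_pow, map_natCast, Nat.cast_pow]

lemma not_isUnit : ¬ IsUnit (p : DPPoly B p n) := fun h => by
  have h1 := pow_dvd_of_pow_dvd_sum (m := 1) (s := {(0 : Expo p n)}) (a := fun _ => (1 : WittVector p B))
    (by rw [pow_one]; exact h.dvd) 0 (Finset.mem_singleton_self _)
  rw [pow_one] at h1
  have h2 := (mem_span_p_iff_coeff_zero_eq_zero _).mp (Ideal.mem_span_singleton.mpr h1)
  rw [one_coeff_zero] at h2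
  have : Nontrivial B := CharP.nontrivial_of_char_ne_one hp.out.ne_one
  exact one_ne_zero h2

end DPPoly

variable (B p n) in
/-- The ring `W(C^♭)`. -/
abbrev KeyWitt : Type _ := WittVector p (KeyTilt B p n)

variable (B p n) in
/-- The PD hull of `W(C^♭) → C`. -/
abbrev KeyHull : Type _ := PDHull p (thetaKer (KeyQuot B p n) p)

variable (B p n) in
/-- The structure map of the PD hull. -/
abbrev hullMap : KeyWitt B p n →+* KeyHull B p n := algebraMap _ _

variable (B p n) in
/-- The embedding of `W(B)` in `W(C^♭)`. -/
def constW : WittVector p B →+* KeyWitt B p n :=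
  WittVector.map (S := KeyTilt B p n) (constHom B p n)

lemma constW_teichmuller (b : B) :
    constW B p n (teichmuller p b) = teichmuller p (mono b (0 : Expo p n)) := by
  rw [constW, map_teichmuller]
  rfl

variable (B p n) in
/-- The `p`-adic completion of the divided power polynomial ring. -/
abbrev DPSeries : Type _ := AdicCompletion (Ideal.span {(p : DPPoly B p n)}) (DPPoly B p n)

namespace DPSeries

instance : IsAdicComplete (Ideal.span {(p : DPSeries B p n)}) (DPSeries B p n) :=
  isAdicComplete_adicCompletion

lemma natCast_mul {k : ℕ} (hk : k ≠ 0) {f : DPSeries B p n} (h : (k : DPSeries B p n) * f = 0) :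
    f = 0 :=
  natCast_mul_left_injective (p := p) (fun _ hx => adicCompletion_torsionFree
    (fun _ hd => DPPoly.natCast_mul hp.out.ne_zero hd) hx) hk h

instance : Fact ¬IsUnit (p : DPSeries B p n) := ⟨fun h => DPPoly.not_isUnit (by
  have h1 : (p : DPSeries B p n) ^ 1 ∣ algebraMap (DPPoly B p n) _ 1 := by
    rw [pow_one]; exact h.dvd
  have h2 := pow_dvd_of_pow_dvd_algebraMap h1
  rw [pow_one] at h2
  exact isUnit_of_dvd_one h2)⟩

/-- The canonical homomorphism to the reduction modulo `p`. -/
def toModP : DPPoly B p n →+* ModP (DPSeries B p n) p :=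
  (Ideal.Quotient.mk _).comp (algebraMap (DPPoly B p n) (DPSeries B p n))

variable (B p n) in
/-- Constants modulo `p`. -/
def constModP : B →+* ModP (DPSeries B p n) p where
  toFun b := toModP (DPPoly.const B p n (teichmuller p b))
  map_one' := by rw [map_one, map_one, map_one]
  map_mul' a b := by rw [map_mul, map_mul, map_mul]
  map_zero' := by rw [teichmuller_zero, map_zero, map_zero]
  map_add' a b := by
    obtain ⟨c, hc⟩ := p_dvd_of_coeff_zero (p := p)
      (w := teichmuller p (a + b) - (teichmuller p a + teichmuller p b)) (by
        have := add_coeff_zero' (teichmuller p (a + b) - (teichmuller p a + teichmuller p b))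
          (teichmuller p a + teichmuller p b)
        rw [sub_add_cancel, add_coeff_zero', teichmuller_coeff_zero, teichmuller_coeff_zero,
          teichmuller_coeff_zero] at this
        exact right_eq_add.mp this)
    rw [← map_add, ← map_add, ← sub_eq_zero, ← map_sub, ← map_sub, hc, map_mul, map_mul, map_natCast,
      map_natCast, CharP.cast_eq_zero (ModP (DPSeries B p n) p) p, zero_mul]

variable (B p n) in
/-- The reduction modulo `p` of polynomials in `x_i^{p^{-∞}}`. -/
def polyModP : PerfPoly B p n →+* ModP (DPSeries B p n) p :=
  AddMonoidAlgebra.liftNCRingHom (constModP B p n)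
    { toFun := fun α => toModP (DPPoly.xMono α.toAdd)
      map_one' := by rw [toAdd_one, DPPoly.xMono_zero, map_one]
      map_mul' := fun α β => by rw [toAdd_mul, DPPoly.xMono_add, map_mul] } fun _ _ => by
    unfold Commute SemiconjBy; exact mul_comm _ _

lemma polyModP_single (α : Expo p n) (b : B) : polyModP B p n (AddMonoidAlgebra.single α b) =
    toModP (DPPoly.const B p n (teichmuller p b) * DPPoly.xMono α) := by
  rw [polyModP, AddMonoidAlgebra.liftNCRingHom_single, map_mul]
  rfl

lemma xMono_single_pow (i : Fin n) (m : ℕ) :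
    (DPPoly.xMono (Pi.single i (PExp.one p)) : DPPoly B p n) ^ m =
      (m ! : DPPoly B p n) * DPPoly.dpMono (m • Pi.single i (PExp.one p)) := by
  rw [← DPPoly.xMono_nsmul, ← DPPoly.fac_mul_dpMono]
  congr 2
  have h : m • Pi.single i (PExp.one p) = (Expo.ofNat (Pi.single i m) : Expo p n) := by
    funext j
    rcases eq_or_ne j i with rfl | hj
    · simp [Expo.ofNat]
    · simp [Expo.ofNat, hj]
  rw [h, Expo.fac, Expo.floor_ofNat, Finset.prod_eq_single i]
  · rw [Pi.single_eq_same]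
  · intro j _ hj; rw [Pi.single_eq_of_ne hj, Nat.factorial_zero]
  · simp

variable (B p n) in
/-- The `p`-th power map `C → T / p`. -/
def keyModP : KeyQuot B p n →+* ModP (DPSeries B p n) p :=
  Ideal.Quotient.lift (Ideal.span (Set.range (PerfPoly.X B p n))) ((frobenius _ p).comp (polyModP B p n)) fun a ha => by
    rw [← RingHom.mem_ker]
    refine (Ideal.span_le.mpr ?_ : _ ≤ RingHom.ker ((frobenius _ p).comp (polyModP B p n))) ha
    rintro _ ⟨i, rfl⟩
    -- The variable x_i is not 0 modulo p, but x_i^p = p!·(x_i^p/p!) is; this forces the use of the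
    -- p-th power map.
    rw [SetLike.mem_coe, RingHom.mem_ker, RingHom.comp_apply, frobenius_def, PerfPoly.X,
      polyModP_single, ← map_pow, map_one, map_one, one_mul, xMono_single_pow, map_mul,
      map_natCast]
    have : ((p ! : ℕ) : ModP (DPSeries B p n) p) = 0 :=
      (CharP.cast_eq_zero_iff _ p _).mpr (Nat.dvd_factorial hp.out.pos le_rfl)
    rw [this, zero_mul]

lemma keyModP_mk (y : PerfPoly B p n) :
    keyModP B p n (keyMk B p n y) = polyModP B p n y ^ p := rfl

variable (B p n) in
-- Fontaine's map for the p-th power map C → T/p, where T is the completed model ring. The elements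
-- [b^{1/p^k}] x^{α/p^k} form a compatible system of roots in T lifting the required components.
lemma exists_wittHom : ∃ g : WittVector p (KeyTilt B p n) →+* DPSeries B p n,
    ∀ (b : B) (α : Expo p n), g (teichmuller p (mono b α)) =
      algebraMap (DPPoly B p n) _ (DPPoly.const B p n (teichmuller p b) * DPPoly.xMono α) := by
  obtain ⟨g, hg⟩ := exists_theta (keyModP B p n)
  have h : ∀ (b : B) (α : Expo p n) (j k : ℕ),
      (DPPoly.const B p n (teichmuller p (rootB (p := p) (k + j) b)) *
        DPPoly.xMono (Expo.div (k + j) α)) ^ p ^ j =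
      DPPoly.const B p n (teichmuller p (rootB (p := p) k b)) *
        DPPoly.xMono (Expo.div k α) := fun b α j k => by
    rw [mul_pow, ← map_pow, ← map_pow, ← DPPoly.xMono_nsmul, ← Expo.div_div, Expo.nsmul_div,
      rootB, pow_add, ← rootB, ← rootB, RingHom.mul_def, RingHom.comp_apply, ← map_pow, rootB_pow]
  refine ⟨g, fun b α => ?_⟩
  rw [hg (mono b α) (fun k => algebraMap _ _ (DPPoly.const B p n (teichmuller p (rootB (p := p) k b)) *
        DPPoly.xMono (Expo.div k α)))]
  · rw [rootB_zero, Expo.div_zero']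
  · intro k
    have := h b α k 0
    rw [zero_add] at this
    rw [← map_pow, this]
  · intro k
    have := h b α 1 k
    rw [pow_one] at this
    rw [coeff_mono, keyModP_mk, polyModP_single, ← map_pow, this]
    rfl

variable (B p n) in
-- As T is torsion free, it suffices that m! divides the m-th power of the image of each element of
-- the kernel. This can be checked on the generators [x_i] and p.
lemma exists_hullHom : ∃ f : KeyHull B p n →+* DPSeries B p n,
    (∀ α : Expo p n, f (hullMap B p n (teichmuller p (mono (1 : B) α))) =
      algebraMap (DPPoly B p n) _ (DPPoly.xMono α)) ∧
    ∀ a : WittVector p B, f (hullMap B p n (constW B p n a)) =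
      algebraMap (DPPoly B p n) _ (DPPoly.const B p n a) := by
  obtain ⟨g, hg⟩ := exists_wittHom B p n
  obtain ⟨f, hf⟩ := PDHull.exists_lift_of_hasDP (p := p) (I := thetaKer (KeyQuot B p n) p)
    (fun k hk x hx => natCast_mul hk hx) g fun x hx => by
      obtain ⟨a, c, h⟩ := exists_eq_sum_teichX ⟨x, hx⟩
      have h' := congrArg Subtype.val h
      rw [Submodule.coe_add, Submodule.coe_sum, Submodule.coe_smul] at h'
      simp only [Submodule.coe_smul, smul_eq_mul] at h'
      rw [h', map_add, map_sum]
      refine HasDP.add (HasDP.sum fun i _ => ?_) ?_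
      · rw [map_mul]
        refine HasDP.mul_left _ ?_
        change HasDP (g (teichmuller p (mono 1 _)))
        rw [hg]
        refine HasDP.map _ ?_
        rw [map_one, map_one, one_mul]
        exact fun m => ⟨_, xMono_single_pow i m⟩
      · rw [map_mul, map_natCast]
        refine HasDP.mul_left _ fun m => ?_
        obtain ⟨c, hc⟩ := exists_factorial_mul_eq_pow (p := p) (S := DPSeries B p n) m
        exact ⟨c, hc.symm⟩
  refine ⟨f, fun α => by rw [hf, hg, map_one, map_one, one_mul], fun a => ?_⟩
  have := eq_of_teichmuller_eq (p := p) (g.comp (constW B p n))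
    ((algebraMap (DPPoly B p n) (DPSeries B p n)).comp (DPPoly.const B p n)) fun b => by
      rw [RingHom.comp_apply, constW_teichmuller, hg, DPPoly.xMono_zero, mul_one, RingHom.comp_apply]
  rw [hf]
  exact congrArg (fun f => f a) this

end DPSeries

end dpPoly

end Fontaine

namespace Fontaine
open WittVector

/-! ### The PD hull modulo powers of p: spanning and independence -/

noncomputable section hullBasis
open scoped Nat

variable {B : Type*} [CommRing B] {p : ℕ} [hp : Fact p.Prime] [CharP B p] [PerfectRing B p]
  {n : ℕ}

lemma mono_one_sum {ι : Type*} (s : Finset ι) (α : ι → Expo p n) :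
    mono (1 : B) (∑ i ∈ s, α i) = ∏ i ∈ s, mono 1 (α i) := by
  classical
  induction s using Finset.induction_on with
  | empty => rw [Finset.sum_empty, Finset.prod_empty, mono_one]
  | insert i s hi ih =>
    rw [Finset.sum_insert hi, Finset.prod_insert hi, ← ih, mono_mul, one_mul]

lemma mono_ofNat (k : Fin n → ℕ) :
    mono (1 : B) (Expo.ofNat k : Expo p n) = ∏ i, tiltX B p n i ^ k i := by
  rw [Expo.ofNat_eq_sum, mono_one_sum]
  exact Finset.prod_congr rfl fun i _ => by rw [tiltX, mono_pow, one_pow]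

/-- The element `[x^α] ∏ γ_{k_i}([x_i])` of the PD hull. -/
def hullElt (α : Expo p n) (k : Fin n → ℕ) : KeyHull B p n :=
  hullMap B p n (teichmuller p (mono 1 α)) * ∏ i, PDHull.gamma p _ (k i) (teichX B p n i)

lemma hullElt_zero (α : Expo p n) :
    hullElt α 0 = hullMap B p n (teichmuller p (mono 1 α)) := by
  rw [hullElt, Finset.prod_eq_one, mul_one]
  exact fun i _ => PDHull.gamma_zero _

lemma hullElt_mul (α β : Expo p n) (k l : Fin n → ℕ) :
    hullElt (B := B) α k * hullElt β l =
      ((∏ i, (k i + l i).choose (k i) : ℕ) : KeyHull B p n) * hullElt (α + β) (k + l) := by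
  rw [hullElt, hullElt, hullElt, mul_mul_mul_comm, ← Finset.prod_mul_distrib, ← map_mul, ← map_mul,
    mono_mul, one_mul, mul_left_comm, Nat.cast_prod, ← Finset.prod_mul_distrib]
  refine congrArg _ (Finset.prod_congr rfl fun i _ => ?_)
  rw [PDHull.gamma_mul, nsmul_eq_mul, Pi.add_apply]

lemma hullElt_ofNat (k : Fin n → ℕ) :
    hullElt (B := B) (Expo.ofNat k : Expo p n) 0 =
      ((∏ i, (k i)! : ℕ) : KeyHull B p n) * hullElt 0 k := by
  rw [hullElt_zero, hullElt, mono_one, map_one, map_one, one_mul, mono_ofNat, map_prod, map_prod,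
    Nat.cast_prod, ← Finset.prod_mul_distrib]
  refine Finset.prod_congr rfl fun i _ => ?_
  rw [map_pow, map_pow, PDHull.factorial_mul_gamma]
  rfl

/-- The basis element `x^α / ⌊α⌋!` of the PD hull. -/
def hullMono (α : Expo p n) : KeyHull B p n := hullElt α.fract α.floor

/-- Write x^α as its fractional part times ∏ x_i^{⌊α_i⌋}, and use [x_i]^m = m! γ_m([x_i]). The
integral powers merge with the given divided powers at the cost of an integer factor. -/
lemma exists_hullElt_eq (α : Expo p n) (k : Fin n → ℕ) :
    ∃ N : ℕ, hullElt (B := B) α k = (N : KeyHull B p n) * hullMono (α + Expo.ofNat k) := by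
  have h1 : hullElt (B := B) α k = hullElt (Expo.ofNat α.floor) 0 * hullElt α.fract k := by
    rw [hullElt_mul, Expo.floor_add_fract, zero_add, Finset.prod_eq_one, Nat.cast_one, one_mul]
    intro i _
    exact Nat.choose_zero_right _
  rw [h1, hullElt_ofNat, mul_assoc, hullElt_mul, ← mul_assoc, zero_add, ← Nat.cast_mul, hullMono,
    Expo.fract_add_ofNat, Expo.floor_add_ofNat]
  exact ⟨_, rfl⟩

lemma exists_hullMono_mul (α β : Expo p n) :
    ∃ N : ℕ, hullMono (B := B) α * hullMono β = (N : KeyHull B p n) * hullMono (α + β) := by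
  obtain ⟨N, hN⟩ := exists_hullElt_eq (B := B) (α.fract + β.fract) (α.floor + β.floor)
  have h : α.fract + β.fract + Expo.ofNat (α.floor + β.floor) = α + β := by
    conv_rhs => rw [← Expo.floor_add_fract α, ← Expo.floor_add_fract β]
    rw [Expo.ofNat_add]
    abel
  rw [h] at hN
  rw [hullMono, hullMono, hullElt_mul, hN, ← mul_assoc, ← Nat.cast_mul]
  exact ⟨_, rfl⟩

lemma fac_mul_hullMono (α : Expo p n) : (Expo.fac α : KeyHull B p n) * hullMono α =
    hullMap B p n (teichmuller p (mono 1 α)) := by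
  have h1 := hullElt_mul (B := B) (Expo.ofNat α.floor) α.fract 0 0
  rw [Expo.floor_add_fract, zero_add, hullElt_zero α, Finset.prod_eq_one (by simp), Nat.cast_one,
    one_mul] at h1
  have h2 := hullElt_mul (B := B) 0 α.fract α.floor 0
  rw [zero_add, add_zero, Finset.prod_eq_one (fun i _ => by
    rw [Pi.zero_apply, add_zero, Nat.choose_self]), Nat.cast_one, one_mul] at h2
  rw [← h1, hullElt_ofNat, mul_assoc, h2]
  rfl

variable (B p n) in
/-- Finite linear combinations of the basis elements of the PD hull. -/
def comb : (Expo p n →₀ WittVector p B) →+ KeyHull B p n :=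
  Finsupp.liftAddHom fun α => (AddMonoidHom.mulRight (hullMono α)).comp
    ((hullMap B p n).comp (constW B p n)).toAddMonoidHom

lemma comb_single (α : Expo p n) (c : WittVector p B) :
    comb B p n (Finsupp.single α c) = hullMap B p n (constW B p n c) * hullMono α :=
  Finsupp.liftAddHom_apply_single _ _ _

lemma comb_apply (f : Expo p n →₀ WittVector p B) :
    comb B p n f = ∑ α ∈ f.support, hullMap B p n (constW B p n (f α)) * hullMono α := rfl

lemma comb_single_mul (α : Expo p n) (c : WittVector p B) (k : ℕ) :
    comb B p n (Finsupp.single α (k * c)) =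
      hullMap B p n (constW B p n c) * ((k : KeyHull B p n) * hullMono α) := by
  rw [comb_single, map_mul, map_mul, map_natCast, map_natCast, mul_comm (k : KeyHull B p n),
    mul_assoc]

/-- Independence is transported from the model ring: `hullMono` maps to `dpMono`, since their
multiples by ⌊α⌋! correspond and the target is torsion free. -/
lemma pow_dvd_of_pow_dvd_comb {m : ℕ} {f : Expo p n →₀ WittVector p B}
    (h : (p : KeyHull B p n) ^ m ∣ comb B p n f) (α : Expo p n) :
    (p : WittVector p B) ^ m ∣ f α := by
  obtain ⟨φ', h1, h2⟩ := DPSeries.exists_hullHom B p n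
  have h3 : ∀ α, φ' (hullMono α) = algebraMap (DPPoly B p n) _ (DPPoly.dpMono α) := fun α => by
    refine sub_eq_zero.mp (DPSeries.natCast_mul (Expo.fac_ne_zero α) ?_)
    rw [mul_sub, ← map_natCast φ', ← map_mul, fac_mul_hullMono, h1, ← DPPoly.fac_mul_dpMono,
      map_mul, map_natCast, map_natCast, sub_self]
  have h4 := map_dvd φ' h
  rw [comb_apply, map_sum, map_pow, map_natCast] at h4
  simp only [map_mul, h2, h3] at h4
  simp only [← map_mul, ← map_sum] at h4
  by_cases hα : α ∈ f.support
  · exact DPPoly.pow_dvd_of_pow_dvd_sum (pow_dvd_of_pow_dvd_algebraMap h4) α hα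
  · rw [Finsupp.notMem_support_iff.mp hα]
    exact dvd_zero _

lemma teichmuller_mono (b : B) (α : Expo p n) : teichmuller p (mono b α) =
    constW B p n (teichmuller p b) * teichmuller p (mono 1 α) := by
  rw [constW_teichmuller, ← map_mul, mono_mul, mul_one, zero_add]

lemma hullMap_teichmuller_mono (b : B) (α : Expo p n) :
    hullMap B p n (teichmuller p (mono b α)) =
      comb B p n (Finsupp.single α (Expo.fac α * teichmuller p b)) := by
  rw [comb_single_mul, fac_mul_hullMono, teichmuller_mono, map_mul]

lemma p_dvd_sub_of_coeff_zero {R : Type*} [CommRing R] [CharP R p] [PerfectRing R p]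
    {v w : WittVector p R} (h : v.coeff 0 = w.coeff 0) : (p : WittVector p R) ∣ v - w := by
  refine p_dvd_of_coeff_zero ?_
  have := add_coeff_zero' (v - w) w
  rw [sub_add_cancel, h] at this
  exact right_eq_add.mp this

lemma coeff_zero_sum {R ι : Type*} [CommRing R] (s : Finset ι) (w : ι → WittVector p R) :
    (∑ i ∈ s, w i).coeff 0 = ∑ i ∈ s, (w i).coeff 0 :=
  map_sum (constantCoeff (p := p) (R := R)) w s

lemma p_dvd_teichmuller_polyHom_sub (y : PerfPoly B p n) :
    (p : KeyWitt B p n) ∣ teichmuller p (polyHom B p n y) -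
      ∑ α ∈ y.coeff.support, teichmuller p (mono (y.coeff α) α) := by
  refine p_dvd_sub_of_coeff_zero ?_
  rw [coeff_zero_sum, teichmuller_coeff_zero, polyHom_eq_sum]
  exact Finset.sum_congr rfl fun _ _ => (teichmuller_coeff_zero _ _).symm

/-- Representatives modulo `p` of the image of `W(C^♭)` in the PD hull. -/
lemma p_dvd_hullMap_sub {w : KeyWitt B p n} {y : PerfPoly B p n}
    (h : Perfection.coeff _ p 1 (w.coeff 0) = Perfection.coeff _ p 1 (polyHom B p n y)) :
    (p : KeyHull B p n) ∣ hullMap B p n w -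
      comb B p n (y.coeff.sum fun α b => Finsupp.single α (Expo.fac α * teichmuller p b)) := by
  -- By continuity, modulo p a Witt vector matters only through ν_1 of its 0-th coordinate, which a
  -- polynomial can match.
  have h1 : (p : KeyHull B p n) ∣ hullMap B p n w - hullMap B p n (teichmuller p (polyHom B p n y)) := by
    have h2 := pow_dvd_algebraMap_sub (k := 1) (w := w) (w' := teichmuller p (polyHom B p n y))
      (fun i hi => by rw [Nat.lt_one_iff.mp hi, teichmuller_coeff_zero, h])
    rw [Acris.algebraMap_witt, Acris.algebraMap_witt, ← map_sub] at h2
    have h3 := Acris.pow_dvd_of_algebraMap h2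
    rwa [pow_one] at h3
  have h2 := map_dvd (hullMap B p n) (p_dvd_teichmuller_polyHom_sub y)
  rw [map_natCast, map_sub, map_sum] at h2
  simp only [hullMap_teichmuller_mono] at h2
  rw [Finsupp.sum, map_sum]
  have h3 := dvd_add h1 h2
  rwa [sub_add_sub_cancel] at h3

variable (B p n) in
/-- The elements of the PD hull that are congruent modulo `p` to finite linear combinations. -/
def combModP : Subring (KeyHull B p n) where
  carrier := {d | ∃ f, (p : KeyHull B p n) ∣ d - comb B p n f}
  zero_mem' := ⟨0, by simp⟩
  one_mem' := ⟨Finsupp.single 0 (Expo.fac (0 : Expo p n) * 1), by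
    rw [comb_single_mul, fac_mul_hullMono, mono_one, map_one, map_one, map_one, map_one, mul_one,
      sub_self]
    exact dvd_zero _⟩
  add_mem' := by
    rintro d d' ⟨f, hf⟩ ⟨f', hf'⟩
    exact ⟨f + f', by rw [map_add, add_sub_add_comm]; exact dvd_add hf hf'⟩
  neg_mem' := by
    rintro d ⟨f, hf⟩
    exact ⟨-f, by rw [map_neg, ← neg_sub']; exact hf.neg_right⟩
  mul_mem' := by
    rintro d d' ⟨f, hf⟩ ⟨f', hf'⟩
    have key : ∃ g, comb B p n g = comb B p n f * comb B p n f' := by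
      choose N hN using exists_hullMono_mul (B := B) (p := p) (n := n)
      refine ⟨∑ α ∈ f.support, ∑ β ∈ f'.support,
        Finsupp.single (α + β) (N α β * (f α * f' β)), ?_⟩
      rw [comb_apply f, comb_apply f', Finset.sum_mul_sum, map_sum]
      refine Finset.sum_congr rfl fun α _ => ?_
      rw [map_sum]
      refine Finset.sum_congr rfl fun β _ => ?_
      rw [comb_single_mul, ← hN, map_mul, map_mul]
      exact mul_mul_mul_comm _ _ _ _
    obtain ⟨g, hg⟩ := key
    refine ⟨g, ?_⟩
    rw [hg]
    have : d * d' - comb B p n f * comb B p n f' =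
      (d - comb B p n f) * d' + comb B p n f * (d' - comb B p n f') := by ring
    rw [this]
    exact dvd_add (hf.mul_right _) (hf'.mul_left _)

lemma hullMap_mem_combModP (w : KeyWitt B p n) : hullMap B p n w ∈ combModP B p n := by
  obtain ⟨y, hy⟩ := exists_coeff_polyHom_eq 1 (w.coeff 0)
  exact Exists.intro _ (p_dvd_hullMap_sub hy.symm)

lemma hullMono_mem_combModP (α : Expo p n) : hullMono α ∈ combModP B p n :=
  ⟨Finsupp.single α 1, by
    rw [comb_single, map_one, map_one, one_mul, sub_self]; exact dvd_zero _⟩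

/-- The elements all of whose divided powers lie in `combModP` are stable under sums and multiples,
so only the generators [x_i] and p of the kernel need be treated. -/
lemma gamma_mem_combModP (k : ℕ) (x : thetaKer (KeyQuot B p n) p) :
    PDHull.gamma p _ k x ∈ combModP B p n := by
  have hadd : ∀ x y : thetaKer (KeyQuot B p n) p, (∀ k, PDHull.gamma p _ k x ∈ combModP B p n) →
      (∀ k, PDHull.gamma p _ k y ∈ combModP B p n) →
      ∀ k, PDHull.gamma p _ k (x + y) ∈ combModP B p n := fun x y hx hy k => by
    rw [PDHull.gamma_add]
    exact Subring.sum_mem _ fun j _ => Subring.mul_mem _ (hx _) (hy _)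
  have hsmul : ∀ (a : KeyWitt B p n) (x : thetaKer (KeyQuot B p n) p),
      (∀ k, PDHull.gamma p _ k x ∈ combModP B p n) →
      ∀ k, PDHull.gamma p _ k (a • x) ∈ combModP B p n := fun a x hx k => by
    rw [PDHull.gamma_smul]
    exact Subring.mul_mem _ (hullMap_mem_combModP _) (hx k)
  have hX : ∀ i k, PDHull.gamma p _ k (teichX B p n i) ∈ combModP B p n := fun i k => by
    obtain ⟨N, hN⟩ := exists_hullElt_eq (B := B) (0 : Expo p n) (Pi.single i k)
    have : hullElt (B := B) (0 : Expo p n) (Pi.single i k) = PDHull.gamma p _ k (teichX B p n i) := by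
      rw [hullElt, mono_one, map_one, map_one, one_mul, Finset.prod_eq_single i]
      · rw [Pi.single_eq_same]
      · intro j _ hj; rw [Pi.single_eq_of_ne hj, PDHull.gamma_zero]
      · simp
    rw [← this, hN]
    exact Subring.mul_mem _ (natCast_mem _ N) (hullMono_mem_combModP _)
  have hP : ∀ k, PDHull.gamma p (thetaKer (KeyQuot B p n) p) k ⟨_, p_mem_thetaKer⟩ ∈
      combModP B p n := fun k => by
    obtain ⟨e, he⟩ := exists_factorial_mul_eq_pow (p := p) (S := KeyWitt B p n) k
    rw [PDHull.gamma_natCast _ rfl k e he]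
    exact hullMap_mem_combModP _
  obtain ⟨a, c, h⟩ := exists_eq_sum_teichX x
  rw [h]
  refine hadd _ _ (Finset.sum_induction _
    (fun z => ∀ k, PDHull.gamma p _ k z ∈ combModP B p n) hadd ?_
      fun i _ => hsmul _ _ (hX i)) (hsmul _ _ hP) k
  have := hsmul 0 _ hP
  rwa [zero_smul] at this

/-- Spanning modulo p is a statement about ring generators, since `combModP` is a subring. Applying
it again to the quotient of the error by p gives any power of p. -/
lemma exists_comb_pow (m : ℕ) (d : KeyHull B p n) :
    ∃ f, (p : KeyHull B p n) ^ m ∣ d - comb B p n f := by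
  have h1 : ∀ d, d ∈ combModP B p n := fun d => by
    induction d using PDHull.induction_on with
    | algebraMap a => exact hullMap_mem_combModP a
    | add x y hx hy => exact Subring.add_mem _ hx hy
    | gamma x k y hx => exact Subring.mul_mem _ hx (gamma_mem_combModP k y)
  induction m generalizing d with
  | zero => exact ⟨0, by simp⟩
  | succ m ih =>
    obtain ⟨f, d', hf⟩ := h1 d
    obtain ⟨f', hf'⟩ := ih d'
    refine ⟨f + p • f', ?_⟩
    rw [map_add, map_nsmul, ← sub_sub, hf, nsmul_eq_mul, ← mul_sub, pow_succ']
    exact mul_dvd_mul_left _ hf'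

end hullBasis

end Fontaine

namespace Fontaine
open WittVector

/-! ### Expansions in A_cris(C) and the action of F -/

noncomputable section expansions

variable {B : Type*} [CommRing B] {p : ℕ} [hp : Fact p.Prime] [CharP B p] [PerfectRing B p]
  {n : ℕ}

variable (B p n) in
/-- The ring `A_cris(C)`. -/
abbrev KeyAcris : Type _ := Acris (KeyQuot B p n) p

variable (B p n) in
/-- The structure map of `A_cris(C)`. -/
abbrev acrisMap : KeyWitt B p n →+* KeyAcris B p n := algebraMap _ _

variable (B p n) in
/-- The map from the PD hull to `A_cris(C)`. -/
abbrev hullAcris : KeyHull B p n →+* KeyAcris B p n := algebraMap _ _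

lemma hullAcris_hullMap (w : KeyWitt B p n) :
    hullAcris B p n (hullMap B p n w) = acrisMap B p n w := rfl

/-- The basis element `x^α / ⌊α⌋!` of `A_cris(C)`. -/
def acrisMono (α : Expo p n) : KeyAcris B p n := hullAcris B p n (hullMono α)

lemma fac_mul_acrisMono (α : Expo p n) : (Expo.fac α : KeyAcris B p n) * acrisMono α =
    acrisMap B p n (teichmuller p (mono 1 α)) := by
  rw [acrisMono, ← hullAcris_hullMap, ← fac_mul_hullMono, map_mul, map_natCast]

variable (B p n) in
/-- Finite linear combinations of the basis elements of `A_cris(C)`. -/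
def combA : (Expo p n →₀ WittVector p B) →+ KeyAcris B p n :=
  (hullAcris B p n).toAddMonoidHom.comp (comb B p n)

lemma combA_eq (f : Expo p n →₀ WittVector p B) :
    combA B p n f = hullAcris B p n (comb B p n f) := rfl

lemma combA_single (α : Expo p n) (c : WittVector p B) :
    combA B p n (Finsupp.single α c) = acrisMap B p n (constW B p n c) * acrisMono α := by
  rw [combA_eq, comb_single, map_mul]; rfl

lemma combA_apply (f : Expo p n →₀ WittVector p B) :
    combA B p n f = ∑ α ∈ f.support, acrisMap B p n (constW B p n (f α)) * acrisMono α := by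
  rw [combA_eq, comb_apply, map_sum]
  exact Finset.sum_congr rfl fun α _ => map_mul _ _ _

lemma pow_dvd_of_pow_dvd_combA {m : ℕ} {f : Expo p n →₀ WittVector p B}
    (h : (p : KeyAcris B p n) ^ m ∣ combA B p n f) (α : Expo p n) :
    (p : WittVector p B) ^ m ∣ f α :=
  pow_dvd_of_pow_dvd_comb (Acris.pow_dvd_of_algebraMap h) α

lemma pow_dvd_combA {m : ℕ} {f : Expo p n →₀ WittVector p B}
    (h : ∀ α, (p : WittVector p B) ^ m ∣ f α) : (p : KeyAcris B p n) ^ m ∣ combA B p n f := by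
  rw [combA_apply]
  refine Finset.dvd_sum fun α _ => Dvd.dvd.mul_right ?_ _
  have := map_dvd ((acrisMap B p n).comp (constW B p n)) (h α)
  rwa [map_pow, map_natCast] at this

/-- The element `u` of `A_cris(C)` has the expansion `∑ a_α x^α / ⌊α⌋!`. -/
def Expands (a : Expo p n → WittVector p B) (u : KeyAcris B p n) : Prop :=
  ∀ m : ℕ, ∃ f : Expo p n →₀ WittVector p B, (p : KeyAcris B p n) ^ m ∣ u - combA B p n f ∧
    ∀ α, (p : WittVector p B) ^ m ∣ a α - f α

/-- Finite combinations approximate u modulo each p^m; by independence their coefficients form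
Cauchy sequences, with limits in W(B). -/
lemma exists_expands (u : KeyAcris B p n) : ∃ a, Expands a u := by
  have h1 : ∀ m, ∃ f, (p : KeyAcris B p n) ^ m ∣ u - combA B p n f := fun m => by
    obtain ⟨d, hd⟩ := Acris.exists_pow_dvd_sub m u
    obtain ⟨f, hf⟩ := exists_comb_pow m d
    have := map_dvd (hullAcris B p n) hf
    rw [map_pow, map_natCast, map_sub, ← combA_eq] at this
    exact ⟨f, by have := dvd_add hd this; rwa [sub_add_sub_cancel] at this⟩
  choose f hf using h1
  have h2 : ∀ α, ∃ c, ∀ m, (p : WittVector p B) ^ m ∣ c - f m α := fun α =>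
    exists_forall_pow_dvd_sub fun m => by
      rw [← Finsupp.sub_apply]
      refine pow_dvd_of_pow_dvd_combA ?_ α
      rw [map_sub, ← sub_sub_sub_cancel_left _ _ u]
      exact dvd_sub (hf m) ((pow_dvd_pow _ (Nat.le_succ m)).trans (hf (m + 1)))
  choose a ha using h2
  exact ⟨a, fun m => ⟨f m, hf m, fun α => ha α m⟩⟩

namespace Expands

variable {a b : Expo p n → WittVector p B} {u v : KeyAcris B p n}

lemma add (ha : Expands a u) (hb : Expands b v) : Expands (a + b) (u + v) := fun m => by
  obtain ⟨f, h1, h2⟩ := ha m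
  obtain ⟨g, h3, h4⟩ := hb m
  refine ⟨f + g, ?_, fun α => ?_⟩
  · rw [map_add, add_sub_add_comm]; exact dvd_add h1 h3
  · rw [Pi.add_apply, Finsupp.add_apply, add_sub_add_comm]; exact dvd_add (h2 α) (h4 α)

lemma neg (ha : Expands a u) : Expands (-a) (-u) := fun m => by
  obtain ⟨f, h1, h2⟩ := ha m
  refine ⟨-f, ?_, fun α => ?_⟩
  · rw [map_neg, ← neg_sub']; exact h1.neg_right
  · rw [Pi.neg_apply, Finsupp.neg_apply, ← neg_sub']; exact (h2 α).neg_right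

lemma sub (ha : Expands a u) (hb : Expands b v) : Expands (a - b) (u - v) := by
  rw [sub_eq_add_neg, sub_eq_add_neg]; exact ha.add hb.neg

lemma natCast_mul (ha : Expands a u) (k : ℕ) :
    Expands (fun α => (k : WittVector p B) * a α) ((k : KeyAcris B p n) * u) := fun m => by
  obtain ⟨f, h1, h2⟩ := ha m
  refine ⟨k • f, ?_, fun α => ?_⟩
  · rw [map_nsmul, nsmul_eq_mul, ← mul_sub]; exact h1.mul_left _
  · rw [Finsupp.smul_apply, nsmul_eq_mul, ← mul_sub]; exact (h2 α).mul_left _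

lemma combA (f : Expo p n →₀ WittVector p B) : Expands f (combA B p n f) := fun m =>
  ⟨f, by rw [sub_self]; exact dvd_zero _, fun α => by rw [sub_self]; exact dvd_zero _⟩

lemma pow_dvd (ha : Expands a u) {m : ℕ} (h : (p : KeyAcris B p n) ^ m ∣ u) (α : Expo p n) :
    (p : WittVector p B) ^ m ∣ a α := by
  obtain ⟨f, h1, h2⟩ := ha m
  exact (dvd_iff_dvd_of_dvd_sub (h2 α)).mpr
    (pow_dvd_of_pow_dvd_combA ((dvd_iff_dvd_of_dvd_sub h1).mp h) α)

lemma pow_dvd_of_forall (ha : Expands a u) {m : ℕ} (h : ∀ α, (p : WittVector p B) ^ m ∣ a α) :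
    (p : KeyAcris B p n) ^ m ∣ u := by
  obtain ⟨f, h1, h2⟩ := ha m
  exact (dvd_iff_dvd_of_dvd_sub h1).mpr
    (pow_dvd_combA fun α => (dvd_iff_dvd_of_dvd_sub (h2 α)).mp (h α))

lemma eq_zero (ha : Expands a 0) (α : Expo p n) : a α = 0 :=
  eq_zero_of_forall_pow_dvd (p := p) fun _ => ha.pow_dvd (dvd_zero _) α

lemma eq_zero_of_forall (ha : Expands a u) (h : ∀ α, a α = 0) : u = 0 :=
  eq_zero_of_forall_pow_dvd (p := p) fun _ => ha.pow_dvd_of_forall fun α => by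
    rw [h α]; exact dvd_zero _

lemma unique (ha : Expands a u) (hb : Expands b u) : a = b := by
  have := ha.sub hb
  rw [sub_self] at this
  exact funext fun α => sub_eq_zero.mp (this.eq_zero α)

end Expands

/-- Multiplication by p acts on coefficients, and W(B) is p-torsion free. This discharges the
hypothesis carried by the results on `fbar`. -/
lemma acris_torsionFree (u : KeyAcris B p n) (h : (p : KeyAcris B p n) * u = 0) : u = 0 := by
  obtain ⟨a, ha⟩ := exists_expands u
  have h1 := ha.natCast_mul p
  rw [h] at h1
  exact ha.eq_zero_of_forall fun α => wittVector_natCast_mul hp.out.ne_zero (h1.eq_zero α)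

lemma acris_natCast_mul {k : ℕ} (hk : k ≠ 0) {u v : KeyAcris B p n}
    (h : (k : KeyAcris B p n) * u = k * v) : u = v :=
  sub_eq_zero.mp (natCast_mul_left_injective (p := p) acris_torsionFree hk
    (by rw [mul_sub, h, sub_self]))

lemma wittVector_natCast_mul_cancel {k : ℕ} (hk : k ≠ 0) {x y : WittVector p B}
    (h : (k : WittVector p B) * x = k * y) : x = y :=
  sub_eq_zero.mp (wittVector_natCast_mul hk (by rw [mul_sub, h, sub_self]))

section frobenius

/-- The quotient `⌊pα⌋! / ⌊α⌋!`. -/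
def facQuot (α : Expo p n) : ℕ := Expo.fac (p • α) / Expo.fac α

lemma facQuot_mul_fac (α : Expo p n) : facQuot α * Expo.fac α = Expo.fac (p • α) := by
  refine Nat.div_mul_cancel ?_
  have h := Expo.fac_mul_fac_dvd α ((p - 1) • α)
  rw [← succ_nsmul', Nat.sub_add_cancel hp.out.one_le] at h
  exact (dvd_mul_right _ _).trans h

lemma facQuot_ne_zero (α : Expo p n) : facQuot α ≠ 0 := fun h =>
  Expo.fac_ne_zero (p • α) (by rw [← facQuot_mul_fac, h, zero_mul])

lemma frobenius_constW (c : WittVector p B) :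
    WittVector.frobenius (constW B p n c) = constW B p n (WittVector.frobenius c) := by
  ext1 i
  rw [coeff_frobenius_charP, constW, WittVector.map_coeff, WittVector.map_coeff,
    coeff_frobenius_charP, map_pow]

lemma frob_acrisMap (w : KeyWitt B p n) :
    Acris.frob (acrisMap B p n w) = acrisMap B p n (WittVector.frobenius w) :=
  Acris.frob_algebraMap_witt w

/-- Multiplied by ⌊α⌋!, this is F[x^α] = [x^{pα}]; torsion freeness allows the division. -/
lemma frob_acrisMono (α : Expo p n) : Acris.frob (acrisMono (B := B) α) =
    (facQuot α : KeyAcris B p n) * acrisMono (p • α) := by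
  refine acris_natCast_mul (Expo.fac_ne_zero α) ?_
  rw [← map_natCast Acris.frob, ← map_mul, fac_mul_acrisMono, frob_acrisMap, frob_teich, mono_pow,
    one_pow, ← mul_assoc, map_natCast, ← Nat.cast_mul, mul_comm (Expo.fac α), facQuot_mul_fac,
    fac_mul_acrisMono]

variable (B p n) in
/-- The Frobenius on finite linear combinations. -/
def frobFin : (Expo p n →₀ WittVector p B) →+ (Expo p n →₀ WittVector p B) :=
  Finsupp.liftAddHom fun α => (Finsupp.singleAddHom (p • α)).comp
    ((AddMonoidHom.mulLeft (facQuot α : WittVector p B)).comp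
      (WittVector.frobenius (p := p) (R := B)).toAddMonoidHom)

lemma frobFin_single (α : Expo p n) (c : WittVector p B) : frobFin B p n (Finsupp.single α c) =
    Finsupp.single (p • α) (facQuot α * WittVector.frobenius c) :=
  Finsupp.liftAddHom_apply_single _ _ _

lemma frob_combA (f : Expo p n →₀ WittVector p B) :
    Acris.frob (combA B p n f) = combA B p n (frobFin B p n f) := by
  induction f using Finsupp.induction_linear with
  | zero => rw [map_zero, map_zero, map_zero, map_zero]
  | add f g hf hg => rw [map_add, map_add, map_add, map_add, hf, hg]
  | single α c =>
    rw [frobFin_single, combA_single, combA_single, map_mul, frob_acrisMap, frobenius_constW,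
      frob_acrisMono, map_mul, map_mul, map_natCast, map_natCast]
    ring

lemma Expo.nsmul_eq_iff (α β : Expo p n) : p • α = β ↔ α = Expo.div 1 β := by
  constructor
  · rintro rfl
    have := Expo.div_nsmul 1 α
    rw [pow_one] at this
    exact this.symm
  · rintro rfl
    have := Expo.nsmul_div 1 β
    rwa [pow_one] at this

lemma frobFin_apply (f : Expo p n →₀ WittVector p B) (β : Expo p n) : frobFin B p n f β =
    facQuot (Expo.div 1 β) * WittVector.frobenius (f (Expo.div 1 β)) := by
  induction f using Finsupp.induction_linear with
  | zero => rw [map_zero, Finsupp.zero_apply, Finsupp.zero_apply, map_zero, mul_zero]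
  | add f g hf hg =>
    rw [map_add, Finsupp.add_apply, Finsupp.add_apply, map_add, hf, hg, mul_add]
  | single α c =>
    rw [frobFin_single]
    by_cases h : α = Expo.div 1 β
    · rw [h, (Expo.nsmul_eq_iff _ _).mpr rfl, Finsupp.single_eq_same, Finsupp.single_eq_same]
    · rw [Finsupp.single_eq_of_ne' h, Finsupp.single_eq_of_ne' (mt (Expo.nsmul_eq_iff _ _).mp h),
        map_zero, mul_zero]

lemma Expands.frob {a : Expo p n → WittVector p B} {u : KeyAcris B p n} (ha : Expands a u) :
    Expands (fun β => (facQuot (Expo.div 1 β) : WittVector p B) *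
      WittVector.frobenius (a (Expo.div 1 β)))
      (Acris.frob u) := fun m => by
  obtain ⟨f, h1, h2⟩ := ha m
  refine ⟨frobFin B p n f, ?_, fun β => ?_⟩
  · rw [← frob_combA, ← map_sub]
    exact dvd_frob h1
  · rw [frobFin_apply, ← mul_sub, ← map_sub]
    have := map_dvd (WittVector.frobenius (p := p) (R := B)) (h2 (Expo.div 1 β))
    rw [map_pow, map_natCast] at this
    exact this.mul_left _

/-- The relation between coefficients is kept multiplied by the factorial of β/p^L, which avoids a
product of L quotients of factorials. -/
lemma Expands.frob_iterate {a : Expo p n → WittVector p B} {u : KeyAcris B p n}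
    (ha : Expands a u) (L : ℕ) : ∃ a', Expands a' (Acris.frob^[L] u) ∧
      ∀ β, (Expo.fac (Expo.div L β) : WittVector p B) * a' β =
        Expo.fac β * WittVector.frobenius^[L] (a (Expo.div L β)) := by
  induction L with
  | zero => exact ⟨a, ha, fun β => by rw [Expo.div_zero']; rfl⟩
  | succ L ih =>
    obtain ⟨a', h1, h2⟩ := ih
    refine ⟨_, by rw [Function.iterate_succ_apply']; exact h1.frob, fun β => ?_⟩
    have h3 := congrArg WittVector.frobenius (h2 (Expo.div 1 β))
    rw [map_mul, map_mul, map_natCast, map_natCast, Expo.div_div, add_comm 1 L,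
      ← Function.iterate_succ_apply' (WittVector.frobenius (p := p) (R := B))] at h3
    rw [mul_left_comm, h3, ← mul_assoc, ← Nat.cast_mul, facQuot_mul_fac,
      (Expo.nsmul_eq_iff _ _).mpr rfl]

/-- F permutes the exponents through α ↦ pα, and on coefficients is the bijective Frobenius of W(B)
followed by multiplication by a nonzero integer. -/
lemma frob_injective : Function.Injective (Acris.frob (C := KeyQuot B p n) (p := p)) := by
  rw [injective_iff_map_eq_zero]
  intro u hu
  obtain ⟨a, ha⟩ := exists_expands u
  have h1 := ha.frob
  rw [hu] at h1
  refine ha.eq_zero_of_forall fun α => ?_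
  have h2 := wittVector_natCast_mul (facQuot_ne_zero _) (h1.eq_zero (p • α))
  rw [← (Expo.nsmul_eq_iff α (p • α)).mp rfl] at h2
  exact (WittVector.frobenius_bijective p B).1 (h2.trans (map_zero _).symm)

end frobenius

end expansions

end Fontaine

namespace Fontaine
open WittVector

/-! ### Degree filtrations and injectivity of f̄ -/

noncomputable section degrees

variable {B : Type*} [CommRing B] {p : ℕ} [hp : Fact p.Prime] [CharP B p] [PerfectRing B p]
  {n : ℕ}

lemma perfPoly_mul_coeff_eq_zero {c d : ℚ≥0} {y z : PerfPoly B p n}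
    (hy : ∀ α : Expo p n, Expo.deg α < c → y.coeff α = 0)
    (hz : ∀ α : Expo p n, Expo.deg α < d → z.coeff α = 0) (γ : Expo p n)
    (h : Expo.deg γ < c + d) : (y * z).coeff γ = 0 := by
  classical
  rw [AddMonoidAlgebra.coeff_mul]
  refine Finset.sum_eq_zero fun α _ => Finset.sum_eq_zero fun β _ => ?_
  change (if α + β = γ then y.coeff α * z.coeff β else 0) = 0
  split_ifs with hαβ
  · by_cases hα : Expo.deg α < c
    · rw [hy α hα, zero_mul]
    · rw [hz β, mul_zero]
      by_contra hβ
      rw [← hαβ, map_add] at h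
      exact absurd h (not_lt.mpr (add_le_add (not_lt.mp hα) (not_lt.mp hβ)))
  · rfl

variable (B p n) in
/-- The polynomials all of whose monomials have degree at least `d`. -/
def polyDeg (d : ℚ≥0) : Ideal (PerfPoly B p n) where
  carrier := {y | ∀ α : Expo p n, Expo.deg α < d → y.coeff α = 0}
  zero_mem' _ _ := rfl
  add_mem' {y z} hy hz α hα := by
    rw [AddMonoidAlgebra.coeff_add, Finsupp.add_apply, hy α hα, hz α hα, add_zero]
  smul_mem' y z hz α hα := perfPoly_mul_coeff_eq_zero (c := 0)
    (fun α hα => absurd hα not_lt_zero) hz α (by rwa [zero_add])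

lemma mul_mem_polyDeg {c d : ℚ≥0} {y z : PerfPoly B p n} (hy : y ∈ polyDeg B p n c)
    (hz : z ∈ polyDeg B p n d) : y * z ∈ polyDeg B p n (c + d) :=
  perfPoly_mul_coeff_eq_zero hy hz

lemma pow_mem_polyDeg {d : ℚ≥0} {y : PerfPoly B p n} (hy : y ∈ polyDeg B p n d) (m : ℕ) :
    y ^ m ∈ polyDeg B p n (m * d) := by
  induction m with
  | zero => intro α hα; rw [Nat.cast_zero, zero_mul] at hα; exact absurd hα not_lt_zero
  | succ m ih => rw [pow_succ, Nat.cast_succ, add_mul, one_mul]; exact mul_mem_polyDeg ih hy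

lemma single_mem_polyDeg {d : ℚ≥0} {α : Expo p n} (h : d ≤ Expo.deg α) (b : B) :
    AddMonoidAlgebra.single α b ∈ polyDeg B p n d := fun β hβ => by
  rw [AddMonoidAlgebra.coeff_single, Finsupp.single_eq_of_ne']
  rintro rfl
  exact absurd hβ (not_lt.mpr h)

lemma span_X_le_polyDeg : Ideal.span (Set.range (PerfPoly.X B p n)) ≤ polyDeg B p n 1 := by
  rw [Ideal.span_le]
  rintro _ ⟨i, rfl⟩
  refine single_mem_polyDeg (le_trans (le_of_eq ?_) (Expo.coe_le_deg _ i)) 1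
  rw [Pi.single_eq_same]
  rfl

/-- The element `r` of `C^♭` is a limit of sums of monomials of degree at least `d`. -/
def TiltDeg (d : ℚ≥0) (r : KeyTilt B p n) : Prop :=
  ∀ k, ∃ y ∈ polyDeg B p n d, Perfection.coeff _ p k r = Perfection.coeff _ p k (polyHom B p n y)

/-- A polynomial approximating r at ν_k also agrees with r at ν_0, hence lies in the ideal of the
x_i, all of whose monomials have degree at least 1. -/
lemma tiltDeg_one {r : KeyTilt B p n} (hr : Perfection.coeff _ p 0 r = 0) : TiltDeg 1 r := by
  intro k
  obtain ⟨y, hy⟩ := exists_coeff_polyHom_eq k r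
  refine ⟨y ^ p ^ k, span_X_le_polyDeg ?_, hy.symm⟩
  have h := coeff_zero_eq_zero_of_coeff (p := p) (k := k) (r := r - polyHom B p n (y ^ p ^ k))
    (by rw [map_sub, hy, sub_self])
  rw [map_sub, hr, zero_sub, neg_eq_zero, coeff_zero_polyHom] at h
  exact keyMk_eq_zero_iff.mp h

lemma TiltDeg.mono {c d : ℚ≥0} (hcd : c ≤ d) {r : KeyTilt B p n} (hr : TiltDeg d r) :
    TiltDeg c r := fun k => (hr k).imp fun _ h => ⟨fun α hα => h.1 α (hα.trans_le hcd), h.2⟩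

/-- A monomial of degree above n p^k has some exponent α_i ≥ p^k, and so is killed by ν_k. -/
lemma eq_zero_of_forall_tiltDeg {r : KeyTilt B p n} (h : ∀ m : ℕ, TiltDeg (m : ℚ≥0) r) : r = 0 := by
  refine Perfection.ext fun k => ?_
  obtain ⟨y, hy, hk⟩ := h (n * p ^ k + 1) k
  rw [hk, polyHom_eq_sum, map_sum, map_zero]
  refine Finset.sum_eq_zero fun α _ => ?_
  by_cases hα : Expo.deg α < ((n * p ^ k + 1 : ℕ) : ℚ≥0)
  · rw [hy α hα, mono_zero_left, map_zero]
  · obtain ⟨i, hi⟩ := Expo.exists_le_coe_of_le_deg (α := α) (c := (p : ℚ≥0) ^ k)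
      (lt_of_lt_of_le (by push_cast; exact lt_add_one _) (not_lt.mp hα))
    exact coeff_mono_eq_zero hi _

/-- All the monomials in the expansion of the element `u` of `A_cris(C)` have degree at
least `d`. -/
def AcrisDeg (d : ℚ≥0) (u : KeyAcris B p n) : Prop :=
  ∀ a, Expands a u → ∀ α : Expo p n, Expo.deg α < d → a α = 0

lemma Expands.acrisDeg {a : Expo p n → WittVector p B} {u : KeyAcris B p n} (ha : Expands a u)
    {d : ℚ≥0} (h : ∀ α : Expo p n, Expo.deg α < d → a α = 0) : AcrisDeg d u := fun b hb => by
  rw [hb.unique ha]; exact h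

namespace AcrisDeg

variable {c d : ℚ≥0} {u v : KeyAcris B p n}

lemma mono (hcd : c ≤ d) (hu : AcrisDeg d u) : AcrisDeg c u :=
  fun a ha α hα => hu a ha α (hα.trans_le hcd)

lemma add (hu : AcrisDeg d u) (hv : AcrisDeg d v) : AcrisDeg d (u + v) := by
  obtain ⟨a, ha⟩ := exists_expands u
  obtain ⟨b, hb⟩ := exists_expands v
  exact (ha.add hb).acrisDeg fun α hα => by
    rw [Pi.add_apply, hu a ha α hα, hv b hb α hα, add_zero]

lemma neg (hu : AcrisDeg d u) : AcrisDeg d (-u) := by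
  obtain ⟨a, ha⟩ := exists_expands u
  exact ha.neg.acrisDeg fun α hα => by rw [Pi.neg_apply, hu a ha α hα, neg_zero]

lemma sub (hu : AcrisDeg d u) (hv : AcrisDeg d v) : AcrisDeg d (u - v) := by
  rw [sub_eq_add_neg]; exact hu.add hv.neg

lemma zero : AcrisDeg d (0 : KeyAcris B p n) := fun _ ha α _ => ha.eq_zero α

lemma sum {ι : Type*} {s : Finset ι} {f : ι → KeyAcris B p n} (h : ∀ i ∈ s, AcrisDeg d (f i)) :
    AcrisDeg d (∑ i ∈ s, f i) :=
  Finset.sum_induction _ _ (fun _ _ => add) zero h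

lemma of_forall_pow_dvd (h : ∀ m : ℕ, ∃ v, AcrisDeg d v ∧ (p : KeyAcris B p n) ^ m ∣ u - v) :
    AcrisDeg d u := fun a ha α hα => by
  refine eq_zero_of_forall_pow_dvd (p := p) fun m => ?_
  obtain ⟨v, hv, hm⟩ := h m
  obtain ⟨b, hb⟩ := exists_expands v
  have := (ha.sub hb).pow_dvd hm α
  rwa [Pi.sub_apply, hv b hb α hα, sub_zero] at this

lemma of_natCast_mul {k : ℕ} (hk : k ≠ 0) (h : AcrisDeg d ((k : KeyAcris B p n) * u)) :
    AcrisDeg d u := fun _ ha α hα =>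
  wittVector_natCast_mul hk (h _ (ha.natCast_mul k) α hα)

lemma of_pow_mul {k : ℕ} (h : AcrisDeg d ((p : KeyAcris B p n) ^ k * u)) : AcrisDeg d u := by
  rw [← Nat.cast_pow] at h
  exact h.of_natCast_mul (pow_ne_zero _ hp.out.ne_zero)

lemma natCast_mul (k : ℕ) (h : AcrisDeg d u) : AcrisDeg d ((k : KeyAcris B p n) * u) := by
  obtain ⟨a, ha⟩ := exists_expands u
  exact (ha.natCast_mul k).acrisDeg fun α hα => by rw [h a ha α hα, mul_zero]

lemma frob (hu : AcrisDeg d u) : AcrisDeg (p * d) (Acris.frob u) := by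
  obtain ⟨a, ha⟩ := exists_expands u
  refine ha.frob.acrisDeg fun β hβ => ?_
  rw [hu a ha, map_zero, mul_zero]
  rw [Expo.deg_div, pow_one]
  exact (div_lt_iff₀' (Nat.cast_pos.mpr hp.out.pos)).mpr hβ

lemma of_frob (h : AcrisDeg (p * d) (Acris.frob u)) : AcrisDeg d u := fun a ha α hα => by
  have h1 := h _ ha.frob (p • α) (by
    rw [map_nsmul, nsmul_eq_mul]
    exact mul_lt_mul_of_pos_left hα (Nat.cast_pos.mpr hp.out.pos))
  have h2 := wittVector_natCast_mul (facQuot_ne_zero _) h1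
  rw [← (Expo.nsmul_eq_iff α (p • α)).mp rfl] at h2
  exact (WittVector.frobenius_bijective p B).1 (h2.trans (map_zero _).symm)

lemma frob_iterate (hu : AcrisDeg d u) (k : ℕ) : AcrisDeg (p ^ k * d) (Acris.frob^[k] u) := by
  induction k with
  | zero => rwa [pow_zero, one_mul]
  | succ k ih => rw [Function.iterate_succ_apply', pow_succ', mul_assoc]; exact ih.frob

lemma of_frob_iterate {k : ℕ} (h : AcrisDeg (p ^ k * d) (Acris.frob^[k] u)) : AcrisDeg d u := by
  induction k with
  | zero => rwa [pow_zero, one_mul] at h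
  | succ k ih =>
    rw [Function.iterate_succ_apply', pow_succ', mul_assoc] at h
    exact ih h.of_frob

end AcrisDeg

lemma frob_iterate_acrisMap (k : ℕ) (w : KeyWitt B p n) :
    Acris.frob^[k] (acrisMap B p n w) = acrisMap B p n (WittVector.frobenius^[k] w) := by
  induction k with
  | zero => rfl
  | succ k ih => rw [Function.iterate_succ_apply', Function.iterate_succ_apply', ih, frob_acrisMap]

variable (B p n) in
/-- The subgroup of `W(C^♭)` generated by the `a [x^α]`, `a ∈ W(B)`, `α` of degree at
least `d`. -/
def wittDeg (d : ℚ≥0) : AddSubgroup (KeyWitt B p n) :=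
  AddSubgroup.closure {w | ∃ (c : WittVector p B) (α : Expo p n), d ≤ Expo.deg α ∧
    w = constW B p n c * teichmuller p (mono 1 α)}

lemma teichmuller_mono_mem_wittDeg {d : ℚ≥0} {α : Expo p n} (h : d ≤ Expo.deg α) (b : B) :
    teichmuller p (mono b α) ∈ wittDeg B p n d :=
  AddSubgroup.subset_closure ⟨_, α, h, teichmuller_mono b α⟩

lemma mul_mem_wittDeg {c d : ℚ≥0} {v w : KeyWitt B p n} (hv : v ∈ wittDeg B p n c)
    (hw : w ∈ wittDeg B p n d) : v * w ∈ wittDeg B p n (c + d) := by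
  induction hv using AddSubgroup.closure_induction with
  | zero => rw [zero_mul]; exact zero_mem _
  | add v v' _ _ h h' => rw [add_mul]; exact add_mem h h'
  | neg v _ h => rw [neg_mul]; exact neg_mem h
  | mem v hv =>
    obtain ⟨b, α, hα, rfl⟩ := hv
    induction hw using AddSubgroup.closure_induction with
    | zero => rw [mul_zero]; exact zero_mem _
    | add v v' _ _ h h' => rw [mul_add]; exact add_mem h h'
    | neg v _ h => rw [mul_neg]; exact neg_mem h
    | mem w hw =>
      obtain ⟨b', β, hβ, rfl⟩ := hw
      refine AddSubgroup.subset_closure ⟨b * b', α + β, ?_, ?_⟩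
      · rw [map_add]; exact add_le_add hα hβ
      · rw [mul_mul_mul_comm, ← map_mul, ← map_mul, mono_mul, one_mul]

lemma pow_mem_wittDeg {d : ℚ≥0} {w : KeyWitt B p n} (hw : w ∈ wittDeg B p n d) (m : ℕ) :
    w ^ m ∈ wittDeg B p n (m * d) := by
  induction m with
  | zero =>
    rw [pow_zero, Nat.cast_zero, zero_mul, ← map_one (teichmuller p), ← mono_one]
    exact teichmuller_mono_mem_wittDeg zero_le _
  | succ m ih => rw [pow_succ, Nat.cast_succ, add_mul, one_mul]; exact mul_mem_wittDeg ih hw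

lemma acrisDeg_of_mem_wittDeg {d : ℚ≥0} {w : KeyWitt B p n} (hw : w ∈ wittDeg B p n d) :
    AcrisDeg d (acrisMap B p n w) := by
  induction hw using AddSubgroup.closure_induction with
  | zero => rw [map_zero]; exact AcrisDeg.zero
  | add v w _ _ hv hw => rw [map_add]; exact hv.add hw
  | neg v _ hv => rw [map_neg]; exact hv.neg
  | mem w hw =>
    obtain ⟨c, α, hα, rfl⟩ := hw
    rw [map_mul, ← fac_mul_acrisMono, mul_left_comm, ← combA_single]
    refine AcrisDeg.natCast_mul _ ((Expands.combA _).acrisDeg fun β hβ => ?_)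
    rw [Finsupp.single_eq_of_ne']
    rintro rfl
    exact absurd hβ (not_lt.mpr hα)

/-- The map r ↦ [r] is not additive, so a sum of monomials cannot be treated term by term. Taking
p^M-th roots first makes the defect disappear modulo p^M. -/
lemma acrisDeg_teichmuller {d : ℚ≥0} {r : KeyTilt B p n} (hr : TiltDeg d r) :
    AcrisDeg d (acrisMap B p n (teichmuller p r)) := by
  refine AcrisDeg.of_forall_pow_dvd fun M => ?_
  obtain ⟨y, hy, hM⟩ := hr M
  have h1 : (p : KeyAcris B p n) ^ M ∣ acrisMap B p n (teichmuller p r) -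
      acrisMap B p n (teichmuller p (polyHom B p n y)) := pow_dvd_algebraMap_sub fun i _ => by
    rcases Nat.eq_zero_or_pos i with rfl | hi
    · rw [teichmuller_coeff_zero, teichmuller_coeff_zero, hM]
    · rw [teichmuller_coeff_pos _ _ _ hi, teichmuller_coeff_pos _ _ _ hi]
  let t : Expo p n → KeyTilt B p n := fun α => mono (rootB (p := p) M (y.coeff α)) (Expo.div M α)
  have h2 : polyHom B p n y = (∑ α ∈ y.coeff.support, t α) ^ p ^ M := by
    rw [sum_pow_char_pow, polyHom_eq_sum]
    refine Finset.sum_congr rfl fun α _ => ?_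
    rw [mono_pow, rootB_pow, Expo.nsmul_div]
  have h3 : (p : KeyWitt B p n) ∣ teichmuller p (∑ α ∈ y.coeff.support, t α) -
      ∑ α ∈ y.coeff.support, teichmuller p (t α) := by
    refine p_dvd_sub_of_coeff_zero ?_
    rw [coeff_zero_sum, teichmuller_coeff_zero]
    exact Finset.sum_congr rfl fun _ _ => (teichmuller_coeff_zero _ _).symm
  -- A congruence modulo p becomes one modulo p^{M+1} after raising to the power p^M, and the roots
  -- of the monomials have degree at least d/p^M.
  have h4 := (pow_dvd_pow _ (Nat.le_succ M)).trans (dvd_sub_pow_of_dvd_sub h3 M)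
  rw [← map_pow, ← h2] at h4
  have h5 := map_dvd (acrisMap B p n) h4
  rw [map_pow, map_natCast, map_sub] at h5
  refine ⟨_, acrisDeg_of_mem_wittDeg ?_, by
    have := dvd_add h1 h5; rwa [sub_add_sub_cancel] at this⟩
  have h6 : ∑ α ∈ y.coeff.support, teichmuller p (t α) ∈ wittDeg B p n (d / p ^ M) := by
    refine sum_mem fun α hα => teichmuller_mono_mem_wittDeg ?_ _
    rw [Expo.deg_div]
    have : d ≤ Expo.deg α := not_lt.mp fun h => Finsupp.mem_support_iff.mp hα (hy α h)
    gcongr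
  have h7 := pow_mem_wittDeg h6 (p ^ M)
  rwa [Nat.cast_pow, mul_div_cancel₀ _ (natCast_p_pow_ne_zero M)] at h7

/-- Multiplication by p^l turns the polar term into F^l[r], which has degree at least p^l ≥ 1;
integer factors do not affect the degree. -/
lemma acrisDeg_polar (l : ℕ) {r : KeyTilt B p n} (hr : Perfection.coeff _ p 0 r = 0) :
    AcrisDeg 1 (polar l r) := by
  refine AcrisDeg.of_pow_mul (k := l) ?_
  rw [pow_mul_polar l r hr]
  have h := (acrisDeg_teichmuller (tiltDeg_one hr)).frob_iterate l
  rw [frob_iterate_acrisMap, mul_one] at h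
  exact h.mono (one_le_pow₀ (Nat.one_le_cast.mpr hp.out.one_le))

lemma exists_one_le_of_dvd_fac {α : Expo p n} (h : p ∣ Expo.fac α) : ∃ i, 1 ≤ (α i : ℚ≥0) := by
  obtain ⟨i, -, hi⟩ := (hp.out.prime.dvd_finsetProd_iff _).mp h
  refine ⟨i, (Nat.one_le_floor_iff _).mp ?_⟩
  exact hp.out.one_le.trans ((hp.out.dvd_factorial).mp hi)

/-- Modulo p, the coefficient of F^{-k}w at x^α/⌊α⌋! is ⌊α⌋![y_α], where y represents the 0-th
coordinate at ν_1. In degrees below d/p^k it must vanish modulo p, so either y_α = 0 or p divides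
⌊α⌋!. In the latter case some α_i ≥ 1 and the monomial is 0 in C, so it may be dropped; the p^k-th
power of what remains approximates w_0 at ν_k. -/
lemma tiltDeg_coeff_zero {d : ℚ≥0} {w : KeyWitt B p n} (hw : AcrisDeg d (acrisMap B p n w)) :
    TiltDeg d (w.coeff 0) := by
  classical
  intro k
  have h1 : AcrisDeg (d / p ^ k) (acrisMap B p n (frobInv w k)) := by
    refine AcrisDeg.of_frob_iterate (k := k) ?_
    rwa [frob_iterate_acrisMap, iterate_frobenius_frobInv,
      mul_div_cancel₀ _ (natCast_p_pow_ne_zero k)]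
  obtain ⟨z, hz⟩ := exists_coeff_polyHom_eq 1 ((frobInv w k).coeff 0)
  generalize z ^ p ^ 1 = y at hz
  have h2 := map_dvd (hullAcris B p n) (p_dvd_hullMap_sub hz.symm)
  rw [map_natCast, map_sub, hullAcris_hullMap, ← combA_eq] at h2
  obtain ⟨a, ha⟩ := exists_expands (acrisMap B p n (frobInv w k))
  have h3 : ∀ α : Expo p n, Expo.deg α < d / p ^ k → y.coeff α ≠ 0 → ∃ i, 1 ≤ (α i : ℚ≥0) := by
    intro α hα hne
    refine exists_one_le_of_dvd_fac ?_
    by_contra hfac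
    have h4 := (ha.sub (Expands.combA _)).pow_dvd (m := 1) (by rwa [pow_one]) α
    rw [Pi.sub_apply, h1 a ha α hα, zero_sub, dvd_neg, pow_one, Finsupp.sum_apply, Finsupp.sum,
      Finset.sum_eq_single α (fun β _ hβ => Finsupp.single_eq_of_ne' hβ)
        (fun h => absurd (Finsupp.mem_support_iff.mpr hne) h), Finsupp.single_eq_same] at h4
    have h5 : IsUnit ((Expo.fac α : ℕ) : WittVector p B) :=
      isUnit_natCast_of_coprime (p := p) ((hp.out.coprime_iff_not_dvd.mpr hfac).symm)
    rw [h5.dvd_mul_left] at h4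
    have h6 := (mem_span_p_iff_coeff_zero_eq_zero _).mp (Ideal.mem_span_singleton.mpr h4)
    rw [teichmuller_coeff_zero] at h6
    exact hne h6
  -- Discarding every monomial with some α_i ≥ 1 does not change the image in C.
  let y' : PerfPoly B p n := ∑ α ∈ y.coeff.support.filter fun α => ∀ i, ¬ 1 ≤ (α i : ℚ≥0),
    AddMonoidAlgebra.single α (y.coeff α)
  have hy' : y' ∈ polyDeg B p n (d / p ^ k) := by
    refine Ideal.sum_mem _ fun α hα => single_mem_polyDeg (not_lt.mp fun h => ?_) _
    rw [Finset.mem_filter, Finsupp.mem_support_iff] at hα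
    obtain ⟨i, hi⟩ := h3 α h hα.1
    exact hα.2 i hi
  refine ⟨y' ^ p ^ k, ?_, ?_⟩
  · have := pow_mem_polyDeg hy' (p ^ k)
    rwa [Nat.cast_pow, mul_div_cancel₀ _ (natCast_p_pow_ne_zero k)] at this
  · have h4 : Perfection.coeff _ p 0 (polyHom B p n y) =
        Perfection.coeff _ p 0 ((frobInv w k).coeff 0) := by
      rw [← coeff_pow_p_pow 1, ← coeff_pow_p_pow 1 ((frobInv w k).coeff 0), map_pow, map_pow, hz]
    rw [map_pow, coeff_pow_p_pow, ← coeff_frobInv_coeff, ← h4, polyHom_eq_sum, map_sum, map_sum,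
      map_sum, Finset.sum_filter_of_ne]
    · exact Finset.sum_congr rfl fun α _ => by rw [polyHom_single]
    · intro α _ hne i hi
      refine hne ?_
      rw [polyHom_single]
      exact coeff_mono_eq_zero (i := i) (by rwa [pow_zero]) _

/-- With w' the shifted vector, p w' = F(w - [w_0]). Hence w' has degree at least p d, and the
induction passes from w to w'. -/
lemma tiltDeg_coeff {d : ℚ≥0} {w : KeyWitt B p n} (hw : AcrisDeg d (acrisMap B p n w)) (j : ℕ) :
    TiltDeg (p ^ j * d) (w.coeff j) := by
  induction j generalizing d w with
  | zero => rw [pow_zero, one_mul]; exact tiltDeg_coeff_zero hw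
  | succ j ih =>
    have h1 := acrisDeg_teichmuller (tiltDeg_coeff_zero hw)
    have h2 : acrisMap B p n w - acrisMap B p n (teichmuller p (w.coeff 0)) =
        acrisMap B p n (verschiebung (wtl w)) := by
      conv_lhs => rw [eq_cons w]
      rw [cons_coeff_zero, ← map_sub, add_sub_cancel_left]
    have h3 := (hw.sub h1).frob
    rw [h2, frob_acrisMap, frobenius_verschiebung, mul_comm (wtl w), map_mul, map_natCast] at h3
    have h4 := ih (h3.of_natCast_mul hp.out.ne_zero)
    rw [pow_succ, mul_assoc]
    exact h4

lemma BarM.iterate_ver_apply {C : Type*} [CommRing C] [CharP C p] (M : ℕ) (x : BarM C p) (m : ℤ) :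
    (BarM.ver^[M] x).1 m = x.1 (m - M) := by
  induction M generalizing m with
  | zero => simp
  | succ M ih =>
    rw [Function.iterate_succ_apply']
    change (BarM.ver^[M] x).1 (m - 1) = _
    rw [ih]
    exact congrArg x.1 (by push_cast; ring)

lemma eq_zero_of_fbar_eq_zero {x : BarM (KeyQuot B p n) p} (hx : fbar x = 0) (m : ℤ) :
    x.1 m = 0 := by
  have h1 : ∀ M, fbar (BarM.ver^[M] x) = 0 := fun M => by
    refine frob_injective.iterate M ?_
    rw [← pow_mul_fbar acris_torsionFree, hx, mul_zero, iterate_map_zero]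
  have h2 : ∀ M, AcrisDeg 1 (acrisMap B p n (trunc x.1 M)) := fun M => by
    have h3 : acrisMap B p n (trunc x.1 M) = -∑' i, polarTerm (BarM.ver^[M] x) i := by
      rw [eq_neg_iff_add_eq_zero, ← h1 M, fbar]
      congr 2
      ext1 i
      rw [trunc, coeff_mk, coeff_mk, BarM.iterate_ver_apply]
    rw [h3]
    refine AcrisDeg.neg (AcrisDeg.of_forall_pow_dvd fun N =>
      ⟨_, AcrisDeg.sum fun i _ => ?_, pow_dvd_tsum_polarTerm_sub _ N⟩)
    rw [polarTerm_eq_polar]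
    exact acrisDeg_polar _ ((BarM.ver^[M] x).2.1 _ (by omega))
  refine eq_zero_of_forall_tiltDeg fun d => ?_
  have h3 := tiltDeg_coeff (h2 (d + m.natAbs)) (m + (d + m.natAbs)).toNat
  rw [trunc, coeff_mk, mul_one] at h3
  have h4 : (((m + (d + m.natAbs)).toNat : ℕ) : ℤ) - ((d + m.natAbs : ℕ) : ℤ) = m := by omega
  rw [h4] at h3
  refine h3.mono ?_
  rw [← Nat.cast_pow, Nat.cast_le]
  have h5 : d ≤ (m + (d + m.natAbs)).toNat := by omega
  exact h5.trans (Nat.lt_pow_self hp.out.one_lt).le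

end degrees

end Fontaine

namespace Fontaine
open WittVector

noncomputable section surjectivity
open Filter

variable {B : Type*} [CommRing B] {p : ℕ} [hp : Fact p.Prime] [CharP B p] [PerfectRing B p]
  {n : ℕ}

lemma coeff_eq_zero_of_pow_dvd {R : Type*} [CommRing R] [CharP R p] {m : ℕ}
    {w : WittVector p R} (h : (p : WittVector p R) ^ m ∣ w) {i : ℕ} (hi : i < m) :
    w.coeff i = 0 := by
  obtain ⟨t, rfl⟩ := h
  induction m generalizing i t with
  | zero => exact absurd hi (Nat.not_lt_zero i)
  | succ m ih =>
    rw [pow_succ', mul_assoc, mul_comm]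
    cases i with
    | zero => exact mul_charP_coeff_zero _
    | succ i => rw [mul_charP_coeff_succ, ih (by omega) t, zero_pow hp.out.ne_zero]

lemma coeff_eq_of_pow_dvd_sub {R : Type*} [CommRing R] [CharP R p] {m : ℕ}
    {w z : WittVector p R} (h : (p : WittVector p R) ^ m ∣ w - z) {i : ℕ} (hi : i < m) :
    w.coeff i = z.coeff i :=
  (le_coeff_eq_iff_le_sub_coeff_eq_zero (n := m)).mpr
    (fun _ hj => coeff_eq_zero_of_pow_dvd h hj) i hi

section coordinates

variable {R : Type*} [CommRing R] [CharP R p] (I : Ideal R)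

lemma add_coeff_mem_pow {j : ℕ} {c d : WittVector p R}
    (hc : ∀ i ≤ j, c.coeff i ∈ I ^ (1 + (p - 1) * i))
    (hd : ∀ i ≤ j, d.coeff i ∈ I ^ (1 + (p - 1) * i)) :
    (c + d).coeff j ∈ I ^ (1 + (p - 1) * j) := by
  have hI : ∀ i, I ^ (1 + (p - 1) * i) ≤ I := fun i => Ideal.pow_le_self (by omega)
  have hq : ∀ i ≤ j, qfun p j j i = 1 + (p - 1) * i := fun i hi => by
    rw [qfun, Nat.sub_self, Nat.sub_zero, min_eq_left hi]
  have h := add_filt I (fun q => I ^ q) (fun q => by rw [← pow_succ'])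
    (fun _ _ h => Ideal.pow_le_pow_right h) j (qfun p j j) j c 0 d 0 (qfun_adm j j)
    (fun i _ hi => ⟨hI i (hc i hi), by rw [zero_coeff]; exact I.zero_mem, hI i (hd i hi),
      by rw [zero_coeff]; exact I.zero_mem⟩)
    (fun i hi => by rw [zero_coeff, sub_zero, sub_zero, hq i hi]; exact ⟨hc i hi, hd i hi⟩)
  rwa [add_zero, zero_coeff, sub_zero, hq j le_rfl] at h

lemma coeff_mem_pow_of_mem_span {ι : Type*} [Fintype ι] {t : ι → R} (ht : ∀ i, t i ∈ I)
    {w : WittVector p R} (hw : w ∈ Ideal.span (Set.range fun i => teichmuller p (t i))) (j : ℕ) :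
    w.coeff j ∈ I ^ (1 + (p - 1) * j) := by
  classical
  obtain ⟨c, rfl⟩ := Submodule.mem_span_range_iff_exists_fun _ |>.mp hw
  generalize (Finset.univ : Finset ι) = s
  induction s using Finset.induction_on generalizing j with
  | empty => rw [Finset.sum_empty, zero_coeff]; exact Ideal.zero_mem _
  | insert i s hi ih =>
    rw [Finset.sum_insert hi]
    refine add_coeff_mem_pow I (fun k _ => ?_) fun k _ => ih k
    rw [smul_eq_mul, mul_comm (c i), teich_mul_coeff]
    refine Ideal.mul_mem_right _ _ (Ideal.pow_le_pow_right ?_ (Ideal.pow_mem_pow (ht i) (p ^ k)))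
    have := one_add_mul_le_pow_of_sq_nonneg (R := ℕ) (a := p - 1) (Nat.zero_le _) (Nat.zero_le _) (Nat.zero_le _) k
    rwa [Nat.add_sub_cancel' hp.out.one_le, mul_comm, Nat.cast_id] at this

end coordinates

section convergence

variable {C : Type*} [CommRing C] [CharP C p]

/-- The partial sums `∑_{L ≤ N} V^{N - L} w_L`. -/
def layerSum {R : Type*} [CommRing R] (w : ℕ → WittVector p R) : ℕ → WittVector p R
  | 0 => w 0
  | N + 1 => verschiebung (layerSum w N) + w (N + 1)

lemma layerSum_succ {R : Type*} [CommRing R] (w : ℕ → WittVector p R) (N : ℕ) :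
    layerSum w (N + 1) = verschiebung (layerSum w N) + w (N + 1) := rfl

lemma layerSum_coeff_mem {R : Type*} [CommRing R] [CharP R p] {I : Ideal R} {w : ℕ → WittVector p R}
    (hw : ∀ N j, (w (N + 1)).coeff j ∈ I) (N j : ℕ) (hj : j < N) :
    (layerSum w N).coeff j ∈ I := by
  induction N generalizing j with
  | zero => exact absurd hj (Nat.not_lt_zero j)
  | succ N ih =>
    rw [layerSum_succ]
    refine add_coeff_mem I j _ _ (fun i hi => ?_) fun i _ => hw N i
    cases i with
    | zero => rw [verschiebung_coeff_zero]; exact I.zero_mem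
    | succ i => rw [verschiebung_coeff_succ]; exact ih i (by omega)

lemma exists_nilLim_layerSum {I : Ideal (Perfection C p)} (hI : TopNilpotent I)
    (hI0 : I ≤ RingHom.ker (Perfection.coeff C p 0)) {w : ℕ → WittVector p (Perfection C p)}
    (hw : ∀ N j, (w (N + 1)).coeff j ∈ I ^ (1 + (p - 1) * j)) :
    ∃ x, NilLim (layerSum w) x := by
  have hw' : ∀ N j, (w (N + 1)).coeff j ∈ I := fun N j => Ideal.pow_le_self (by omega) (hw N j)
  have hy := layerSum_coeff_mem hw'
  obtain ⟨x, hx⟩ := exists_isLim (s := layerSum w) fun k m => by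
    obtain ⟨r, hr⟩ := hI k
    filter_upwards [eventually_gt_atTop (m.natAbs + r)] with N hN
    obtain ⟨N, rfl⟩ : ∃ N', N = N' + 1 := ⟨N - 1, by omega⟩
    set L := N + 1 - m.natAbs with hL
    have h1 : (vshift (layerSum w) (N + 1)) = verschiebung (layerSum w N) + 0 := by
      rw [add_zero]; rfl
    have h2 : ∀ i < L, (verschiebung (layerSum w N)).coeff i ∈ I := fun i hi => by
      cases i with
      | zero => rw [verschiebung_coeff_zero]; exact I.zero_mem
      | succ i => rw [verschiebung_coeff_succ]; exact hy N i (by omega)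
    have h3 := add_filt I (fun q => I ^ q) (fun q => by rw [← pow_succ'])
      (fun _ _ h => Ideal.pow_le_pow_right h) (m + (N + 1 : ℕ)).toNat (qfun p L L) L
      (verschiebung (layerSum w N)) (verschiebung (layerSum w N)) (w (N + 1)) 0 (qfun_adm L L)
      (fun i hi _ => ⟨h2 i hi, h2 i hi, hw' N i, by rw [zero_coeff]; exact I.zero_mem⟩)
      (fun i hi => by
        refine ⟨by rw [sub_self]; exact Ideal.zero_mem _, ?_⟩
        rw [zero_coeff, sub_zero]
        refine Ideal.pow_le_pow_right ?_ (hw N i)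
        exact Nat.add_le_add_left (Nat.mul_le_mul_left _ (by omega)) _)
    have h4 := hr (Ideal.pow_le_pow_right ((by omega : r ≤ L).trans
      (le_qfun (p := p) (le_refl L) (by omega))) h3)
    rw [RingHom.mem_ker, map_sub, sub_eq_zero] at h4
    rw [h1]
    exact h4
  exact ⟨x, ⟨I, hI, hI0, hy⟩, hx⟩

end convergence

/-- A partial expansion of an element of `A_cris(C)`, over exponents `α` for which `⌊α⌋!` is
prime to `p`, comes from a Witt vector. -/
lemma exists_witt_expands {b : Expo p n → WittVector p B} {v : KeyAcris B p n}
    (hb : Expands b v) (S : Set (Expo p n)) [DecidablePred (· ∈ S)]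
    (hS : ∀ α ∈ S, (Expo.fac α).Coprime p) :
    ∃ w : KeyWitt B p n, Expands (fun α => if α ∈ S then b α else 0) (acrisMap B p n w) ∧
      ∀ T : Ideal (KeyWitt B p n), (∀ α ∈ S, teichmuller p (mono 1 α) ∈ T) →
        ∀ m : ℕ, ∃ z ∈ T, (p : KeyWitt B p n) ^ m ∣ w - z := by
  have h1 : ∀ α, ∃ c : WittVector p B, α ∈ S → c * (Expo.fac α : ℕ) = 1 := fun α => by
    by_cases h : α ∈ S
    · obtain ⟨c, hc⟩ := (isUnit_natCast_of_coprime (p := p) (S := WittVector p B)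
        (hS α h)).exists_left_inv
      exact ⟨c, fun _ => hc⟩
    · exact ⟨0, fun h' => absurd h' h⟩
  choose inv hinv using h1
  let Z : (Expo p n →₀ WittVector p B) → KeyWitt B p n := fun f =>
    f.sum fun α c => if α ∈ S then constW B p n (c * inv α) * teichmuller p (mono 1 α) else 0
  have hZsub : ∀ f g, Z (f - g) = Z f - Z g := fun f g =>
    Finsupp.sum_sub_index fun α c d => by
      split_ifs
      · rw [sub_mul, map_sub, sub_mul]
      · rw [sub_zero]
  have hZT : ∀ (T : Ideal (KeyWitt B p n)), (∀ α ∈ S, teichmuller p (mono 1 α) ∈ T) →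
      ∀ f, Z f ∈ T := fun T hT f => Ideal.sum_mem _ fun α _ => by
    dsimp only
    split_ifs with h
    · exact T.mul_mem_left _ (hT α h)
    · exact T.zero_mem
  have hZdvd : ∀ (m : ℕ) f, (∀ α, (p : WittVector p B) ^ m ∣ f α) →
      (p : KeyWitt B p n) ^ m ∣ Z f := fun m f hf => Finset.dvd_sum fun α _ => by
    dsimp only
    split_ifs with h
    · have := map_dvd (constW B p n) ((hf α).mul_right (inv α))
      rw [map_pow, map_natCast] at this
      exact this.mul_right _
    · exact dvd_zero _
  have hZA : ∀ f, acrisMap B p n (Z f) = combA B p n (f.filter (· ∈ S)) := fun f => by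
    change acrisMap B p n (∑ α ∈ f.support, if α ∈ S then
      constW B p n (f α * inv α) * teichmuller p (mono 1 α) else 0) = _
    rw [combA_apply, Finsupp.support_filter, Finset.sum_filter, map_sum]
    refine Finset.sum_congr rfl fun α _ => ?_
    split_ifs with h
    · rw [Finsupp.filter_apply_pos _ _ h, map_mul, ← fac_mul_acrisMono, ← mul_assoc,
        ← map_natCast (acrisMap B p n), ← map_natCast (constW B p n), ← map_mul, ← map_mul,
        mul_assoc, hinv α h, mul_one]
    · rw [map_zero]
  choose f hf using hb
  obtain ⟨w, hw⟩ := exists_forall_pow_dvd_sub (p := p) (f := fun m => Z (f m)) fun m => by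
    rw [← hZsub]
    refine hZdvd m _ fun α => ?_
    rw [Finsupp.sub_apply, ← sub_sub_sub_cancel_left _ _ (b α)]
    exact dvd_sub ((hf m).2 α) ((pow_dvd_pow _ (Nat.le_succ m)).trans ((hf (m + 1)).2 α))
  refine ⟨w, fun m => ⟨(f m).filter (· ∈ S), ?_, fun α => ?_⟩,
    fun T hT m => ⟨Z (f m), hZT T hT _, hw m⟩⟩
  · have := map_dvd (acrisMap B p n) (hw m)
    rwa [map_pow, map_natCast, map_sub, hZA] at this
  · change _ ∣ (if α ∈ S then b α else 0) - _
    split_ifs with h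
    · rw [Finsupp.filter_apply_pos _ _ h]; exact (hf m).2 α
    · rw [Finsupp.filter_apply_neg _ _ h, sub_zero]; exact dvd_zero _

variable (p n) in
/-- The exponents `α` with all `α_i < p` and, for `L ≠ 0`, some `α_i ≥ 1`. -/
def layer (L : ℕ) : Set (Expo p n) :=
  {α | (∀ i, (α i : ℚ≥0) < p) ∧ (L ≠ 0 → ∃ i, 1 ≤ (α i : ℚ≥0))}

lemma coprime_fac_of_mem_layer {L : ℕ} {α : Expo p n} (h : α ∈ layer p n L) :
    (Expo.fac α).Coprime p := by
  refine Nat.Coprime.prod_left fun i _ => ?_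
  refine ((Nat.Prime.coprime_iff_not_dvd hp.out).mpr fun hd => ?_).symm
  rw [hp.out.dvd_factorial] at hd
  refine absurd hd (not_le.mpr ?_)
  exact (Nat.floor_lt zero_le).mpr (h.1 i)

lemma teichmuller_mem_span_of_mem_layer {L : ℕ} (hL : L ≠ 0) {α : Expo p n}
    (h : α ∈ layer p n L) : teichmuller p (mono (1 : B) α) ∈
      Ideal.span (Set.range fun i => teichmuller p (tiltX B p n i)) := by
  obtain ⟨i, hi⟩ := h.2 hL
  obtain ⟨β, rfl⟩ := Expo.exists_add_single hi
  rw [← mul_one (1 : B), ← mono_mul, map_mul]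
  exact Ideal.mul_mem_left _ _ (Ideal.subset_span ⟨i, rfl⟩)

open Classical in
lemma exists_layer {a : Expo p n → WittVector p B} {u : KeyAcris B p n} (ha : Expands a u)
    (hu : u ∈ Acris.prime (KeyQuot B p n) p) (L : ℕ) :
    ∃ (w : KeyWitt B p n) (v : KeyAcris B p n),
      acrisMap B p n (WittVector.frobenius^[L] w) = (p : KeyAcris B p n) ^ L * v ∧
      Expands (fun α => if Expo.div L α ∈ layer p n L then a α else 0) v ∧
      (L ≠ 0 → ∀ j, w.coeff j ∈ Ideal.span (Set.range (tiltX B p n)) ^ (1 + (p - 1) * j)) := by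
  obtain ⟨v, hv⟩ := hu L
  obtain ⟨b, hb⟩ := exists_expands v
  obtain ⟨b', h1, h2⟩ := hb.frob_iterate L
  obtain ⟨w, hw, hT⟩ := exists_witt_expands hb (layer p n L) fun _ => coprime_fac_of_mem_layer
  obtain ⟨c, h3, h4⟩ := hw.frob_iterate L
  have h5 := ha.natCast_mul (p ^ L)
  rw [Nat.cast_pow (α := KeyAcris B p n), hv] at h5
  have h6 := h1.unique h5
  have h7 : ∀ β, c β = ((p ^ L : ℕ) : WittVector p B) *
      if Expo.div L β ∈ layer p n L then a β else 0 := fun β => by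
    refine wittVector_natCast_mul_cancel (Expo.fac_ne_zero (Expo.div L β)) ?_
    rw [h4 β]
    split_ifs
    · rw [← h2 β, h6]
    · rw [iterate_map_zero, mul_zero, mul_zero, mul_zero]
  have h8 : acrisMap B p n (WittVector.frobenius^[L] w) = Acris.frob^[L] (acrisMap B p n w) :=
    (frob_iterate_acrisMap L w).symm
  obtain ⟨v', hv'⟩ := h3.pow_dvd_of_forall (m := L) fun β => by
    rw [h7 β, Nat.cast_pow]; exact dvd_mul_right _ _
  refine ⟨w, v', h8.trans hv', ?_, fun hL j => ?_⟩
  · obtain ⟨c', hc'⟩ := exists_expands v'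
    have h9 := hc'.natCast_mul (p ^ L)
    rw [Nat.cast_pow (α := KeyAcris B p n), ← hv'] at h9
    have h10 := h9.unique h3
    convert hc' using 1
    funext β
    refine wittVector_natCast_mul_cancel (k := p ^ L) (pow_pos hp.out.pos L).ne' ?_
    rw [← h7 β, ← h10, Nat.cast_pow]
  · obtain ⟨z, hz, hd⟩ := hT _ (fun α => teichmuller_mem_span_of_mem_layer hL) (j + 1)
    rw [coeff_eq_of_pow_dvd_sub hd (Nat.lt_succ_self j)]
    exact coeff_mem_pow_of_mem_span _ (fun i => Ideal.subset_span (Set.mem_range_self i)) hz j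

open Classical in
lemma layer_add (a : Expo p n → WittVector p B) (N : ℕ) (α : Expo p n) :
    ((if ∀ i, (α i : ℚ≥0) < p ^ (N + 1) then a α else 0) +
      if Expo.div (N + 1) α ∈ layer p n (N + 1) then a α else 0) =
    if ∀ i, (α i : ℚ≥0) < p ^ (N + 1 + 1) then a α else 0 := by
  have hpos : (0 : ℚ≥0) < (p : ℚ≥0) ^ (N + 1) := pow_pos (Nat.cast_pos.mpr hp.out.pos) _
  have h1 : ∀ i, (Expo.div (N + 1) α i : ℚ≥0) < p ↔ (α i : ℚ≥0) < p ^ (N + 1 + 1) := fun i => by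
    rw [Expo.coe_div, div_lt_iff₀ hpos, ← pow_succ']
  have h2 : Expo.div (N + 1) α ∈ layer p n (N + 1) ↔ (∀ i, (α i : ℚ≥0) < p ^ (N + 1 + 1)) ∧
      ¬ ∀ i, (α i : ℚ≥0) < p ^ (N + 1) := by
    refine and_congr (forall_congr' h1) ?_
    simp only [ne_eq, Nat.succ_ne_zero, not_false_eq_true, forall_const, not_forall, not_lt]
    exact exists_congr fun i => by rw [Expo.coe_div, one_le_div hpos]
  by_cases h3 : ∀ i, (α i : ℚ≥0) < p ^ (N + 1)
  · have h4 : ∀ i, (α i : ℚ≥0) < p ^ (N + 1 + 1) := fun i => (h3 i).trans_le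
      (pow_le_pow_right₀ (Nat.one_le_cast.mpr hp.out.one_le) (Nat.le_succ _))
    rw [if_pos h3, if_neg fun h => (h2.mp h).2 h3, if_pos h4, add_zero]
  · rw [if_neg h3, zero_add]
    exact if_congr (h2.trans (and_iff_left h3)) rfl rfl

lemma exists_fbar_eq {u : KeyAcris B p n} (hu : u ∈ Acris.prime (KeyQuot B p n) p) :
    ∃ x, fbar x = u := by
  classical
  obtain ⟨a, ha⟩ := exists_expands u
  choose w v hwv hv hw using exists_layer ha hu
  have hI0 : Ideal.span (Set.range (tiltX B p n)) ≤ RingHom.ker (Perfection.coeff _ p 0) := by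
    rw [Ideal.span_le]
    rintro _ ⟨i, rfl⟩
    exact coeff_zero_tiltX i
  obtain ⟨x, hx⟩ := exists_nilLim_layerSum topNilpotent_span_tiltX hI0 (w := w)
    fun N => hw (N + 1) N.succ_ne_zero
  refine ⟨⟨x, hx.mem⟩, ?_⟩
  have h1 : ∀ N, ∃ U, acrisMap B p n (WittVector.frobenius^[N] (layerSum w N)) =
      (p : KeyAcris B p n) ^ N * U ∧
      Expands (fun α => if ∀ i, (α i : ℚ≥0) < p ^ (N + 1) then a α else 0) U := fun N => by
    induction N with
    | zero =>
      refine ⟨v 0, hwv 0, ?_⟩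
      convert hv 0 using 4 with α
      rw [Expo.div_zero', zero_add, pow_one]
      exact ⟨fun h => ⟨h, fun h' => absurd rfl h'⟩, fun h => h.1⟩
    | succ N ih =>
      obtain ⟨U, h1, h2⟩ := ih
      refine ⟨U + v (N + 1), ?_, ?_⟩
      · rw [layerSum_succ, iterate_map_add, map_add, hwv, mul_add, Function.iterate_succ_apply,
          frobenius_verschiebung, iterate_map_mul, map_mul, h1]
        have : WittVector.frobenius^[N] (p : KeyWitt B p n) = p := by
          rw [← RingHom.coe_pow, map_natCast]
        rw [this, map_natCast, pow_succ]
        ring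
      · convert h2.add (hv (N + 1)) using 1
        funext α
        exact (layer_add a N α).symm
  choose U hU hUe using h1
  refine eq_of_forall_pow_dvd_sub (p := p) fun M => ?_
  have h2 : ∀ᶠ N in atTop, (p : KeyAcris B p n) ^ M ∣ u - U N := by
    obtain ⟨f, -, hf⟩ := ha M
    have h3 : ∀ᶠ N : ℕ in atTop, ∀ α ∈ f.support, ∀ i, (α i : ℚ≥0) < p ^ (N + 1) := by
      rw [Filter.eventually_all_finset]
      intro α _
      rw [Filter.eventually_all]
      intro i
      filter_upwards [eventually_ge_atTop ⌈(α i : ℚ≥0)⌉₊] with N hN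
      refine (Nat.le_ceil _).trans_lt ?_
      rw [← Nat.cast_pow, Nat.cast_lt]
      exact (hN.trans (Nat.le_succ N)).trans_lt (Nat.lt_pow_self hp.out.one_lt)
    filter_upwards [h3] with N hN
    refine (ha.sub (hUe N)).pow_dvd_of_forall fun α => ?_
    rw [Pi.sub_apply]
    split_ifs with h
    · rw [sub_self]; exact dvd_zero _
    · have h4 := hf α
      rwa [Finsupp.notMem_support_iff.mp fun h' => h (hN α h')] at h4
  obtain ⟨N, h3, h4⟩ := (h2.and (eventually_pow_dvd_fbar_sub acris_torsionFree
    (x := ⟨x, hx.mem⟩) hx.coeff_eq_zero hx.2 M)).exists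
  rw [hU N, ← mul_sub] at h4
  have h5 := dvd_sub (pow_dvd_of_pow_add_dvd acris_torsionFree h4) h3
  rwa [sub_sub_sub_cancel_right] at h5

variable (B p n) in
/-- The map `f̄ : M̄(C) → A'_cris(C)` as a linear map. -/
def fbarHom : BarM (KeyQuot B p n) p →ₗ[WittVector p (Perfection (KeyQuot B p n) p)]
    Acris.prime (KeyQuot B p n) p where
  toFun x := ⟨fbar x, fbar_mem_prime acris_torsionFree x⟩
  map_add' x y := Subtype.ext (fbar_add acris_torsionFree x y)
  map_smul' c x := Subtype.ext (fbar_smul acris_torsionFree c x)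

lemma fbarHom_bijective : Function.Bijective (fbarHom B p n) := by
  refine ⟨(injective_iff_map_eq_zero _).mpr fun x hx => Subtype.ext (funext fun m => ?_),
    fun u => (exists_fbar_eq u.2).imp fun _ h => Subtype.ext h⟩
  rw [eq_zero_of_fbar_eq_zero (congrArg Subtype.val hx) m]
  exact (eq_zero_of_fbar_eq_zero (congrArg Subtype.val (map_zero (fbarHom B p n))) m).symm

lemma exists_linearEquiv_fbar :
    (∀ x : BarM (KeyQuot B p n) p, Summable (polarTerm x)) ∧
    ∃ e : BarM (KeyQuot B p n) p ≃ₗ[WittVector p (Perfection (KeyQuot B p n) p)]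
        Acris.prime (KeyQuot B p n) p,
      (∀ x, (e x : Acris (KeyQuot B p n) p) = fbar x) ∧
      ∀ x, (e (BarM.frob x) : Acris (KeyQuot B p n) p) = Acris.frob (e x : Acris _ p) :=
  ⟨summable_polarTerm, LinearEquiv.ofBijective (fbarHom B p n) fbarHom_bijective, fun _ => rfl,
    fun x => fbar_frob acris_torsionFree x⟩

end surjectivity

end Fontaine

theorem mainTheorem10 (p : ℕ) [Fact p.Prime] (B : Type*) [CommRing B] [CharP B p]
    [PerfectRing B p] (n : ℕ) :
    (∀ x : Fontaine.BarM (Fontaine.KeyRing B p n) p, Summable (Fontaine.polarTerm x)) ∧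
    ∃ e : Fontaine.BarM (Fontaine.KeyRing B p n) p
        ≃ₗ[WittVector p (Perfection (Fontaine.KeyRing B p n) p)]
          Fontaine.Acris.prime (Fontaine.KeyRing B p n) p,
      (∀ x, (e x : Fontaine.Acris (Fontaine.KeyRing B p n) p) = Fontaine.fbar x) ∧
      ∀ x, (e (Fontaine.BarM.frob x) : Fontaine.Acris (Fontaine.KeyRing B p n) p)
        = Fontaine.Acris.frob (e x : Fontaine.Acris (Fontaine.KeyRing B p n) p) :=
  Fontaine.exists_linearEquiv_fbar (B := B) (p := p) (n := n)
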